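/- **Proposition 2.4.** Let $b>0$, $Q=b+b^{-1}$, and let $\theta_0,\theta_*\in\mathbb C$ with $2ib\theta_0\notin\mathbb Z$. Put $\sigma_3=\mathrm{diag}(1,-1)$. Here ${}_2F_1$ denotes the principal branch on $\mathbb C\setminus[1,\infty)$. *Hypergeometric bases.* For $\Lambda\in\mathbb R\setminus\{0\}$ set $\theta_1=\frac{\Lambda+\theta_*}{2}$, $\theta_\infty=\frac{\Lambda-\theta_*}{2}$ and, for $0<\arg z<\pi$ (all powers principal), $$F^1_\pm(z)=\left(1-\tfrac1z\right)^{\frac{bQ}2\pm ib\theta_1}z^{\frac12+b^2-ib\theta_\infty}\,{}_2F_1\!\left(\tfrac12-ib(\theta_0\mp\theta_1-\theta_\infty),\tfrac12+ib(\theta_0\pm\theta_1+\theta_\infty);1\pm2ib\theta_1;1-\tfrac1z\right),$$ $$F^\infty_\pm(z)=\left(\tfrac1z\right)^{-\frac12-b^2\mp ib\theta_\infty}\left(1-\tfrac1z\right)^{\frac{bQ}2+ib\theta_1}{}_2F_1\!\left(\tfrac12+ib(\theta_0+\theta_1\mp\theta_\infty),\tfrac12-ib(\theta_0-\theta_1\pm\theta_\infty);1\mp2ib\theta_\infty;\tfrac1z\right).$$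 For $p\in\{1,\infty\}$ let $\tilde{\boldsymbol F}^p(z,\Lambda)=N_\infty(\Lambda)\,(F^p_+(z),F^p_-(z))^T$, where $N_\infty(\Lambda)=\mathrm{diag}(Q_+(\Lambda),Q_-(\Lambda))$ and $$Q_\pm(\Lambda)=e^{-\frac{i\pi bQ}{2}}e^{\pm\frac{\pi b}{2}(\theta_*+\Lambda)}(ib\Lambda)^{\frac b2(b\mp2i\theta_*)}.$$ *Confluent bases.* On the universal cover of $\mathbb C\setminus\{0\}$ let $$\boldsymbol D_n(t)=t^{\frac{b^2}2}\begin{pmatrix}e^{2\pi b\theta_*\lfloor\frac{n-1}2\rfloor}\,W_{-ib\theta_*,-ib\theta_0}\!\left(e^{-2i\pi\lfloor\frac{n-1}2\rfloor}t\right)\\ e^{-2\pi b\theta_*(\lfloor\frac n2\rfloor-\frac12)}\,W_{ib\theta_*,-ib\theta_0}\!\left(e^{-2i\pi(\lfloor\frac n2\rfloor-\frac12)}t\right)\end{pmatrix},\qquad n\in\mathbb Z,$$ with $W_{k,\mu}$ the Whittaker function of the second kind, analytically continued to the universal cover. Let $$\Omega_n^-=\left\{-\tfrac{3\pi}2+\pi(n-1)<\arg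 t<-\tfrac\pi2+\pi(n-1)\right\},\qquad \Omega_n^+=\left\{-\tfrac\pi2+\pi(n-1)<\arg t<\tfrac\pi2+\pi(n-1)\right\}.$$ *(1) Limits of the bases.* For every integer $j\ge1$, pointwise in $t$, $$\left(e^{i\pi b^2}e^{2\pi b\theta_*\sigma_3}\right)^{j-1}\lim_{\Lambda\to+\infty}\tilde{\boldsymbol F}^\infty\!\left(\frac{te^{-2i\pi(j-1)}}{ib\epsilon\Lambda},\epsilon\Lambda\right)=\begin{cases}\boldsymbol D_{2j+1}(t),&t\in\Omega_{2j+1}^-,\ \epsilon=+1,\\ \boldsymbol D_{2j}(t),&t\in\Omega_{2j}^-,\ \epsilon=-1,\end{cases}$$ $$\left(e^{i\pi b^2}e^{2\pi b\theta_*\sigma_3}\right)^{j-1}\lim_{\Lambda\to+\infty}\tilde{\boldsymbol F}^1\!\left(\frac{te^{-2i\pi(j-1)}}{ib\epsilon\Lambda},\epsilon\Lambda\right)=\begin{cases}\boldsymbol D_{2j}(t),&t\in\Omega_{2j}^+,\ \epsilon=+1,\\ \boldsymbol D_{2j-1}(t),&t\in\Omega_{2j-1}^+,\ \epsilon=-1.\end{cases}$$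 (In each of these cases the first argument $z$ satisfies $0<\arg z<\pi$.) *(2) Connection and Stokes matrices.* For real $\Lambda\ne0$ with $ib(\Lambda\pm\theta_*)\notin\mathbb Z$ there is exactly one matrix $\tilde C_{\infty1}(\Lambda)$ with $\tilde{\boldsymbol F}^\infty(z,\Lambda)=\tilde C_{\infty1}(\Lambda)\tilde{\boldsymbol F}^1(z,\Lambda)$ for all $0<\arg z<\pi$, namely $\tilde C_{\infty1}(\Lambda)=N_\infty(\Lambda)C_{\infty1}N_\infty(\Lambda)^{-1}$ with $$C_{\infty1}=\begin{pmatrix}\frac{\Gamma(-2ib\theta_1)\Gamma(1-2ib\theta_\infty)}{\Gamma(\frac12-ib(-\theta_0+\theta_1+\theta_\infty))\Gamma(\frac12-ib(\theta_0+\theta_1+\theta_\infty))}&\frac{\Gamma(2ib\theta_1)\Gamma(1-2ib\theta_\infty)}{\Gamma(\frac12+ib(\theta_0+\theta_1-\theta_\infty))\Gamma(\frac12-ib(\theta_0-\theta_1+\theta_\infty))}\\ \frac{\Gamma(-2ib\theta_1)\Gamma(1+2ib\theta_\infty)}{\Gamma(\frac12-ib(\theta_0+\theta_1-\theta_\infty))\Gamma(\frac12+ib(\theta_0-\theta_1+\theta_\infty))}&\frac{\Gamma(2ib\theta_1)\Gamma(1+2ib\theta_\infty)}{\Gamma(\frac12-ib(\theta_0-\theta_1-\theta_\infty))\Gamma(\frac12+ib(\theta_0+\theta_1+\theta_\infty))}\end{pmatrix}.$$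 For $n=1,2$ there is exactly one matrix $S_n$ with $\boldsymbol D_{n+1}(t)=S_n\boldsymbol D_n(t)$ for all $t$, namely $$S_1=\begin{pmatrix}1&0\\ \frac{-2i\pi}{\Gamma(\frac12-ib(\theta_0+\theta_*))\Gamma(\frac12+ib(\theta_0-\theta_*))}&1\end{pmatrix},\qquad S_2=\begin{pmatrix}1&\frac{-2i\pi e^{2\pi b\theta_*}}{\Gamma(\frac12-ib(\theta_0-\theta_*))\Gamma(\frac12+ib(\theta_0+\theta_*))}\\0&1\end{pmatrix}.$$ *(3) Limits of the connection matrices.* $$\lim_{\Lambda\to+\infty}\tilde C_{\infty1}(\Lambda)=S_2,\qquad\lim_{\Lambda\to+\infty}\tilde C_{\infty1}(-\Lambda)=S_1.$$ -/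

import Mathlib

open Filter Topology Matrix

noncomputable section

namespace ConfluentBPZ

/-! ### Hypergeometric and confluent hypergeometric functions -/

/-- The cut plane `ℂ ∖ [1, ∞)`, the domain of the principal branch of `₂F₁`. -/
def cutPlane : Set ℂ := {z | 1 - z ∈ Complex.slitPlane}

open Classical in
/-- The principal branch of the Gauss hypergeometric function on `ℂ ∖ [1, ∞)`: the analytic
continuation of the hypergeometric series from the unit disk. The cut plane is connected, so there
is only one such continuation, and it exists whenever `c ∉ {0, -1, -2, …}`. -/
def gaussF (a b c z : ℂ) : ℂ :=
  if h : ∃ f : ℂ → ℂ, DifferentiableOn ℂ f cutPlane ∧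
      ∀ w ∈ Metric.ball (0 : ℂ) 1, f w = ₂F₁ a b c w
  then Classical.choose h z else 0

/-- Kummer's function `₁F₁(a; c; z) = ∑ (a)ₙ / (c)ₙ zⁿ / n!` for `c ∉ {0, -1, -2, …}`
(Mathlib's series carries the additional factor `1 / Γ(c)`). -/
def kummerM (a c z : ℂ) : ℂ := Complex.Gamma c * Complex.regularizedHGFun {a} {c} z

/-! In what follows a point `t` of the universal cover of `ℂ ∖ {0}` is given by its logarithm
`s = log |t| + i arg t`, with `arg t` any real number; so `t ^ α = exp (α s)`, and `exp (iφ) t` has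
logarithm `s + iφ`. -/

/-- Tricomi's function `U(a, c, t)` at the point `t` with logarithm `s`. -/
def tricomiU (a c s : ℂ) : ℂ :=
  Complex.Gamma (1 - c) / Complex.Gamma (a + 1 - c) * kummerM a c (Complex.exp s) +
    Complex.Gamma (c - 1) / Complex.Gamma a * Complex.exp ((1 - c) * s) *
      kummerM (a + 1 - c) (2 - c) (Complex.exp s)

/-- The Whittaker function of the second kind `W_{k,μ}(t)` at the point `t` with logarithm `s`. -/
def whittakerW (k μ s : ℂ) : ℂ :=
  Complex.exp (-(Complex.exp s / 2)) * Complex.exp ((μ + 1 / 2) * s) *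
    tricomiU (μ - k + 1 / 2) (1 + 2 * μ) s

/-! ### Bases of the confluent BPZ equation -/

/-- The basis `D_n(t)`, at the point `t` with logarithm `s`. Division in `ℤ` by `2` rounds
downwards, so it is the floor. -/
def confD (b θ₀ θs : ℂ) (n : ℤ) (s : ℂ) : Fin 2 → ℂ :=
  let p : ℂ := (((n - 1) / 2 : ℤ) : ℂ)
  let q : ℂ := ((n / 2 : ℤ) : ℂ) - 1 / 2
  ![Complex.exp (b ^ 2 / 2 * s) * (Complex.exp (2 * Real.pi * b * θs * p) *
      whittakerW (-Complex.I * b * θs) (-Complex.I * b * θ₀) (s - 2 * Real.pi * Complex.I * p)),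
    Complex.exp (b ^ 2 / 2 * s) * (Complex.exp (-(2 * Real.pi * b * θs * q)) *
      whittakerW (Complex.I * b * θs) (-Complex.I * b * θ₀) (s - 2 * Real.pi * Complex.I * q))]

/-- The half Stokes sector `Ω_n⁻`, as the set of logarithms of its points. -/
def sectorMinus (n : ℤ) : Set ℂ :=
  {s | -(3 * Real.pi / 2) + Real.pi * (n - 1) < s.im ∧ s.im < -(Real.pi / 2) + Real.pi * (n - 1)}

/-- The half Stokes sector `Ω_n⁺`, as the set of logarithms of its points. -/
def sectorPlus (n : ℤ) : Set ℂ :=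
  {s | -(Real.pi / 2) + Real.pi * (n - 1) < s.im ∧ s.im < Real.pi / 2 + Real.pi * (n - 1)}

/-- `S` is the Stokes matrix of index `n`: it takes `D_n` to `D_{n+1}`. -/
def IsStokesMatrix (b θ₀ θs : ℂ) (n : ℤ) (S : Matrix (Fin 2) (Fin 2) ℂ) : Prop :=
  ∀ s : ℂ, confD b θ₀ θs (n + 1) s = S *ᵥ confD b θ₀ θs n s

/-- The explicit matrix `S_1`. -/
def stokes1 (b θ₀ θs : ℂ) : Matrix (Fin 2) (Fin 2) ℂ :=
  !![1, 0;
    -(2 * Complex.I * Real.pi) / (Complex.Gamma (1 / 2 - Complex.I * b * (θ₀ + θs)) *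
      Complex.Gamma (1 / 2 + Complex.I * b * (θ₀ - θs))), 1]

/-- The explicit matrix `S_2`. -/
def stokes2 (b θ₀ θs : ℂ) : Matrix (Fin 2) (Fin 2) ℂ :=
  !![1, -(2 * Complex.I * Real.pi * Complex.exp (2 * Real.pi * b * θs)) /
      (Complex.Gamma (1 / 2 - Complex.I * b * (θ₀ - θs)) *
        Complex.Gamma (1 / 2 + Complex.I * b * (θ₀ + θs)));
    0, 1]

/-! ### Bases of the hypergeometric BPZ equation

These are used in the upper half plane `0 < arg z < π`, where all powers have their principal
values and the arguments `1 / z` and `1 - 1 / z` lie in the cut plane. -/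

/-- `Q = b + 1 / b`. -/
def Q (b : ℂ) : ℂ := b + b⁻¹

/-- `F^1_±(z)`, for `σ = ±1`. -/
def F1comp (b θ₀ θ₁ θi σ z : ℂ) : ℂ :=
  (1 - 1 / z) ^ (b * Q b / 2 + σ * Complex.I * b * θ₁) *
    z ^ (1 / 2 + b ^ 2 - Complex.I * b * θi) *
    gaussF (1 / 2 - Complex.I * b * (θ₀ - σ * θ₁ - θi))
      (1 / 2 + Complex.I * b * (θ₀ + σ * θ₁ + θi))
      (1 + σ * 2 * Complex.I * b * θ₁) (1 - 1 / z)

/-- `F^∞_±(z)`, for `σ = ±1`. -/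
def FInfcomp (b θ₀ θ₁ θi σ z : ℂ) : ℂ :=
  (1 / z) ^ (-(1 / 2) - b ^ 2 - σ * Complex.I * b * θi) *
    (1 - 1 / z) ^ (b * Q b / 2 + Complex.I * b * θ₁) *
    gaussF (1 / 2 + Complex.I * b * (θ₀ + θ₁ - σ * θi))
      (1 / 2 - Complex.I * b * (θ₀ - θ₁ + σ * θi))
      (1 - σ * 2 * Complex.I * b * θi) (1 / z)

/-- The basis `F^1(z)`. -/
def F1 (b θ₀ θ₁ θi z : ℂ) : Fin 2 → ℂ :=
  ![F1comp b θ₀ θ₁ θi 1 z, F1comp b θ₀ θ₁ θi (-1) z]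

/-- The basis `F^∞(z)`. -/
def FInf (b θ₀ θ₁ θi z : ℂ) : Fin 2 → ℂ :=
  ![FInfcomp b θ₀ θ₁ θi 1 z, FInfcomp b θ₀ θ₁ θi (-1) z]

/-- The explicit connection matrix `C_{∞1}`. -/
def connInf1 (b θ₀ θ₁ θi : ℂ) : Matrix (Fin 2) (Fin 2) ℂ :=
  let β : ℂ := Complex.I * b
  !![Complex.Gamma (-2 * β * θ₁) * Complex.Gamma (1 - 2 * β * θi) /
      (Complex.Gamma (1 / 2 - β * (-θ₀ + θ₁ + θi)) * Complex.Gamma (1 / 2 - β * (θ₀ + θ₁ + θi))),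
    Complex.Gamma (2 * β * θ₁) * Complex.Gamma (1 - 2 * β * θi) /
      (Complex.Gamma (1 / 2 + β * (θ₀ + θ₁ - θi)) * Complex.Gamma (1 / 2 - β * (θ₀ - θ₁ + θi)));
    Complex.Gamma (-2 * β * θ₁) * Complex.Gamma (1 + 2 * β * θi) /
      (Complex.Gamma (1 / 2 - β * (θ₀ + θ₁ - θi)) * Complex.Gamma (1 / 2 + β * (θ₀ - θ₁ + θi))),
    Complex.Gamma (2 * β * θ₁) * Complex.Gamma (1 + 2 * β * θi) /
      (Complex.Gamma (1 / 2 - β * (θ₀ - θ₁ - θi)) * Complex.Gamma (1 / 2 + β * (θ₀ + θ₁ + θi)))]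

/-! ### Renormalization, with `θ₁ = (Λ + θ_*) / 2` and `θ_∞ = (Λ - θ_*) / 2` -/

/-- The normalization factors `Q_±(Λ)`, for `σ = ±1`. -/
def Qnorm (b θs Λ σ : ℂ) : ℂ :=
  Complex.exp (-(Complex.I * Real.pi * b * Q b / 2)) *
    Complex.exp (σ * (Real.pi * b / 2) * (θs + Λ)) *
    (Complex.I * b * Λ) ^ (b / 2 * (b - σ * 2 * Complex.I * θs))

/-- `N_∞(Λ) = diag(Q_+(Λ), Q_-(Λ))`. -/
def Ninf (b θs Λ : ℂ) : Matrix (Fin 2) (Fin 2) ℂ :=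
  Matrix.diagonal ![Qnorm b θs Λ 1, Qnorm b θs Λ (-1)]

/-- The renormalized basis `F̃^1(z, Λ)`. -/
def F1Tilde (b θ₀ θs z Λ : ℂ) : Fin 2 → ℂ :=
  Ninf b θs Λ *ᵥ F1 b θ₀ ((Λ + θs) / 2) ((Λ - θs) / 2) z

/-- The renormalized basis `F̃^∞(z, Λ)`. -/
def FInfTilde (b θ₀ θs z Λ : ℂ) : Fin 2 → ℂ :=
  Ninf b θs Λ *ᵥ FInf b θ₀ ((Λ + θs) / 2) ((Λ - θs) / 2) z

/-- `C` is the renormalized connection matrix: it takes `F̃^1` to `F̃^∞` for `0 < arg z < π`. -/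
def IsConnInf1Tilde (b θ₀ θs Λ : ℂ) (C : Matrix (Fin 2) (Fin 2) ℂ) : Prop :=
  ∀ z : ℂ, 0 < z.im → FInfTilde b θ₀ θs z Λ = C *ᵥ F1Tilde b θ₀ θs z Λ

/-- The explicit matrix `C̃_{∞1}(Λ) = N_∞(Λ) C_{∞1} N_∞(Λ)⁻¹`. -/
def connInf1Tilde (b θ₀ θs Λ : ℂ) : Matrix (Fin 2) (Fin 2) ℂ :=
  Ninf b θs Λ * connInf1 b θ₀ ((Λ + θs) / 2) ((Λ - θs) / 2) * (Ninf b θs Λ)⁻¹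

/-- The matrix `exp (iπb²) exp (2πbθ_* σ₃)`, with `σ₃ = diag(1, -1)`. -/
def phase (b θs : ℂ) : Matrix (Fin 2) (Fin 2) ℂ :=
  Complex.exp (Complex.I * Real.pi * b ^ 2) •
    Matrix.diagonal ![Complex.exp (2 * Real.pi * b * θs), Complex.exp (-(2 * Real.pi * b * θs))]

/-- `z = t exp (-2πi(j-1)) / (ibΛ)`, where `t` has logarithm `s`. For `b > 0` and `Λ = ε |Λ|` in the
half sectors of the theorem this point of the universal cover satisfies `0 < arg z < π`, so it is
the complex number given here, with its principal argument. -/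
def zPoint (b Λ : ℂ) (j : ℕ) (s : ℂ) : ℂ :=
  Complex.exp (s - 2 * Real.pi * Complex.I * ((j : ℂ) - 1)) / (Complex.I * b * Λ)

end ConfluentBPZ

end

open ConfluentBPZ

/-! # Confluent limits of hypergeometric bases and their connection matrices

The bases `F^1`, `F^∞` on the hypergeometric side and `D_n` on the confluent side are all compared
with the Frobenius bases at the origin: `F0` for the hypergeometric equation, `confX` for the
confluent one. This is possible because `2ibθ₀` is not an integer, so that the two exponents at the
origin differ by a non-integer.

* Connection formulas. Euler's integral and the contiguous relations give the continuation of `₂F₁`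
  to the cut plane. In the variable `s = log (-x)` the Wronskian shows that the solution at `0` is a
  combination of the two solutions at `∞`; its coefficients are read off from Euler's integral when
  the parameters are large, and are carried to all parameters by the contiguous relations
  (`expF_eq_connCoeff`). With the transformations of Pfaff and Euler this gives
  `F^1 = C_{10} F^0` and `F^∞ = C_{∞0} F^0` on the upper half plane, and the reflection formula of
  the Gamma function gives `C_{∞1} C_{10} = C_{∞0}`. Since `det C_{10} ≠ 0` and the components of
  `F^0` are linearly independent, the matrix taking `F̃^1` to `F̃^∞` is unique
  (`isConnInf1Tilde_iff`).

* Confluence. Put `X = ibΛ`. As `|X| → ∞`, the series `₂F₁(p + X, q; r; t / X)` tends to Kummer's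
  `M(q, r, t)` by dominated convergence, and `(1 - t / X)^(X / 2)` tends to `exp (-t / 2)`. So `F^0`,
  rescaled by powers of `X`, tends to `confX` (`tendsto_F0comp`). The entries of `N_∞ C_{10}` and
  `N_∞ C_{∞0}`, rescaled inversely, contain `Λ` only through a ratio of two Gamma functions at `±X`
  times a power of `X`. By `tendsto_Gamma_div_Gamma` they converge, and the limits are the matrices
  `connD n` with `D_n = connD n · confX`; the limits of the bases follow on the first sheet, and a
  turn around the origin multiplies by the phase matrix (`confD_add_two_mul`).

* Stokes matrices. The relation `S_n connD n = connD (n + 1)` for `n = 1, 2` is the reflection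
  formula again, and `S_n` is unique because `det (connD n) ≠ 0` and the components of `confX` have
  different monodromies. Finally `C̃_{∞1} = (N_∞ C_{∞0}) (N_∞ C_{10})⁻¹` tends to
  `connD (n + 1) (connD n)⁻¹ = S_n`, with `n = 2` for `Λ → +∞` and `n = 1` for `Λ → -∞`.
-/

namespace ConfluentBPZ

/-! ### The hypergeometric series on the unit disc -/

lemma ascPochhammer_eval_succ_left (n : ℕ) (a : ℂ) :
    (ascPochhammer ℂ (n + 1)).eval a = a * (ascPochhammer ℂ n).eval (a + 1) := by
  simp [ascPochhammer_succ_left]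

lemma ascPochhammer_eval_add_one (n : ℕ) (a : ℂ) :
    (n + a) * (ascPochhammer ℂ n).eval a = a * (ascPochhammer ℂ n).eval (a + 1) := by
  rw [← ascPochhammer_eval_succ_left, ascPochhammer_succ_eval]
  ring

lemma ascPochhammer_eval_ne_zero {c : ℂ} (hc : ∀ k : ℕ, c ≠ -k) (n : ℕ) :
    (ascPochhammer ℂ n).eval c ≠ 0 := by
  rw [Ne, ascPochhammer_eval_eq_zero_iff]
  rintro ⟨k, -, hk⟩
  exact hc k (by rw [hk]; ring)

lemma ne_neg_nat_add_one {c : ℂ} (hc : ∀ k : ℕ, c ≠ -k) (k : ℕ) : c + 1 ≠ -k := by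
  intro h
  exact hc (k + 1) (by push_cast; linear_combination h)

lemma ne_zero_of_ne_neg_nat {c : ℂ} (hc : ∀ k : ℕ, c ≠ -k) : c ≠ 0 := by
  simpa using hc 0

lemma one_le_radius_hypergeometric (a b : ℂ) {c : ℂ} (hc : ∀ k : ℕ, c ≠ -k) :
    1 ≤ (ordinaryHypergeometricSeries ℂ a b c).radius := by
  by_cases ha : ∃ k : ℕ, a = -k
  · obtain ⟨k, rfl⟩ := ha
    simp [ordinaryHypergeometric_radius_top_of_neg_nat₁]
  by_cases hb : ∃ k : ℕ, b = -k
  · obtain ⟨k, rfl⟩ := hb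
    simp [ordinaryHypergeometric_radius_top_of_neg_nat₂]
  push Not at ha hb
  rw [ordinaryHypergeometricSeries_radius_eq_one]
  intro k
  refine ⟨fun h => ha k ?_, fun h => hb k ?_, fun h => hc k ?_⟩ <;> rw [h] <;> ring

lemma hasSum_hypergeometric (a b : ℂ) {c : ℂ} (hc : ∀ k : ℕ, c ≠ -k) {x : ℂ}
    (hx : x ∈ Metric.ball (0 : ℂ) 1) :
    HasSum (fun n => ordinaryHypergeometricCoefficient a b c n * x ^ n) (₂F₁ a b c x) := by
  have h := (ordinaryHypergeometricSeries ℂ a b c).hasSum (x := x) (by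
    refine Metric.eball_subset_eball (one_le_radius_hypergeometric a b hc) ?_
    rw [← ENNReal.ofReal_one, Metric.eball_ofReal]
    exact hx)
  simp only [ordinaryHypergeometricSeries_apply_eq, smul_eq_mul] at h
  exact h

lemma summable_norm_hypergeometric (a b : ℂ) {c : ℂ} (hc : ∀ k : ℕ, c ≠ -k) {r : ℝ}
    (hr : 0 ≤ r) (hr1 : r < 1) :
    Summable (fun n => ‖ordinaryHypergeometricCoefficient a b c n‖ * r ^ n) := by
  have h := (hasSum_hypergeometric a b hc (x := (r : ℂ)) (by
    simpa [abs_of_nonneg hr] using hr1)).summable.norm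
  simpa [abs_of_nonneg hr] using h

lemma differentiableOn_hypergeometric (a b : ℂ) {c : ℂ} (hc : ∀ k : ℕ, c ≠ -k) :
    DifferentiableOn ℂ (₂F₁ a b c : ℂ → ℂ) (Metric.ball 0 1) := by
  have h := ((ordinaryHypergeometricSeries ℂ a b c).hasFPowerSeriesOnBall
    (lt_of_lt_of_le one_pos (one_le_radius_hypergeometric a b hc))).differentiableOn
  refine h.mono ?_
  rw [← Metric.eball_ofReal, ENNReal.ofReal_one]
  exact Metric.eball_subset_eball (one_le_radius_hypergeometric a b hc)

lemma hasSum_deriv_hypergeometric (a b : ℂ) {c : ℂ} (hc : ∀ k : ℕ, c ≠ -k) {x : ℂ}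
    (hx : x ∈ Metric.ball (0 : ℂ) 1) :
    HasSum (fun n : ℕ => ordinaryHypergeometricCoefficient a b c n * (n * x ^ (n - 1)))
      (deriv (₂F₁ a b c) x) := by
  obtain ⟨r, hxr, hr1⟩ := exists_between (mem_ball_zero_iff.1 hx)
  have hr : 0 ≤ r := (norm_nonneg x).trans hxr.le
  have h := Complex.hasSum_deriv_of_summable_norm (z := x)
    (F := fun n w => ordinaryHypergeometricCoefficient a b c n * w ^ n)
    (summable_norm_hypergeometric a b hc hr hr1)
    (fun n => ((differentiable_id.pow n).const_mul _).differentiableOn)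
    (Metric.isOpen_ball (x := (0 : ℂ)) (ε := r))
    (fun n w hw => by
      rw [norm_mul, norm_pow]
      have : ‖w‖ < r := mem_ball_zero_iff.1 hw
      gcongr) (by simpa using hxr)
  have he : (fun w : ℂ => ∑' n, ordinaryHypergeometricCoefficient a b c n * w ^ n)
      = ₂F₁ a b c := by
    rw [ordinaryHypergeometric_eq_tsum]
    simp [ordinaryHypergeometricCoefficient]
  rw [he] at h
  refine h.congr_fun fun n => ?_
  simp only [deriv_const_mul_field', deriv_pow_field]

lemma hypergeometric_symm (a b c x : ℂ) : ₂F₁ a b c x = ₂F₁ b a c x := by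
  simp only [ordinaryHypergeometric, ordinaryHypergeometricSeries_symm a b c]

/-- `d/dx ₂F₁(a, b; c; x) = (ab/c) ₂F₁(a+1, b+1; c+1; x)`. -/
lemma deriv_hypergeometric (a b : ℂ) {c : ℂ} (hc : ∀ k : ℕ, c ≠ -k) {x : ℂ}
    (hx : x ∈ Metric.ball (0 : ℂ) 1) :
    deriv (₂F₁ a b c) x = a * b / c * ₂F₁ (a + 1) (b + 1) (c + 1) x := by
  have h := hasSum_deriv_hypergeometric a b hc hx
  rw [← hasSum_nat_add_iff' 1] at h
  have h2 := (hasSum_hypergeometric (a + 1) (b + 1) (ne_neg_nat_add_one hc) hx).mul_left (a * b / c)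
  simp only [Finset.range_one, Finset.sum_singleton, Nat.cast_zero, zero_mul, mul_zero,
    sub_zero, Nat.add_sub_cancel] at h
  refine h.unique (h2.congr_fun ?_)
  intro n
  have hcn := ascPochhammer_eval_ne_zero (ne_neg_nat_add_one hc) n
  have hc0 := ne_zero_of_ne_neg_nat hc
  have hn : (n + 1 : ℂ) ≠ 0 := by exact_mod_cast Nat.succ_ne_zero n
  have hf : (n.factorial : ℂ) ≠ 0 := by exact_mod_cast Nat.factorial_ne_zero n
  simp only [ordinaryHypergeometricCoefficient, ascPochhammer_eval_succ_left, Nat.factorial_succ]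
  push_cast
  field_simp

lemma hasDerivAt_hypergeometric (a b : ℂ) {c : ℂ} (hc : ∀ k : ℕ, c ≠ -k) {x : ℂ}
    (hx : x ∈ Metric.ball (0 : ℂ) 1) :
    HasDerivAt (₂F₁ a b c) (a * b / c * ₂F₁ (a + 1) (b + 1) (c + 1) x) x := by
  rw [← deriv_hypergeometric a b hc hx]
  exact ((differentiableOn_hypergeometric a b hc).differentiableAt
    (Metric.isOpen_ball.mem_nhds hx)).hasDerivAt

lemma hasSum_euler_hypergeometric (a b : ℂ) {c : ℂ} (hc : ∀ k : ℕ, c ≠ -k) {x : ℂ}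
    (hx : x ∈ Metric.ball (0 : ℂ) 1) :
    HasSum (fun n : ℕ => n * (ordinaryHypergeometricCoefficient a b c n * x ^ n))
      (x * deriv (₂F₁ a b c) x) := by
  refine ((hasSum_deriv_hypergeometric a b hc hx).mul_left x).congr_fun ?_
  intro n
  cases n with
  | zero => simp
  | succ n => simp only [Nat.add_sub_cancel, pow_succ]; ring

/-- `(x d/dx + a) ₂F₁(a, b; c; x) = a ₂F₁(a+1, b; c; x)`. -/
lemma hypergeometric_raise (a b : ℂ) {c : ℂ} (hc : ∀ k : ℕ, c ≠ -k) {x : ℂ}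
    (hx : x ∈ Metric.ball (0 : ℂ) 1) :
    x * deriv (₂F₁ a b c) x + a * ₂F₁ a b c x = a * ₂F₁ (a + 1) b c x := by
  refine ((hasSum_euler_hypergeometric a b hc hx).add
    ((hasSum_hypergeometric a b hc hx).mul_left a)).unique
    (((hasSum_hypergeometric (a + 1) b hc hx).mul_left a).congr_fun ?_)
  intro n
  simp only [ordinaryHypergeometricCoefficient]
  linear_combination (n.factorial : ℂ)⁻¹ * (ascPochhammer ℂ n).eval b *
    ((ascPochhammer ℂ n).eval c)⁻¹ * x ^ n * ascPochhammer_eval_add_one n a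

/-- `(x d/dx + c) ₂F₁(a, b; c+1; x) = c ₂F₁(a, b; c; x)`. -/
lemma hypergeometric_lower (a b : ℂ) {c : ℂ} (hc : ∀ k : ℕ, c ≠ -k) {x : ℂ}
    (hx : x ∈ Metric.ball (0 : ℂ) 1) :
    x * deriv (₂F₁ a b (c + 1)) x + c * ₂F₁ a b (c + 1) x = c * ₂F₁ a b c x := by
  refine ((hasSum_euler_hypergeometric a b (ne_neg_nat_add_one hc) hx).add
    ((hasSum_hypergeometric a b (ne_neg_nat_add_one hc) hx).mul_left c)).unique
    (((hasSum_hypergeometric a b hc hx).mul_left c).congr_fun ?_)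
  intro n
  have h1 := ascPochhammer_eval_ne_zero hc n
  have h2 := ascPochhammer_eval_ne_zero (ne_neg_nat_add_one hc) n
  have h3 : (n + c) * ((ascPochhammer ℂ n).eval (c + 1))⁻¹ =
      c * ((ascPochhammer ℂ n).eval c)⁻¹ := by
    field_simp
    exact ascPochhammer_eval_add_one n c
  simp only [ordinaryHypergeometricCoefficient]
  linear_combination (n.factorial : ℂ)⁻¹ * (ascPochhammer ℂ n).eval a *
    (ascPochhammer ℂ n).eval b * x ^ n * h3

/-- The operator lowering the second parameter of `₂F₁`. -/
lemma hypergeometric_lower_right (a b : ℂ) {c : ℂ} (hc : ∀ k : ℕ, c ≠ -k) {x : ℂ}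
    (hx : x ∈ Metric.ball (0 : ℂ) 1) :
    x * (1 - x) * deriv (₂F₁ a (b + 1) c) x + (c - (b + 1) - a * x) * ₂F₁ a (b + 1) c x =
      (c - (b + 1)) * ₂F₁ a b c x := by
  have hE := hasSum_euler_hypergeometric a (b + 1) hc hx
  have hF := hasSum_hypergeometric a (b + 1) hc hx
  have h1 := hE.add (hF.mul_left (c - (b + 1)))
  have h2 := (hE.add (hF.mul_left a)).mul_left x
  have h3 : HasSum (fun n : ℕ =>
      (n + (c - (b + 1))) * (ordinaryHypergeometricCoefficient a (b + 1) c n * x ^ n) -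
      (c - (b + 1)) * (ordinaryHypergeometricCoefficient a b c n * x ^ n))
      (x * deriv (₂F₁ a (b + 1) c) x + (c - (b + 1)) * ₂F₁ a (b + 1) c x
        - (c - (b + 1)) * ₂F₁ a b c x) := by
    refine (h1.sub ((hasSum_hypergeometric a b hc hx).mul_left (c - (b + 1)))).congr_fun ?_
    intro n
    ring
  rw [← hasSum_nat_add_iff' 1] at h3
  have h4 := h3.unique (h2.congr_fun ?_)
  · simp only [ordinaryHypergeometricCoefficient] at h4
    simp at h4
    linear_combination h4
  intro n
  have hcn := ascPochhammer_eval_ne_zero hc n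
  have hcn1 := ascPochhammer_eval_ne_zero hc (n + 1)
  rw [ascPochhammer_succ_eval] at hcn1
  have hn : (n + 1 : ℂ) ≠ 0 := by exact_mod_cast Nat.succ_ne_zero n
  have hf : (n.factorial : ℂ) ≠ 0 := by exact_mod_cast Nat.factorial_ne_zero n
  have hcn2 : c + n ≠ 0 := right_ne_zero_of_mul hcn1
  have hb := ascPochhammer_eval_succ_left n b
  have e1 : (ascPochhammer ℂ (n + 1)).eval (b + 1) =
    (ascPochhammer ℂ n).eval (b + 1) * (b + 1 + n) := ascPochhammer_succ_eval ..
  simp only [ordinaryHypergeometricCoefficient, Nat.factorial_succ, e1, hb,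
    ascPochhammer_succ_eval n a, ascPochhammer_succ_eval n c]
  push_cast
  field_simp
  ring

/-! ### Euler's integral and the analytic continuation to the cut plane -/

/-- If each function of a sequence vanishes at the origin and its derivative is a multiple of the
next function of the sequence, then the Taylor series of the first one vanishes. -/
lemma eq_zero_of_hasDerivAt_succ {r : ℝ} (hr : 0 < r) (f : ℕ → ℂ → ℂ) (k : ℕ → ℂ)
    (hf : ∀ n, ∀ x ∈ Metric.ball (0 : ℂ) r, HasDerivAt (f n) (k n * f (n + 1) x) x)
    (h0 : ∀ n, f n 0 = 0) {x : ℂ} (hx : x ∈ Metric.ball (0 : ℂ) r) : f 0 x = 0 := by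
  have hit : ∀ n, ∃ K : ℂ, ∀ y ∈ Metric.ball (0 : ℂ) r,
      iteratedDeriv n (f 0) y = K * f n y := by
    intro n
    induction n with
    | zero => exact ⟨1, fun y _ => by simp⟩
    | succ n ih =>
      obtain ⟨K, hK⟩ := ih
      refine ⟨K * k n, fun y hy => ?_⟩
      rw [iteratedDeriv_succ]
      have : iteratedDeriv n (f 0) =ᶠ[𝓝 y] fun y => K * f n y := by
        filter_upwards [Metric.isOpen_ball.mem_nhds hy] with w hw using hK w hw
      rw [this.deriv_eq, ((hf n y hy).const_mul K).deriv]
      ring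
  have hd : DifferentiableOn ℂ (f 0) (Metric.ball 0 r) := fun y hy =>
    (hf 0 y hy).differentiableAt.differentiableWithinAt
  rw [← Complex.taylorSeries_eq_on_ball' hx hd]
  refine (tsum_congr fun n => ?_).trans tsum_zero
  obtain ⟨K, hK⟩ := hit n
  rw [hK 0 (Metric.mem_ball_self hr), h0]
  simp

lemma isOpen_cutPlane : IsOpen cutPlane :=
  Complex.isOpen_slitPlane.preimage (by fun_prop : Continuous fun z : ℂ => 1 - z)

lemma ball_subset_cutPlane : Metric.ball (0 : ℂ) 1 ⊆ cutPlane := fun z hz => by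
  have := Complex.mem_slitPlane_of_norm_lt_one (z := -z) (by simpa using hz)
  simpa [cutPlane, sub_eq_add_neg] using this

lemma zero_mem_cutPlane : (0 : ℂ) ∈ cutPlane := by simp [cutPlane]

lemma one_sub_mul_mem_slitPlane {x : ℂ} (hx : x ∈ cutPlane) {t : ℝ} (ht : t ∈ Set.Icc (0 : ℝ) 1) :
    1 - x * t ∈ Complex.slitPlane := by
  have hx' : 1 - x ∈ Complex.slitPlane := hx
  rw [Complex.mem_slitPlane_iff] at hx' ⊢
  simp only [Complex.sub_re, Complex.one_re, Complex.sub_im, Complex.one_im, Complex.mul_re,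
    Complex.ofReal_re, Complex.ofReal_im, Complex.mul_im, mul_zero, sub_zero, zero_sub,
    zero_add] at hx' ⊢
  rcases eq_or_lt_of_le ht.1 with h0 | h0
  · simp [← h0]
  rcases hx' with h | h
  · left
    nlinarith [ht.2]
  · right
    have : x.im ≠ 0 := by simpa using h
    simp [this, h0.ne']

lemma isPreconnected_cutPlane : IsPreconnected cutPlane := by
  have : StarConvex ℝ (0 : ℂ) cutPlane := by
    rw [starConvex_zero_iff]
    intro x hx t h0 h1
    have := one_sub_mul_mem_slitPlane hx (t := t) ⟨h0, h1⟩
    simpa [cutPlane, mul_comm] using this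
  exact (this.isPathConnected zero_mem_cutPlane).isConnected.isPreconnected

/-- Analytic functions on the cut plane that agree on the unit disc are equal. -/
lemma eqOn_cutPlane {f g : ℂ → ℂ} (hf : DifferentiableOn ℂ f cutPlane)
    (hg : DifferentiableOn ℂ g cutPlane) (h : ∀ x ∈ Metric.ball (0 : ℂ) 1, f x = g x) :
    Set.EqOn f g cutPlane :=
  (hf.analyticOnNhd isOpen_cutPlane).eqOn_of_preconnected_of_eventuallyEq
    (hg.analyticOnNhd isOpen_cutPlane) isPreconnected_cutPlane zero_mem_cutPlane
    (by filter_upwards [Metric.ball_mem_nhds (0 : ℂ) one_pos] with x hx using h x hx)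

/-- Euler's integral `∫₀¹ t^(b-1) (1-t)^(c-b-1) (1-xt)^(-a) dt`. -/
noncomputable def eulerIntegral (a b c x : ℂ) : ℂ :=
  ∫ t in (0 : ℝ)..1, (t : ℂ) ^ (b - 1) * (1 - (t : ℂ)) ^ (c - b - 1) * (1 - x * t) ^ (-a)

/-- Near a point of the cut plane the powers of `1 - xt` are uniformly bounded. -/
lemma exists_bound_one_sub_mul_cpow (a : ℂ) {x : ℂ} (hx : x ∈ cutPlane) :
    ∃ s ∈ 𝓝 x, s ⊆ cutPlane ∧ ∃ M : ℝ, ∀ y ∈ s, ∀ t ∈ Set.Icc (0 : ℝ) 1,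
      ‖(1 - y * t) ^ a‖ ≤ M := by
  obtain ⟨r, hr, hs⟩ := Metric.nhds_basis_closedBall.mem_iff.1 (isOpen_cutPlane.mem_nhds hx)
  refine ⟨Metric.closedBall x r, Metric.closedBall_mem_nhds x hr, hs, ?_⟩
  have hK : IsCompact (Metric.closedBall x r ×ˢ Set.Icc (0 : ℝ) 1) :=
    (isCompact_closedBall x r).prod isCompact_Icc
  obtain ⟨M, hM⟩ := hK.exists_bound_of_continuousOn
    (f := fun p : ℂ × ℝ => (1 - p.1 * p.2) ^ a) (by
      intro p hp
      refine ContinuousAt.continuousWithinAt ?_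
      refine ContinuousAt.cpow ?_ continuousAt_const
        (one_sub_mul_mem_slitPlane (hs hp.1) hp.2)
      fun_prop)
  exact ⟨M, fun y hy t ht => hM (y, t) ⟨hy, ht⟩⟩

lemma continuousOn_one_sub_mul_cpow (a : ℂ) {x : ℂ} (hx : x ∈ cutPlane) :
    ContinuousOn (fun t : ℝ => (1 - x * t) ^ a) (Set.Icc 0 1) := by
  intro t ht
  refine ContinuousAt.continuousWithinAt ?_
  refine ContinuousAt.cpow ?_ continuousAt_const (one_sub_mul_mem_slitPlane hx ht)
  fun_prop

open MeasureTheory in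
lemma intervalIntegrable_euler (a : ℂ) {b c x : ℂ} (hb : 0 < b.re) (hc : b.re < c.re)
    (hx : x ∈ cutPlane) :
    IntervalIntegrable (fun t : ℝ => (t : ℂ) ^ (b - 1) * (1 - (t : ℂ)) ^ (c - b - 1) *
      (1 - x * t) ^ (-a)) volume 0 1 := by
  refine (Complex.betaIntegral_convergent hb (v := c - b) (by simpa using hc)).mul_continuousOn ?_
  rw [Set.uIcc_of_le zero_le_one]
  exact continuousOn_one_sub_mul_cpow _ hx

open MeasureTheory in
lemma hasDerivAt_eulerIntegral (a : ℂ) {b c x : ℂ} (hb : 0 < b.re) (hc : b.re < c.re)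
    (hx : x ∈ cutPlane) :
    HasDerivAt (eulerIntegral a b c) (a * eulerIntegral (a + 1) (b + 1) (c + 1) x) x := by
  obtain ⟨s, hs, hsc, M, hM⟩ := exists_bound_one_sub_mul_cpow (-a - 1) hx
  have hβ := Complex.betaIntegral_convergent hb (v := c - b) (by simpa using hc)
  have hcont : ContinuousOn (fun t : ℝ => a * t * (1 - x * t) ^ (-a - 1)) (Set.uIcc 0 1) := by
    rw [Set.uIcc_of_le zero_le_one]
    exact (by fun_prop : Continuous fun t : ℝ => a * (t : ℂ)).continuousOn.mul
      (continuousOn_one_sub_mul_cpow _ hx)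
  have key := (intervalIntegral.hasDerivAt_integral_of_dominated_loc_of_deriv_le
    (μ := volume) (a := 0) (b := 1) (x₀ := x) (s := s)
    (F := fun (x : ℂ) (t : ℝ) => (t : ℂ) ^ (b - 1) * (1 - (t : ℂ)) ^ (c - b - 1) *
      (1 - x * t) ^ (-a))
    (F' := fun (x : ℂ) (t : ℝ) => (t : ℂ) ^ (b - 1) * (1 - (t : ℂ)) ^ (c - b - 1) *
      (a * t * (1 - x * t) ^ (-a - 1)))
    (bound := fun t : ℝ => ‖(t : ℂ) ^ (b - 1) * (1 - (t : ℂ)) ^ (c - b - 1)‖ * (‖a‖ * M))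
    hs ?_ (intervalIntegrable_euler a hb hc hx) ?_ ?_ ?_ ?_).2
  · refine key.congr_deriv ?_
    rw [eulerIntegral, ← intervalIntegral.integral_const_mul]
    refine intervalIntegral.integral_congr_ae ?_
    filter_upwards with t ht
    rw [Set.uIoc_of_le zero_le_one] at ht
    have ht0 : (t : ℂ) ≠ 0 := by exact_mod_cast ht.1.ne'
    have e1 : (t : ℂ) ^ (b + 1 - 1) = t ^ (b - 1) * t := by
      rw [show b + 1 - 1 = b - 1 + 1 by ring, Complex.cpow_add _ _ ht0, Complex.cpow_one]
    rw [e1, show c + 1 - (b + 1) - 1 = c - b - 1 by ring, show -(a + 1) = -a - 1 by ring]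
    ring
  · filter_upwards [hs] with y hy
    rw [Set.uIoc_of_le zero_le_one]
    exact (intervalIntegrable_euler a hb hc (hsc hy)).aestronglyMeasurable
  · rw [Set.uIoc_of_le zero_le_one]
    exact (hβ.mul_continuousOn hcont).aestronglyMeasurable
  · filter_upwards with t ht y hy
    rw [Set.uIoc_of_le zero_le_one] at ht
    have h1 := hM y hy t ⟨ht.1.le, ht.2⟩
    rw [norm_mul]
    gcongr
    rw [norm_mul, norm_mul]
    have : ‖(t : ℂ)‖ ≤ 1 := by
      rw [Complex.norm_real, Real.norm_of_nonneg ht.1.le]; exact ht.2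
    calc ‖a‖ * ‖(t : ℂ)‖ * ‖(1 - y * t) ^ (-a - 1)‖ ≤ ‖a‖ * 1 * M := by gcongr
      _ = ‖a‖ * M := by ring
  · exact hβ.norm.mul_const _
  · filter_upwards with t ht y hy
    rw [Set.uIoc_of_le zero_le_one] at ht
    refine HasDerivAt.const_mul _ ?_
    have h1 : HasDerivAt (fun y : ℂ => 1 - y * t) (-t : ℂ) y := by
      simpa using ((hasDerivAt_id y).mul_const (t : ℂ)).const_sub 1
    have h2 := h1.cpow_const (c := -a) (one_sub_mul_mem_slitPlane (hsc hy) ⟨ht.1.le, ht.2⟩)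
    refine h2.congr_deriv ?_
    ring

lemma eulerIntegral_zero (a : ℂ) {b c : ℂ} (hb : 0 < b.re) (hc : b.re < c.re) :
    eulerIntegral a b c 0 = Complex.Gamma b * Complex.Gamma (c - b) / Complex.Gamma c := by
  have := Complex.betaIntegral_eq_Gamma_mul_div b (c - b) hb (by simpa using hc)
  rw [add_sub_cancel] at this
  rw [← this]
  simp [eulerIntegral, Complex.betaIntegral]

lemma ne_neg_nat_of_re_pos {c : ℂ} (hc : 0 < c.re) (k : ℕ) : c ≠ -k := by
  rintro rfl
  simp at hc
  linarith [(Nat.cast_nonneg k : (0 : ℝ) ≤ k)]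

/-- Euler's integral representation of `₂F₁`. -/
lemma eulerIntegral_eq_hypergeometric (a : ℂ) {b c x : ℂ} (hb : 0 < b.re) (hc : b.re < c.re)
    (hx : x ∈ Metric.ball (0 : ℂ) 1) :
    Complex.Gamma c / (Complex.Gamma b * Complex.Gamma (c - b)) * eulerIntegral a b c x =
      ₂F₁ a b c x := by
  have hbn : ∀ n : ℕ, 0 < (b + n).re := fun n => by
    simpa using add_pos_of_pos_of_nonneg hb n.cast_nonneg
  have hcn : ∀ n : ℕ, (b + n).re < (c + n).re := fun n => by simpa using hc
  have hcp : ∀ n : ℕ, 0 < (c + n).re := fun n => (hbn n).trans (hcn n)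
  have hcb : Complex.Gamma (c - b) ≠ 0 :=
    Complex.Gamma_ne_zero_of_re_pos (by simpa using hc)
  have key := eq_zero_of_hasDerivAt_succ one_pos
    (fun n x => Complex.Gamma (c + n) / (Complex.Gamma (b + n) * Complex.Gamma (c - b)) *
      eulerIntegral (a + n) (b + n) (c + n) x - ₂F₁ (a + n) (b + n) (c + n) x)
    (fun n => (a + n) * (b + n) / (c + n)) ?_ ?_ hx
  · simpa [sub_eq_zero] using key
  · intro n x hx
    refine (((hasDerivAt_eulerIntegral (a + n) (hbn n) (hcn n)
      (ball_subset_cutPlane hx)).const_mul _).sub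
      (hasDerivAt_hypergeometric (a + n) (b + n) (ne_neg_nat_of_re_pos (hcp n)) hx)).congr_deriv ?_
    have hc0 := ne_zero_of_ne_neg_nat (ne_neg_nat_of_re_pos (hcp n))
    have hb0 := ne_zero_of_ne_neg_nat (ne_neg_nat_of_re_pos (hbn n))
    have hGb := Complex.Gamma_ne_zero_of_re_pos (hbn n)
    push_cast
    simp only [← add_assoc]
    rw [Complex.Gamma_add_one _ hc0, Complex.Gamma_add_one _ hb0]
    field_simp
  · intro n
    rw [eulerIntegral_zero _ (hbn n) (hcn n), ordinaryHypergeometric_zero,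
      show c + n - (b + n) = c - b by ring]
    have h1 := Complex.Gamma_ne_zero_of_re_pos (hbn n)
    have h2 := Complex.Gamma_ne_zero_of_re_pos (hcp n)
    field_simp
    simp

/-- `₂F₁(a, b; c; ·)` has an analytic continuation to the cut plane. -/
def HasContinuation (a b c : ℂ) : Prop :=
  ∃ f : ℂ → ℂ, DifferentiableOn ℂ f cutPlane ∧ ∀ w ∈ Metric.ball (0 : ℂ) 1, f w = ₂F₁ a b c w

lemma hasContinuation_of_re_lt (a : ℂ) {b c : ℂ} (hb : 0 < b.re) (hc : b.re < c.re) :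
    HasContinuation a b c :=
  ⟨fun x => Complex.Gamma c / (Complex.Gamma b * Complex.Gamma (c - b)) * eulerIntegral a b c x,
    fun _ hx => ((hasDerivAt_eulerIntegral a hb hc hx).const_mul
      _).differentiableAt.differentiableWithinAt,
    fun _ hx => eulerIntegral_eq_hypergeometric a hb hc hx⟩

lemma deriv_eq_of_eqOn_ball {f g : ℂ → ℂ} (h : ∀ w ∈ Metric.ball (0 : ℂ) 1, f w = g w) {w : ℂ}
    (hw : w ∈ Metric.ball (0 : ℂ) 1) : deriv f w = deriv g w := by
  refine Filter.EventuallyEq.deriv_eq ?_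
  filter_upwards [Metric.isOpen_ball.mem_nhds hw] with y hy using h y hy

lemma HasContinuation.lower_right {a b c : ℂ} (h : HasContinuation a (b + 1) c)
    (hc : ∀ k : ℕ, c ≠ -k) (hcb : c - (b + 1) ≠ 0) : HasContinuation a b c := by
  obtain ⟨f, hf, hfe⟩ := h
  refine ⟨fun x => (x * (1 - x) * deriv f x + (c - (b + 1) - a * x) * f x) / (c - (b + 1)),
    ?_, fun w hw => ?_⟩
  · have := hf.deriv isOpen_cutPlane
    fun_prop
  · rw [div_eq_iff hcb, deriv_eq_of_eqOn_ball hfe hw, hfe w hw,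
      hypergeometric_lower_right a b hc hw]
    ring

lemma HasContinuation.lower {a b c : ℂ} (h : HasContinuation a b (c + 1))
    (hc : ∀ k : ℕ, c ≠ -k) : HasContinuation a b c := by
  obtain ⟨f, hf, hfe⟩ := h
  refine ⟨fun x => (x * deriv f x + c * f x) / c, ?_, fun w hw => ?_⟩
  · have := hf.deriv isOpen_cutPlane
    fun_prop
  · rw [div_eq_iff (ne_zero_of_ne_neg_nat hc), deriv_eq_of_eqOn_ball hfe hw, hfe w hw,
      hypergeometric_lower a b hc hw]
    ring

/-- The continuation exists for all admissible parameters: Euler's integral gives it after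
shifting `b` and then `c` upwards, and the contiguous relations undo the shifts. -/
theorem hasContinuation (a b : ℂ) {c : ℂ} (hc : ∀ k : ℕ, c ≠ -k) : HasContinuation a b c := by
  obtain ⟨n, hn⟩ := exists_nat_gt (-b.re)
  obtain ⟨m, hm⟩ := exists_nat_gt (b.re + n - c.re)
  have hb : ∀ j : ℕ, ∀ b : ℂ, 0 < b.re + j → b.re + j < c.re + m →
      HasContinuation a b (c + m) := by
    intro j
    induction j with
    | zero =>
      intro b h1 h2
      exact hasContinuation_of_re_lt a (by simpa using h1) (by simpa using h2)
    | succ j ih =>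
      intro b h1 h2
      have hpos : 0 < (c + m - (b + 1)).re := by
        have : (0 : ℝ) ≤ j := j.cast_nonneg
        simp only [Complex.sub_re, Complex.add_re, Complex.natCast_re, Complex.one_re]
        push_cast at h2
        linarith
      refine (ih (b + 1) ?_ ?_).lower_right (ne_neg_nat_of_re_pos ?_) ?_
      · push_cast at h1
        simp only [Complex.add_re, Complex.one_re]
        linarith
      · push_cast at h2
        simp only [Complex.add_re, Complex.one_re]
        linarith
      · simp only [Complex.add_re, Complex.natCast_re]
        linarith
      · intro h
        simp [h] at hpos
  have hcm : ∀ m : ℕ, ∀ c : ℂ, (∀ k : ℕ, c ≠ -k) → HasContinuation a b (c + m) →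
      HasContinuation a b c := by
    intro m
    induction m with
    | zero => intro c _ h; simpa using h
    | succ m ih =>
      intro c hc h
      refine (ih (c + 1) (ne_neg_nat_add_one hc) ?_).lower hc
      convert h using 1
      push_cast
      ring
  exact hcm m c hc (hb n b (by linarith) (by linarith))

/-! ### The principal branch of `₂F₁` and its contiguous relations -/

lemma gaussF_spec (a b : ℂ) {c : ℂ} (hc : ∀ k : ℕ, c ≠ -k) :
    DifferentiableOn ℂ (gaussF a b c) cutPlane ∧
      ∀ w ∈ Metric.ball (0 : ℂ) 1, gaussF a b c w = ₂F₁ a b c w := by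
  have h := hasContinuation a b hc
  have he : gaussF a b c = Classical.choose h := by
    funext z
    exact dif_pos h
  rw [he]
  exact Classical.choose_spec h

lemma differentiableOn_gaussF (a b : ℂ) {c : ℂ} (hc : ∀ k : ℕ, c ≠ -k) :
    DifferentiableOn ℂ (gaussF a b c) cutPlane := (gaussF_spec a b hc).1

lemma differentiableAt_gaussF (a b : ℂ) {c : ℂ} (hc : ∀ k : ℕ, c ≠ -k) {x : ℂ}
    (hx : x ∈ cutPlane) : DifferentiableAt ℂ (gaussF a b c) x :=
  (differentiableOn_gaussF a b hc).differentiableAt (isOpen_cutPlane.mem_nhds hx)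

lemma gaussF_eq (a b : ℂ) {c : ℂ} (hc : ∀ k : ℕ, c ≠ -k) {x : ℂ}
    (hx : x ∈ Metric.ball (0 : ℂ) 1) : gaussF a b c x = ₂F₁ a b c x := (gaussF_spec a b hc).2 x hx

lemma gaussF_zero (a b : ℂ) {c : ℂ} (hc : ∀ k : ℕ, c ≠ -k) : gaussF a b c 0 = 1 := by
  rw [gaussF_eq a b hc (Metric.mem_ball_self one_pos), ordinaryHypergeometric_zero]

lemma gaussF_symm (a b : ℂ) {c : ℂ} (hc : ∀ k : ℕ, c ≠ -k) {x : ℂ} (hx : x ∈ cutPlane) :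
    gaussF a b c x = gaussF b a c x :=
  eqOn_cutPlane (differentiableOn_gaussF a b hc) (differentiableOn_gaussF b a hc)
    (fun y hy => by rw [gaussF_eq _ _ hc hy, gaussF_eq _ _ hc hy, hypergeometric_symm]) hx

lemma deriv_gaussF_eq (a b : ℂ) {c : ℂ} (hc : ∀ k : ℕ, c ≠ -k) {x : ℂ}
    (hx : x ∈ Metric.ball (0 : ℂ) 1) : deriv (gaussF a b c) x = deriv (₂F₁ a b c) x :=
  deriv_eq_of_eqOn_ball (fun _ hw => gaussF_eq a b hc hw) hx

lemma deriv_gaussF (a b : ℂ) {c : ℂ} (hc : ∀ k : ℕ, c ≠ -k) {x : ℂ} (hx : x ∈ cutPlane) :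
    deriv (gaussF a b c) x = a * b / c * gaussF (a + 1) (b + 1) (c + 1) x := by
  refine eqOn_cutPlane ((differentiableOn_gaussF a b hc).deriv isOpen_cutPlane)
    ((differentiableOn_gaussF _ _ (ne_neg_nat_add_one hc)).const_mul _) (fun y hy => ?_) hx
  rw [deriv_gaussF_eq a b hc hy, deriv_hypergeometric a b hc hy,
    gaussF_eq _ _ (ne_neg_nat_add_one hc) hy]

lemma gaussF_raise (a b : ℂ) {c : ℂ} (hc : ∀ k : ℕ, c ≠ -k) {x : ℂ} (hx : x ∈ cutPlane) :
    x * deriv (gaussF a b c) x + a * gaussF a b c x = a * gaussF (a + 1) b c x := by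
  have h1 := differentiableOn_gaussF a b hc
  have h2 := h1.deriv isOpen_cutPlane
  have h3 := differentiableOn_gaussF (a + 1) b hc
  refine eqOn_cutPlane (f := fun x => x * deriv (gaussF a b c) x + a * gaussF a b c x)
    (g := fun x => a * gaussF (a + 1) b c x) (by fun_prop) (by fun_prop) (fun y hy => ?_) hx
  simp only [deriv_gaussF_eq a b hc hy, gaussF_eq _ _ hc hy]
  exact hypergeometric_raise a b hc hy

lemma gaussF_raise_right (a b : ℂ) {c : ℂ} (hc : ∀ k : ℕ, c ≠ -k) {x : ℂ} (hx : x ∈ cutPlane) :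
    x * deriv (gaussF a b c) x + b * gaussF a b c x = b * gaussF a (b + 1) c x := by
  rw [gaussF_symm a (b + 1) hc hx, ← gaussF_raise b a hc hx, gaussF_symm a b hc hx,
    deriv_gaussF a b hc hx, deriv_gaussF b a hc hx,
    gaussF_symm (a + 1) (b + 1) (ne_neg_nat_add_one hc) hx]
  ring

lemma gaussF_lower (a b : ℂ) {c : ℂ} (hc : ∀ k : ℕ, c ≠ -k) {x : ℂ} (hx : x ∈ cutPlane) :
    x * deriv (gaussF a b (c + 1)) x + c * gaussF a b (c + 1) x = c * gaussF a b c x := by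
  have h1 := differentiableOn_gaussF a b (ne_neg_nat_add_one hc)
  have h2 := h1.deriv isOpen_cutPlane
  have h3 := differentiableOn_gaussF a b hc
  refine eqOn_cutPlane (f := fun x => x * deriv (gaussF a b (c + 1)) x + c * gaussF a b (c + 1) x)
    (g := fun x => c * gaussF a b c x) (by fun_prop) (by fun_prop) (fun y hy => ?_) hx
  simp only [deriv_gaussF_eq a b (ne_neg_nat_add_one hc) hy,
    gaussF_eq _ _ (ne_neg_nat_add_one hc) hy, gaussF_eq _ _ hc hy]
  exact hypergeometric_lower a b hc hy

/-! ### The logarithmic variable -/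

/-- The strip `|Im s| < π`, mapped biholomorphically onto `ℂ ∖ [0, ∞)` by `s ↦ -exp s`. -/
def logStrip : Set ℂ := {s | |s.im| < Real.pi}

lemma isOpen_logStrip : IsOpen logStrip :=
  isOpen_lt (by fun_prop) continuous_const

lemma convex_logStrip : Convex ℝ logStrip := by
  have : logStrip = Complex.imLm ⁻¹' Set.Ioo (-Real.pi) Real.pi := by
    ext s
    simp [logStrip, abs_lt]
  rw [this]
  exact (convex_Ioo _ _).linear_preimage _

lemma neg_mem_logStrip {s : ℂ} (hs : s ∈ logStrip) : -s ∈ logStrip := by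
  simpa [logStrip] using hs

lemma exp_mem_slitPlane {s : ℂ} (hs : s ∈ logStrip) : Complex.exp s ∈ Complex.slitPlane := by
  have h := abs_lt.1 (show |s.im| < Real.pi from hs)
  rw [Complex.mem_slitPlane_iff_arg]
  refine ⟨?_, Complex.exp_ne_zero s⟩
  rw [← Complex.log_im, Complex.log_exp h.1 h.2.le]
  exact h.2.ne

lemma one_add_exp_mem_slitPlane {s : ℂ} (hs : s ∈ logStrip) :
    1 + Complex.exp s ∈ Complex.slitPlane := by
  have h := exp_mem_slitPlane hs
  rw [Complex.mem_slitPlane_iff] at h ⊢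
  rcases h with h | h
  · left
    simpa using add_pos one_pos h
  · right
    simpa using h

lemma neg_exp_mem_cutPlane {s : ℂ} (hs : s ∈ logStrip) : -Complex.exp s ∈ cutPlane := by
  simpa [cutPlane] using one_add_exp_mem_slitPlane hs

/-- `₂F₁(a, b; c; -exp s)`. -/
noncomputable def expF (a b c s : ℂ) : ℂ := gaussF a b c (-Complex.exp s)

/-- The logarithmic derivative `x d/dx` of `₂F₁(a, b; c; x)` at `x = -exp s`. -/
noncomputable def expF' (a b c s : ℂ) : ℂ :=
  -Complex.exp s * deriv (gaussF a b c) (-Complex.exp s)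

lemma hasDerivAt_expF (a b : ℂ) {c s : ℂ} (hc : ∀ k : ℕ, c ≠ -k) (hs : s ∈ logStrip) :
    HasDerivAt (expF a b c) (expF' a b c s) s := by
  have h1 := (differentiableAt_gaussF a b hc (neg_exp_mem_cutPlane hs)).hasDerivAt
  have h2 : HasDerivAt (fun s => -Complex.exp s) (-Complex.exp s) s :=
    (Complex.hasDerivAt_exp s).neg
  exact (h1.comp s h2).congr_deriv (by rw [expF']; ring)

lemma expF_raise (a b : ℂ) {c s : ℂ} (hc : ∀ k : ℕ, c ≠ -k) (hs : s ∈ logStrip) :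
    expF' a b c s = a * expF (a + 1) b c s - a * expF a b c s := by
  have := gaussF_raise a b hc (neg_exp_mem_cutPlane hs)
  simp only [expF, expF']
  linear_combination this

lemma expF_raise_right (a b : ℂ) {c s : ℂ} (hc : ∀ k : ℕ, c ≠ -k) (hs : s ∈ logStrip) :
    expF' a b c s = b * expF a (b + 1) c s - b * expF a b c s := by
  have := gaussF_raise_right a b hc (neg_exp_mem_cutPlane hs)
  simp only [expF, expF']
  linear_combination this

lemma expF_lower (a b : ℂ) {c s : ℂ} (hc : ∀ k : ℕ, c ≠ -k) (hs : s ∈ logStrip) :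
    expF' a b (c + 1) s = c * expF a b c s - c * expF a b (c + 1) s := by
  have := gaussF_lower a b hc (neg_exp_mem_cutPlane hs)
  simp only [expF, expF']
  linear_combination this

lemma expF_deriv (a b : ℂ) {c s : ℂ} (hc : ∀ k : ℕ, c ≠ -k) (hs : s ∈ logStrip) :
    expF' a b c s = -Complex.exp s * (a * b / c * expF (a + 1) (b + 1) (c + 1) s) := by
  rw [expF', deriv_gaussF a b hc (neg_exp_mem_cutPlane hs), expF]

/-- The hypergeometric equation in the variable `s`, in normal form. -/
lemma hasDerivAt_expF' (a b : ℂ) {c s : ℂ} (hc : ∀ k : ℕ, c ≠ -k) (hs : s ∈ logStrip) :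
    HasDerivAt (expF' a b c)
      (-((c - 1 + Complex.exp s * (a + b)) * expF' a b c s +
        Complex.exp s * (a * b) * expF a b c s) / (1 + Complex.exp s)) s := by
  have hc0 := ne_zero_of_ne_neg_nat hc
  have hc1 := ne_neg_nat_add_one hc
  have hE : 1 + Complex.exp s ≠ 0 := Complex.slitPlane_ne_zero (one_add_exp_mem_slitPlane hs)
  have h1 : HasDerivAt (fun s => -Complex.exp s * (a * b / c * expF (a + 1) (b + 1) (c + 1) s))
      (-Complex.exp s * (a * b / c * expF (a + 1) (b + 1) (c + 1) s) +
        -Complex.exp s * (a * b / c * expF' (a + 1) (b + 1) (c + 1) s)) s :=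
    (Complex.hasDerivAt_exp s).neg.mul
      ((hasDerivAt_expF (a + 1) (b + 1) hc1 hs).const_mul (a * b / c))
  have h2 : HasDerivAt (fun s => a * expF (a + 1) b c s - a * expF a b c s)
      (a * expF' (a + 1) b c s - a * expF' a b c s) s :=
    ((hasDerivAt_expF (a + 1) b hc hs).const_mul a).sub ((hasDerivAt_expF a b hc hs).const_mul a)
  have hU := isOpen_logStrip.mem_nhds hs
  have e1 : expF' a b c =ᶠ[𝓝 s]
      fun s => -Complex.exp s * (a * b / c * expF (a + 1) (b + 1) (c + 1) s) := by
    filter_upwards [hU] with u hu using expF_deriv a b hc hu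
  have e2 : expF' a b c =ᶠ[𝓝 s] fun s => a * expF (a + 1) b c s - a * expF a b c s := by
    filter_upwards [hU] with u hu using expF_raise a b hc hu
  have d1 := h1.congr_of_eventuallyEq e1
  have d2 := h2.congr_of_eventuallyEq e2
  have hu := d1.unique d2
  refine d1.congr_deriv ?_
  rw [eq_div_iff hE]
  -- Both expressions of the second derivative enter: the first as such, the second times `exp s`.
  have r1 := expF_lower (a + 1) (b + 1) hc hs
  have r2 := expF_raise_right (a + 1) b hc hs
  have r3 := expF_raise a b hc hs
  have r4 := expF_deriv a b hc hs
  have e3 : a * b / c * expF' (a + 1) (b + 1) (c + 1) s = a * b * expF (a + 1) (b + 1) c s -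
      a * b * expF (a + 1) (b + 1) (c + 1) s := by
    rw [r1]; field_simp
  have e4 : Complex.exp s * (a * b / c * expF (a + 1) (b + 1) (c + 1) s) * c =
      Complex.exp s * (a * b * expF (a + 1) (b + 1) (c + 1) s) := by field_simp
  linear_combination Complex.exp s * hu - Complex.exp s * e3 - e4 + (c - 1) * r4 +
    Complex.exp s * a * r2 + Complex.exp s * b * r3

/-! ### The connection formula between `0` and `∞` -/

/-- The solution `(-x)^(-a) ₂F₁(a, a-c+1; a-b+1; 1/x)` of the hypergeometric equation at
`x = -exp s`. -/
noncomputable def expG (a b c s : ℂ) : ℂ :=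
  Complex.exp (-(a * s)) * expF a (a - c + 1) (a - b + 1) (-s)

/-- The derivative of `expG` in `s`. -/
noncomputable def expG' (a b c s : ℂ) : ℂ :=
  Complex.exp (-(a * s)) *
    (-a * expF a (a - c + 1) (a - b + 1) (-s) - expF' a (a - c + 1) (a - b + 1) (-s))

lemma sub_add_one_ne_neg_nat {a b : ℂ} (hab : ∀ m : ℤ, a - b ≠ m) (k : ℕ) :
    a - b + 1 ≠ -k := by
  intro h
  exact hab (-k - 1) (by push_cast; linear_combination h)

lemma sub_ne_neg_nat {a b : ℂ} (hab : ∀ m : ℤ, a - b ≠ m) (k : ℕ) : a - b ≠ -k := by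
  intro h
  exact hab (-k) (by push_cast; exact h)

lemma sub_ne_intCast_symm {a b : ℂ} (hab : ∀ m : ℤ, a - b ≠ m) (m : ℤ) : b - a ≠ m := by
  intro h
  exact hab (-m) (by push_cast; linear_combination -h)

lemma hasDerivAt_expF_neg (a b : ℂ) {c s : ℂ} (hc : ∀ k : ℕ, c ≠ -k) (hs : s ∈ logStrip) :
    HasDerivAt (fun s => expF a b c (-s)) (-expF' a b c (-s)) s := by
  simpa [Function.comp_def] using
    (hasDerivAt_expF a b hc (neg_mem_logStrip hs)).comp s (hasDerivAt_neg s)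

lemma hasDerivAt_expG {a b : ℂ} (c : ℂ) {s : ℂ} (hab : ∀ m : ℤ, a - b ≠ m) (hs : s ∈ logStrip) :
    HasDerivAt (expG a b c) (expG' a b c s) s := by
  have h1 := hasDerivAt_expF_neg a (a - c + 1) (sub_add_one_ne_neg_nat hab) hs
  have h2 : HasDerivAt (fun s => Complex.exp (-(a * s))) (Complex.exp (-(a * s)) * -a) s := by
    simpa using (((hasDerivAt_id s).const_mul a).neg).cexp
  refine (h2.mul h1).congr_deriv ?_
  rw [expG']
  ring

lemma hasDerivAt_expG' {a b : ℂ} (c : ℂ) {s : ℂ} (hab : ∀ m : ℤ, a - b ≠ m)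
    (hs : s ∈ logStrip) :
    HasDerivAt (expG' a b c)
      (-((c - 1 + Complex.exp s * (a + b)) * expG' a b c s +
        Complex.exp s * (a * b) * expG a b c s) / (1 + Complex.exp s)) s := by
  have hc' := sub_add_one_ne_neg_nat hab
  have hE : 1 + Complex.exp s ≠ 0 := Complex.slitPlane_ne_zero (one_add_exp_mem_slitPlane hs)
  have hE' : 1 + Complex.exp (-s) ≠ 0 :=
    Complex.slitPlane_ne_zero (one_add_exp_mem_slitPlane (neg_mem_logStrip hs))
  have h1 := hasDerivAt_expF_neg a (a - c + 1) hc' hs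
  have h2 : HasDerivAt (fun s => Complex.exp (-(a * s))) (Complex.exp (-(a * s)) * -a) s := by
    simpa using (((hasDerivAt_id s).const_mul a).neg).cexp
  have h3 := (hasDerivAt_expF' a (a - c + 1) hc' (neg_mem_logStrip hs)).comp s (hasDerivAt_neg s)
  refine (h2.mul ((h1.const_mul (-a)).sub h3)).congr_deriv ?_
  rw [expG', expG, eq_div_iff hE]
  have hEE : Complex.exp s * Complex.exp (-s) = 1 := by rw [← Complex.exp_add]; simp
  have hf : Complex.exp s * (1 + Complex.exp (-s)) = 1 + Complex.exp s := by
    linear_combination hEE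
  rw [← hf]
  have hEne := Complex.exp_ne_zero s
  simp only [Function.comp_def, Pi.sub_apply]
  generalize expF a (a - c + 1) (a - b + 1) (-s) = f
  generalize expF' a (a - c + 1) (a - b + 1) (-s) = f'
  have hE2 : Complex.exp (-s) = (Complex.exp s)⁻¹ := Complex.exp_neg s
  rw [hE2] at hE' ⊢
  have hE3 : Complex.exp s + 1 ≠ 0 := by rwa [add_comm]
  clear hf hEE h1 h2 h3
  generalize Complex.exp s = E at *
  generalize Complex.exp (-(a * s)) = X at *
  rw [show 1 + E⁻¹ = (E + 1) / E by field_simp]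
  field_simp
  ring

/-- The contiguous relation of `expG` raising the exponent that does not belong to it. -/
lemma expG_raise_other {a b : ℂ} (c : ℂ) {s : ℂ} (hab : ∀ m : ℤ, a - b ≠ m) (hs : s ∈ logStrip) :
    expG' a b c s + b * expG a b c s = (b - a) * expG a (b + 1) c s := by
  have h := expF_lower a (a - c + 1) (sub_ne_neg_nat hab) (neg_mem_logStrip hs)
  rw [expG', expG, expG, h, show a - (b + 1) + 1 = a - b by ring]
  ring

lemma expG_raise_self {a b : ℂ} (c : ℂ) {s : ℂ} (hab : ∀ m : ℤ, a - b ≠ m) (hs : s ∈ logStrip) :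
    expG' a b c s + a * expG a b c s =
      a * (a - c + 1) / (a - b + 1) * expG (a + 1) b c s := by
  have h := expF_deriv a (a - c + 1) (sub_add_one_ne_neg_nat hab) (neg_mem_logStrip hs)
  have e : Complex.exp (-((a + 1) * s)) = Complex.exp (-(a * s)) * Complex.exp (-s) := by
    rw [← Complex.exp_add]
    congr 1
    ring
  rw [expG', expG, expG, h, e, show a + 1 - c + 1 = a - c + 1 + 1 by ring,
    show a + 1 - b + 1 = a - b + 1 + 1 by ring]
  ring

lemma expG_lower {a b : ℂ} (c : ℂ) {s : ℂ} (hab : ∀ m : ℤ, a - b ≠ m) (hs : s ∈ logStrip) :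
    expG' a b (c + 1) s + c * expG a b (c + 1) s = (c - a) * expG a b c s := by
  have h := expF_raise_right a (a - c) (sub_add_one_ne_neg_nat hab) (neg_mem_logStrip hs)
  rw [expG', expG, expG, show a - (c + 1) + 1 = a - c by ring, h]
  ring

lemma ofReal_mem_logStrip (r : ℝ) : (r : ℂ) ∈ logStrip := by
  simp [logStrip, Real.pi_pos]

lemma tendsto_neg_exp_neg_ofReal :
    Tendsto (fun r : ℝ => -Complex.exp (-(r : ℂ))) atTop (𝓝 0) := by
  have h : Tendsto (fun r : ℝ => ((-Real.exp (-r) : ℝ) : ℂ)) atTop (𝓝 ((-0 : ℝ) : ℂ)) :=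
    (Complex.continuous_ofReal.tendsto _).comp (Real.tendsto_exp_neg_atTop_nhds_zero.neg)
  simpa using h

lemma tendsto_expF_neg (a b : ℂ) {c : ℂ} (hc : ∀ k : ℕ, c ≠ -k) :
    Tendsto (fun r : ℝ => expF a b c (-(r : ℂ))) atTop (𝓝 1) := by
  have h := (differentiableAt_gaussF a b hc zero_mem_cutPlane).continuousAt.tendsto
  rw [gaussF_zero a b hc] at h
  exact h.comp tendsto_neg_exp_neg_ofReal

lemma tendsto_expF'_neg (a b : ℂ) {c : ℂ} (hc : ∀ k : ℕ, c ≠ -k) :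
    Tendsto (fun r : ℝ => expF' a b c (-(r : ℂ))) atTop (𝓝 0) := by
  have h := (((differentiableOn_gaussF a b hc).deriv isOpen_cutPlane).differentiableAt
    (isOpen_cutPlane.mem_nhds zero_mem_cutPlane)).continuousAt.tendsto
  simpa [expF'] using tendsto_neg_exp_neg_ofReal.mul (h.comp tendsto_neg_exp_neg_ofReal)

lemma tendsto_expG {a b : ℂ} (c : ℂ) (hab : ∀ m : ℤ, a - b ≠ m) :
    Tendsto (fun r : ℝ => Complex.exp (a * r) * expG a b c r) atTop (𝓝 1) := by
  refine (tendsto_expF_neg a (a - c + 1) (sub_add_one_ne_neg_nat hab)).congr fun r => ?_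
  rw [expG, ← mul_assoc, ← Complex.exp_add]
  simp

lemma tendsto_expG' {a b : ℂ} (c : ℂ) (hab : ∀ m : ℤ, a - b ≠ m) :
    Tendsto (fun r : ℝ => Complex.exp (a * r) * expG' a b c r) atTop (𝓝 (-a)) := by
  have h := ((tendsto_expF_neg a (a - c + 1) (sub_add_one_ne_neg_nat hab)).const_mul (-a)).sub
    (tendsto_expF'_neg a (a - c + 1) (sub_add_one_ne_neg_nat hab))
  simp only [mul_one, sub_zero] at h
  refine h.congr fun r => ?_
  rw [expG', ← mul_assoc, ← Complex.exp_add]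
  simp

/-- The Wronskian of the two solutions at infinity does not vanish identically. -/
lemma exists_wronskian_expG_ne_zero {a b : ℂ} (c : ℂ) (hab : ∀ m : ℤ, a - b ≠ m) :
    ∃ s ∈ logStrip, expG a b c s * expG' b a c s - expG' a b c s * expG b a c s ≠ 0 := by
  have hba := sub_ne_intCast_symm hab
  have h := ((tendsto_expG c hab).mul (tendsto_expG' c hba)).sub
    ((tendsto_expG' c hab).mul (tendsto_expG c hba))
  have hne : (1 * -b - -a * 1 : ℂ) ≠ 0 := by
    have := hab 0
    simpa [sub_eq_add_neg, add_comm] using this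
  obtain ⟨r, hr⟩ := (h.eventually_ne hne).exists
  refine ⟨r, ofReal_mem_logStrip r, fun h0 => hr ?_⟩
  linear_combination Complex.exp (a * r) * Complex.exp (b * r) * h0

/-- The two solutions at infinity are linearly independent. -/
lemma expG_linearIndependent {a b : ℂ} (c : ℂ) (hab : ∀ m : ℤ, a - b ≠ m) {A B : ℂ}
    (h : ∀ s ∈ logStrip, A * expG a b c s + B * expG b a c s = 0) : A = 0 ∧ B = 0 := by
  have hba := sub_ne_intCast_symm hab
  obtain ⟨s, hs, hW⟩ := exists_wronskian_expG_ne_zero c hab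
  have h1 := h s hs
  have hd := ((hasDerivAt_expG c hab hs).const_mul A).add ((hasDerivAt_expG c hba hs).const_mul B)
  have hz : (fun s => A * expG a b c s + B * expG b a c s) =ᶠ[𝓝 s] fun _ => 0 := by
    filter_upwards [isOpen_logStrip.mem_nhds hs] with u hu using h u hu
  have h2 := hd.unique ((hasDerivAt_const s (0 : ℂ)).congr_of_eventuallyEq hz)
  constructor
  · refine (mul_eq_zero.1 (?_ : A * _ = 0)).resolve_right hW
    linear_combination expG' b a c s * h1 - expG b a c s * h2
  · refine (mul_eq_zero.1 (?_ : B * _ = 0)).resolve_right hW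
    linear_combination -expG' a b c s * h1 + expG a b c s * h2

lemma differentiableOn_expF (a b : ℂ) {c : ℂ} (hc : ∀ k : ℕ, c ≠ -k) :
    DifferentiableOn ℂ (expF a b c) logStrip :=
  fun _ hs => (hasDerivAt_expF a b hc hs).differentiableAt.differentiableWithinAt

lemma differentiableOn_expG {a b : ℂ} (c : ℂ) (hab : ∀ m : ℤ, a - b ≠ m) :
    DifferentiableOn ℂ (expG a b c) logStrip :=
  fun _ hs => (hasDerivAt_expG c hab hs).differentiableAt.differentiableWithinAt

/-- Two Wronskians of solutions of one second order equation have a constant ratio. -/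
lemma hasDerivAt_wronskian_div {f f' g g' u u' v v' p q : ℂ → ℂ} {s : ℂ}
    (hf : HasDerivAt f (f' s) s) (hf' : HasDerivAt f' (p s * f' s + q s * f s) s)
    (hg : HasDerivAt g (g' s) s) (hg' : HasDerivAt g' (p s * g' s + q s * g s) s)
    (hu : HasDerivAt u (u' s) s) (hu' : HasDerivAt u' (p s * u' s + q s * u s) s)
    (hv : HasDerivAt v (v' s) s) (hv' : HasDerivAt v' (p s * v' s + q s * v s) s)
    (hW : u s * v' s - u' s * v s ≠ 0) :
    HasDerivAt (fun s => (f s * g' s - f' s * g s) / (u s * v' s - u' s * v s)) 0 s := by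
  have h1 := (hf.mul hg').sub (hf'.mul hg)
  have h2 := (hu.mul hv').sub (hu'.mul hv)
  refine (h1.div h2 hW).congr_deriv ?_
  simp only [Pi.sub_apply, Pi.mul_apply]
  rw [div_eq_zero_iff]
  left
  ring

/-- Every solution at the origin is a combination of the two solutions at infinity. -/
lemma exists_expF_eq {a b c : ℂ} (hab : ∀ m : ℤ, a - b ≠ m) (hc : ∀ k : ℕ, c ≠ -k) :
    ∃ A B : ℂ, ∀ s ∈ logStrip, expF a b c s = A * expG a b c s + B * expG b a c s := by
  have hba := sub_ne_intCast_symm hab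
  obtain ⟨s₀, hs₀, hW₀⟩ := exists_wronskian_expG_ne_zero c hab
  set W : ℂ → ℂ := fun s => expG a b c s * expG' b a c s - expG' a b c s * expG b a c s with hWdef
  set p : ℂ → ℂ := fun s => -(c - 1 + Complex.exp s * (a + b)) / (1 + Complex.exp s) with hp
  set q : ℂ → ℂ := fun s => -(Complex.exp s * (a * b)) / (1 + Complex.exp s) with hq
  have dF : ∀ s ∈ logStrip, HasDerivAt (expF' a b c) (p s * expF' a b c s + q s * expF a b c s) s :=
    fun s hs => (hasDerivAt_expF' a b hc hs).congr_deriv (by simp only [hp, hq]; ring)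
  have dA : ∀ s ∈ logStrip, HasDerivAt (expG' a b c) (p s * expG' a b c s + q s * expG a b c s) s :=
    fun s hs => (hasDerivAt_expG' c hab hs).congr_deriv (by simp only [hp, hq]; ring)
  have dB : ∀ s ∈ logStrip, HasDerivAt (expG' b a c) (p s * expG' b a c s + q s * expG b a c s) s :=
    fun s hs => (hasDerivAt_expG' c hba hs).congr_deriv (by simp only [hp, hq]; ring)
  have hWc : ContinuousAt W s₀ :=
    ((hasDerivAt_expG c hab hs₀).continuousAt.mul (dB s₀ hs₀).continuousAt).sub
      ((dA s₀ hs₀).continuousAt.mul (hasDerivAt_expG c hba hs₀).continuousAt)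
  obtain ⟨r, hr, hball⟩ := Metric.mem_nhds_iff.1
    (inter_mem (isOpen_logStrip.mem_nhds hs₀) (hWc.eventually_ne hW₀))
  have hs_mem : s₀ ∈ Metric.ball s₀ r := Metric.mem_ball_self hr
  set α : ℂ → ℂ := fun s => (expF a b c s * expG' b a c s - expF' a b c s * expG b a c s) / W s
  set β : ℂ → ℂ := fun s => (expG a b c s * expF' a b c s - expG' a b c s * expF a b c s) / W s
  have hα : ∀ s ∈ Metric.ball s₀ r, α s = α s₀ := fun s hs =>
    Metric.isOpen_ball.is_const_of_deriv_eq_zero (convex_ball s₀ r).isPreconnected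
      (fun w hw => (hasDerivAt_wronskian_div (hasDerivAt_expF a b hc (hball hw).1)
        (dF w (hball hw).1) (hasDerivAt_expG c hba (hball hw).1) (dB w (hball hw).1)
        (hasDerivAt_expG c hab (hball hw).1) (dA w (hball hw).1)
        (hasDerivAt_expG c hba (hball hw).1) (dB w (hball hw).1)
        (hball hw).2).differentiableAt.differentiableWithinAt)
      (fun w hw => (hasDerivAt_wronskian_div (hasDerivAt_expF a b hc (hball hw).1)
        (dF w (hball hw).1) (hasDerivAt_expG c hba (hball hw).1) (dB w (hball hw).1)
        (hasDerivAt_expG c hab (hball hw).1) (dA w (hball hw).1)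
        (hasDerivAt_expG c hba (hball hw).1) (dB w (hball hw).1) (hball hw).2).deriv) hs hs_mem
  have hβ : ∀ s ∈ Metric.ball s₀ r, β s = β s₀ := fun s hs =>
    Metric.isOpen_ball.is_const_of_deriv_eq_zero (convex_ball s₀ r).isPreconnected
      (fun w hw => (hasDerivAt_wronskian_div (hasDerivAt_expG c hab (hball hw).1)
        (dA w (hball hw).1) (hasDerivAt_expF a b hc (hball hw).1) (dF w (hball hw).1)
        (hasDerivAt_expG c hab (hball hw).1) (dA w (hball hw).1)
        (hasDerivAt_expG c hba (hball hw).1) (dB w (hball hw).1)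
        (hball hw).2).differentiableAt.differentiableWithinAt)
      (fun w hw => (hasDerivAt_wronskian_div (hasDerivAt_expG c hab (hball hw).1)
        (dA w (hball hw).1) (hasDerivAt_expF a b hc (hball hw).1) (dF w (hball hw).1)
        (hasDerivAt_expG c hab (hball hw).1) (dA w (hball hw).1)
        (hasDerivAt_expG c hba (hball hw).1) (dB w (hball hw).1) (hball hw).2).deriv) hs hs_mem
  have hGa := differentiableOn_expG c hab
  have hGb := differentiableOn_expG c hba
  refine ⟨α s₀, β s₀, ?_⟩
  refine ((differentiableOn_expF a b hc).analyticOnNhd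
    isOpen_logStrip).eqOn_of_preconnected_of_eventuallyEq
    (DifferentiableOn.analyticOnNhd (f := fun s => α s₀ * expG a b c s + β s₀ * expG b a c s)
      (by fun_prop) isOpen_logStrip) convex_logStrip.isPreconnected hs₀ ?_
  filter_upwards [Metric.isOpen_ball.mem_nhds hs_mem] with s hs
  have hWs : W s ≠ 0 := (hball hs).2
  rw [← hα s hs, ← hβ s hs]
  simp only [α, β]
  field_simp
  simp only [hWdef]
  ring

/-- The coefficient of `(-x)^(-a)` in the expansion of `₂F₁(a, b; c; x)` at infinity. -/
noncomputable def connCoeff (a b c : ℂ) : ℂ :=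
  Complex.Gamma c * Complex.Gamma (b - a) / (Complex.Gamma b * Complex.Gamma (c - a))

/-- Near infinity the first coefficient of the expansion is `connCoeff a b c`. -/
def HasConnCoeff (a b c : ℂ) : Prop :=
  ∀ A B : ℂ, (∀ s ∈ logStrip, expF a b c s = A * expG a b c s + B * expG b a c s) →
    A = connCoeff a b c

lemma sub_add_one_ne_intCast {a b : ℂ} (hab : ∀ m : ℤ, a - b ≠ m) (m : ℤ) : a - (b + 1) ≠ m := by
  intro h
  exact hab (m + 1) (by push_cast; linear_combination h)

lemma inv_Gamma_eq (s : ℂ) : (Complex.Gamma s)⁻¹ = s * (Complex.Gamma (s + 1))⁻¹ :=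
  Complex.one_div_Gamma_eq_self_mul_one_div_Gamma_add_one s

lemma HasConnCoeff.of_succ_right {a b c : ℂ} (hab : ∀ m : ℤ, a - b ≠ m) (hc : ∀ k : ℕ, c ≠ -k)
    (h : HasConnCoeff a (b + 1) c) : HasConnCoeff a b c := by
  intro A B hAB
  have hba := sub_ne_intCast_symm hab
  have hab1 := sub_add_one_ne_intCast hab
  have hba0 : b - a ≠ 0 := by simpa using hba 0
  have hrel : ∀ s ∈ logStrip, b * expF a (b + 1) c s = A * (b - a) * expG a (b + 1) c s +
      B * (b * (b - c + 1) / (b - a + 1)) * expG (b + 1) a c s := by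
    intro s hs
    have hd : HasDerivAt (expF a b c) (A * expG' a b c s + B * expG' b a c s) s := by
      refine (((hasDerivAt_expG c hab hs).const_mul A).add
        ((hasDerivAt_expG c hba hs).const_mul B)).congr_of_eventuallyEq ?_
      filter_upwards [isOpen_logStrip.mem_nhds hs] with u hu using hAB u hu
    have e1 := (hasDerivAt_expF a b hc hs).unique hd
    have e2 := expF_raise_right a b hc hs
    have e3 := expG_raise_other c hab hs
    have e4 := expG_raise_self c hba hs
    have e5 := hAB s hs
    linear_combination -e2 + e1 + b * e5 + A * e3 + B * e4
  rcases eq_or_ne b 0 with rfl | hb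
  · have h0 := (expG_linearIndependent c hab1 (A := A * (0 - a))
      (B := B * (0 * (0 - c + 1) / (0 - a + 1))) (fun s hs => by
        rw [← hrel s hs, zero_mul])).1
    have : A = 0 := (mul_eq_zero.1 h0).resolve_right hba0
    simp [this, connCoeff]
  · have h1 := h (A * (b - a) / b) (B * ((b - c + 1) / (b - a + 1))) (fun s hs => by
      have := hrel s hs
      have e : expF a (b + 1) c s = (b * expF a (b + 1) c s) / b := by field_simp
      rw [e, this]
      field_simp)
    have h2 : Complex.Gamma (b + 1 - a) = (b - a) * Complex.Gamma (b - a) := by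
      rw [← Complex.Gamma_add_one _ hba0]
      congr 1
      ring
    rw [connCoeff, h2] at h1
    rw [connCoeff, div_eq_mul_inv, mul_inv, inv_Gamma_eq b]
    rw [div_eq_iff hb] at h1
    refine mul_right_cancel₀ hba0 (h1.trans ?_)
    rw [div_eq_mul_inv, mul_inv]
    ring

lemma HasConnCoeff.of_succ {a b c : ℂ} (hab : ∀ m : ℤ, a - b ≠ m) (hc : ∀ k : ℕ, c ≠ -k)
    (h : HasConnCoeff a b (c + 1)) : HasConnCoeff a b c := by
  intro A B hAB
  have hba := sub_ne_intCast_symm hab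
  have hc0 := ne_zero_of_ne_neg_nat hc
  have hc1 := ne_neg_nat_add_one hc
  obtain ⟨A', B', hAB'⟩ := exists_expF_eq hab hc1
  have hA' := h A' B' hAB'
  have hrel : ∀ s ∈ logStrip, (c * A - A' * (c - a)) * expG a b c s +
      (c * B - B' * (c - b)) * expG b a c s = 0 := by
    intro s hs
    have hd : HasDerivAt (expF a b (c + 1))
        (A' * expG' a b (c + 1) s + B' * expG' b a (c + 1) s) s := by
      refine (((hasDerivAt_expG (c + 1) hab hs).const_mul A').add
        ((hasDerivAt_expG (c + 1) hba hs).const_mul B')).congr_of_eventuallyEq ?_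
      filter_upwards [isOpen_logStrip.mem_nhds hs] with u hu using hAB' u hu
    have e1 := (hasDerivAt_expF a b hc1 hs).unique hd
    have e2 := expF_lower a b hc hs
    have e3 := expG_lower c hab hs
    have e4 := expG_lower c hba hs
    have e5 := hAB s hs
    have e6 := hAB' s hs
    linear_combination A' * e3 + B' * e4 + e1 - e2 + c * e6 - c * e5
  have h0 := (expG_linearIndependent c hab hrel).1
  have hG : Complex.Gamma (c + 1) = c * Complex.Gamma c := Complex.Gamma_add_one _ hc0
  rw [connCoeff, hG, div_eq_mul_inv, mul_inv] at hA'
  rw [connCoeff, div_eq_mul_inv, mul_inv, inv_Gamma_eq (c - a)]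
  refine mul_left_cancel₀ hc0 ?_
  rw [show c - a + 1 = c + 1 - a by ring]
  linear_combination h0 + (c - a) * hA'

lemma gaussF_eq_eulerIntegral (a : ℂ) {b c x : ℂ} (hb : 0 < b.re) (hc : b.re < c.re)
    (hx : x ∈ cutPlane) :
    gaussF a b c x =
      Complex.Gamma c / (Complex.Gamma b * Complex.Gamma (c - b)) * eulerIntegral a b c x := by
  have hc' := ne_neg_nat_of_re_pos (hb.trans hc)
  refine eqOn_cutPlane (differentiableOn_gaussF a b hc') (fun y hy =>
    ((hasDerivAt_eulerIntegral a hb hc hy).const_mul _).differentiableAt.differentiableWithinAt)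
    (fun y hy => ?_) hx
  rw [eulerIntegral_eq_hypergeometric a hb hc hy, gaussF_eq a b hc' hy]

open MeasureTheory in
/-- The behaviour of Euler's integral as its argument tends to `-∞`. -/
lemma tendsto_eulerIntegral {a b c : ℂ} (hab : a.re < b.re) (hb : 0 < b.re) (hc : b.re < c.re) :
    Tendsto (fun r : ℝ => Complex.exp (a * r) * eulerIntegral a b c (-Complex.exp r)) atTop
      (𝓝 (Complex.betaIntegral (b - a) (c - b))) := by
  have hβ := Complex.betaIntegral_convergent hb (v := c - b) (by simpa using hc)
  have hβ' := Complex.betaIntegral_convergent (u := b - a) (by simpa using hab)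
    (v := c - b) (by simpa using hc)
  have hpow : ∀ r t : ℝ, 0 < t → Complex.exp (a * r) * (1 - -Complex.exp r * t) ^ (-a) =
      (((Real.exp (-r) + t : ℝ) : ℂ)) ^ (-a) := by
    intro r t ht
    have h1 : (1 - -Complex.exp r * t : ℂ) = ((Real.exp r * (Real.exp (-r) + t) : ℝ) : ℂ) := by
      have : Complex.exp (r : ℂ) * Complex.exp (-(r : ℂ)) = 1 := by
        rw [← Complex.exp_add]; simp
      push_cast
      linear_combination -this
    rw [h1, Complex.ofReal_mul, Complex.mul_cpow_ofReal_nonneg (Real.exp_pos r).le (by positivity),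
      ← mul_assoc, Complex.ofReal_exp, Complex.cpow_def_of_ne_zero (Complex.exp_ne_zero _),
      ← Complex.ofReal_exp, ← Complex.ofReal_log (Real.exp_pos r).le, Real.log_exp,
      ← Complex.exp_add, show a * r + r * -a = 0 by ring, Complex.exp_zero, one_mul]
  have hmain : Tendsto (fun r : ℝ => ∫ t in (0 : ℝ)..1,
      ((t : ℂ) ^ (b - 1) * (1 - (t : ℂ)) ^ (c - b - 1)) *
        ((Real.exp (-r) + t : ℝ) : ℂ) ^ (-a)) atTop
      (𝓝 (∫ t in (0 : ℝ)..1, ((t : ℂ) ^ (b - 1) * (1 - (t : ℂ)) ^ (c - b - 1)) *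
        (t : ℂ) ^ (-a))) := by
    refine intervalIntegral.tendsto_integral_filter_of_dominated_convergence
      (fun t => ‖(t : ℂ) ^ (b - a - 1) * (1 - (t : ℂ)) ^ (c - b - 1)‖ +
        ‖(t : ℂ) ^ (b - 1) * (1 - (t : ℂ)) ^ (c - b - 1)‖ * 2 ^ |a.re|) ?_ ?_ ?_ ?_
    · refine Eventually.of_forall fun r => ?_
      rw [Set.uIoc_of_le zero_le_one]
      refine hβ.aestronglyMeasurable.mul (Measurable.aestronglyMeasurable ?_)
      fun_prop
    · filter_upwards [eventually_ge_atTop (0 : ℝ)] with r hr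
      filter_upwards with t ht
      rw [Set.uIoc_of_le zero_le_one] at ht
      have ht0 : (t : ℂ) ≠ 0 := by exact_mod_cast ht.1.ne'
      have hexp := Real.exp_pos (-r)
      have hexp1 : Real.exp (-r) ≤ 1 := Real.exp_le_one_iff.2 (by linarith)
      have hb1 : ‖((Real.exp (-r) + t : ℝ) : ℂ) ^ (-a)‖ ≤ t ^ (-a.re) + 2 ^ |a.re| := by
        rw [Complex.norm_cpow_eq_rpow_re_of_pos (by linarith [ht.1]), Complex.neg_re]
        have p1 : (0 : ℝ) ≤ t ^ (-a.re) := Real.rpow_nonneg ht.1.le _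
        have p2 : (0 : ℝ) ≤ 2 ^ |a.re| := Real.rpow_nonneg two_pos.le _
        rcases le_total a.re 0 with h | h
        · have : (Real.exp (-r) + t) ^ (-a.re) ≤ 2 ^ (-a.re) :=
            Real.rpow_le_rpow (by linarith [ht.1]) (by linarith [ht.2]) (by linarith)
          rw [abs_of_nonpos h]
          rw [abs_of_nonpos h] at p2
          linarith
        · have : (Real.exp (-r) + t) ^ (-a.re) ≤ t ^ (-a.re) :=
            Real.rpow_le_rpow_of_nonpos ht.1 (by linarith) (by linarith)
          linarith
      have e1 : ‖(t : ℂ) ^ (b - a - 1)‖ = ‖(t : ℂ) ^ (b - 1)‖ * t ^ (-a.re) := by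
        rw [Complex.norm_cpow_eq_rpow_re_of_pos ht.1, Complex.norm_cpow_eq_rpow_re_of_pos ht.1,
          ← Real.rpow_add ht.1]
        congr 1
        simp
        ring
      rw [norm_mul _ (((Real.exp (-r) + t : ℝ) : ℂ) ^ (-a)), norm_mul ((t : ℂ) ^ (b - a - 1)), e1]
      calc _ ≤ ‖(t : ℂ) ^ (b - 1) * (1 - (t : ℂ)) ^ (c - b - 1)‖ *
            (t ^ (-a.re) + 2 ^ |a.re|) := by gcongr
        _ = _ := by rw [norm_mul]; ring
    · exact hβ'.norm.add (hβ.norm.mul_const _)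
    · filter_upwards with t ht
      rw [Set.uIoc_of_le zero_le_one] at ht
      refine Tendsto.const_mul _ ?_
      have h1 : Tendsto (fun r : ℝ => ((Real.exp (-r) + t : ℝ) : ℂ)) atTop (𝓝 (t : ℂ)) := by
        have := (Complex.continuous_ofReal.tendsto _).comp
          (Real.tendsto_exp_neg_atTop_nhds_zero.add_const t)
        rw [zero_add] at this
        exact this
      exact h1.cpow tendsto_const_nhds (Complex.ofReal_mem_slitPlane.2 ht.1)
  have hlim : (∫ t in (0 : ℝ)..1, ((t : ℂ) ^ (b - 1) * (1 - (t : ℂ)) ^ (c - b - 1)) *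
      (t : ℂ) ^ (-a)) = Complex.betaIntegral (b - a) (c - b) := by
    refine intervalIntegral.integral_congr_ae ?_
    filter_upwards with t ht
    rw [Set.uIoc_of_le zero_le_one] at ht
    have ht0 : (t : ℂ) ≠ 0 := by exact_mod_cast ht.1.ne'
    rw [show b - a - 1 = b - 1 + -a by ring, Complex.cpow_add _ _ ht0]
    ring
  rw [← hlim]
  refine hmain.congr fun r => ?_
  rw [eulerIntegral, ← intervalIntegral.integral_const_mul]
  refine intervalIntegral.integral_congr_ae ?_
  filter_upwards with t ht
  rw [Set.uIoc_of_le zero_le_one] at ht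
  rw [← hpow r t ht.1]
  ring

/-- When `re a < re b` the first solution dominates at infinity, and when moreover
`0 < re b < re c` the limit of Euler's integral is a Beta function. -/
lemma hasConnCoeff_of_re_lt {a b c : ℂ} (hab : ∀ m : ℤ, a - b ≠ m) (hre : a.re < b.re)
    (hb : 0 < b.re) (hc : b.re < c.re) : HasConnCoeff a b c := by
  intro A B hAB
  have hba := sub_ne_intCast_symm hab
  have hΓ : Complex.Gamma (c - b) ≠ 0 := Complex.Gamma_ne_zero_of_re_pos (by simpa using hc)
  have h1 : Tendsto (fun r : ℝ => Complex.exp (a * r) * expF a b c r) atTop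
      (𝓝 (connCoeff a b c)) := by
    have h := (tendsto_eulerIntegral hre hb hc).const_mul
      (Complex.Gamma c / (Complex.Gamma b * Complex.Gamma (c - b)))
    rw [Complex.betaIntegral_eq_Gamma_mul_div _ _ (by simpa using hre) (by simpa using hc),
      show b - a + (c - b) = c - a by ring] at h
    have e : connCoeff a b c = Complex.Gamma c / (Complex.Gamma b * Complex.Gamma (c - b)) *
        (Complex.Gamma (b - a) * Complex.Gamma (c - b) / Complex.Gamma (c - a)) := by
      rw [connCoeff]
      field_simp
    rw [e]
    refine h.congr fun r => ?_
    rw [expF, gaussF_eq_eulerIntegral a hb hc (neg_exp_mem_cutPlane (ofReal_mem_logStrip r))]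
    ring
  have h2 : Tendsto (fun r : ℝ => Complex.exp (a * r) * expF a b c r) atTop (𝓝 A) := by
    have hexp : Tendsto (fun r : ℝ => Complex.exp ((a - b) * r)) atTop (𝓝 0) := by
      rw [tendsto_zero_iff_norm_tendsto_zero]
      have : Tendsto (fun r : ℝ => Real.exp ((a.re - b.re) * r)) atTop (𝓝 0) :=
        Real.tendsto_exp_atBot.comp (tendsto_id.const_mul_atTop_of_neg (by linarith))
      refine this.congr fun r => ?_
      rw [Complex.norm_exp]
      simp
    have h := ((tendsto_expG c hab).const_mul A).add
      ((hexp.mul (tendsto_expG c hba)).const_mul B)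
    simp only [mul_one, mul_zero, add_zero] at h
    refine h.congr fun r => ?_
    rw [hAB r (ofReal_mem_logStrip r), show a * (r : ℂ) = (a - b) * r + b * r by ring,
      Complex.exp_add]
    ring
  exact tendsto_nhds_unique h2 h1

/-- The contiguous relations lower `c` and then `b` from the range where Euler's integral applies. -/
lemma hasConnCoeff {a b c : ℂ} (hab : ∀ m : ℤ, a - b ≠ m) (hc : ∀ k : ℕ, c ≠ -k) :
    HasConnCoeff a b c := by
  obtain ⟨n, hn⟩ := exists_nat_gt (max (-b.re) (a.re - b.re))
  obtain ⟨m, hm⟩ := exists_nat_gt (b.re + n - c.re)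
  have hn1 := (le_max_left _ _).trans_lt hn
  have hn2 := (le_max_right _ _).trans_lt hn
  have hcm : ∀ b : ℂ, (∀ m : ℤ, a - b ≠ m) → ∀ m : ℕ, ∀ c : ℂ, (∀ k : ℕ, c ≠ -k) →
      HasConnCoeff a b (c + m) → HasConnCoeff a b c := by
    intro b hab m
    induction m with
    | zero => intro c _ h; simpa using h
    | succ m ih =>
      intro c hc h
      refine (ih (c + 1) (ne_neg_nat_add_one hc) ?_).of_succ hab hc
      convert h using 1
      push_cast
      ring
  have hbn : ∀ n : ℕ, ∀ b : ℂ, (∀ m : ℤ, a - b ≠ m) → HasConnCoeff a (b + n) c →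
      HasConnCoeff a b c := by
    intro n
    induction n with
    | zero => intro b _ h; simpa using h
    | succ n ih =>
      intro b hab h
      refine (ih (b + 1) (sub_add_one_ne_intCast hab) ?_).of_succ_right hab hc
      convert h using 1
      push_cast
      ring
  have habn : ∀ m : ℤ, a - (b + n) ≠ m := fun m h =>
    hab (m + n) (by push_cast; linear_combination h)
  refine hbn n b hab (hcm (b + n) habn m c hc (hasConnCoeff_of_re_lt habn ?_ ?_ ?_))
  · simp only [Complex.add_re, Complex.natCast_re]; linarith
  · simp only [Complex.add_re, Complex.natCast_re]; linarith
  · simp only [Complex.add_re, Complex.natCast_re]; linarith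

/-- The connection formula of the hypergeometric function between `0` and `∞`. -/
theorem expF_eq_connCoeff {a b c : ℂ} (hab : ∀ m : ℤ, a - b ≠ m) (hc : ∀ k : ℕ, c ≠ -k) {s : ℂ}
    (hs : s ∈ logStrip) :
    expF a b c s = connCoeff a b c * expG a b c s + connCoeff b a c * expG b a c s := by
  have hba := sub_ne_intCast_symm hab
  obtain ⟨A, B, h⟩ := exists_expF_eq hab hc
  rw [h s hs, hasConnCoeff hab hc A B h, hasConnCoeff hba hc B A (fun u hu => ?_)]
  rw [expF, gaussF_symm b a hc (neg_exp_mem_cutPlane hu), ← expF, h u hu, add_comm]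

/-! ### Pfaff's transformation -/

lemma inv_mem_slitPlane {z : ℂ} (hz : z ∈ Complex.slitPlane) : z⁻¹ ∈ Complex.slitPlane := by
  have h0 := Complex.normSq_pos.2 (Complex.slitPlane_ne_zero hz)
  rw [Complex.mem_slitPlane_iff] at hz ⊢
  rw [Complex.inv_re, Complex.inv_im]
  rcases hz with h | h
  · exact Or.inl (div_pos h h0)
  · exact Or.inr (div_ne_zero (neg_ne_zero.2 h) h0.ne')

lemma div_sub_one_mem_cutPlane {z : ℂ} (hz : z ∈ cutPlane) : z / (z - 1) ∈ cutPlane := by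
  have hz' : 1 - z ∈ Complex.slitPlane := hz
  have h0 : 1 - z ≠ 0 := Complex.slitPlane_ne_zero hz'
  have h1 : z - 1 ≠ 0 := fun h => h0 (by linear_combination -h)
  have : 1 - z / (z - 1) = (1 - z)⁻¹ := by
    field_simp
    ring
  change 1 - z / (z - 1) ∈ Complex.slitPlane
  rw [this]
  exact inv_mem_slitPlane hz'

/-- The contiguous relation behind Pfaff's transformation. -/
lemma gaussF_pfaff_aux (a b : ℂ) {c : ℂ} (hc : ∀ k : ℕ, c ≠ -k) {u : ℂ} (hu : u ∈ cutPlane) :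
    a * gaussF a b c u - (1 - u) * deriv (gaussF a b c) u =
      a * (c - b) / c * gaussF (a + 1) b (c + 1) u := by
  have hc0 := ne_zero_of_ne_neg_nat hc
  have h1 := gaussF_raise a b hc hu
  have h2 := deriv_gaussF a b hc hu
  have h3 := gaussF_lower (a + 1) b hc hu
  have h4 := gaussF_raise_right (a + 1) b (ne_neg_nat_add_one hc) hu
  have h5 : deriv (gaussF a b c) u * c = a * (b * gaussF (a + 1) (b + 1) (c + 1) u) := by
    rw [h2]; field_simp
  refine mul_right_cancel₀ hc0 ?_
  have h6 : a * (c - b) / c * gaussF (a + 1) b (c + 1) u * c =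
    a * (c - b) * gaussF (a + 1) b (c + 1) u := by field_simp
  rw [h6]
  linear_combination c * h1 - h5 - a * h3 + a * h4

lemma hasDerivAt_pfaff (a b : ℂ) {c : ℂ} (hc : ∀ k : ℕ, c ≠ -k) {z : ℂ} (hz : z ∈ cutPlane) :
    HasDerivAt (fun z => (1 - z) ^ (-a) * gaussF a b c (z / (z - 1)))
      (a * (c - b) / c * ((1 - z) ^ (-(a + 1)) * gaussF (a + 1) b (c + 1) (z / (z - 1)))) z := by
  have hz' : 1 - z ∈ Complex.slitPlane := hz
  have h0 : 1 - z ≠ 0 := Complex.slitPlane_ne_zero hz'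
  have h1 : z - 1 ≠ 0 := fun h => h0 (by linear_combination -h)
  have hu := div_sub_one_mem_cutPlane hz
  have d1 : HasDerivAt (fun z : ℂ => (1 - z) ^ (-a)) (-a * (1 - z) ^ (-a - 1) * -1) z :=
    ((hasDerivAt_id z).const_sub 1).cpow_const hz'
  have d2 : HasDerivAt (fun z : ℂ => z / (z - 1)) ((1 * (z - 1) - z * 1) / (z - 1) ^ 2) z :=
    (hasDerivAt_id z).div ((hasDerivAt_id z).sub_const 1) h1
  have d3 := (differentiableAt_gaussF a b hc hu).hasDerivAt.comp z d2
  refine (d1.mul d3).congr_deriv ?_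
  have key := gaussF_pfaff_aux a b hc hu
  have e1 : (1 - z) ^ (-a) = (1 - z) ^ (-a - 1) * (1 - z) := by
    rw [Complex.cpow_sub _ _ h0, Complex.cpow_one]
    field_simp
  have e2 : 1 - z / (z - 1) = (1 - z)⁻¹ := by
    field_simp
    ring
  have e3 : (1 * (z - 1) - z * 1) / (z - 1) ^ 2 = -((1 - z)⁻¹ * (1 - z)⁻¹) := by
    field_simp
    ring
  rw [show -(a + 1) = -a - 1 by ring]
  rw [e2] at key
  rw [e3, e1]
  simp only [Function.comp_def]
  have e4 : (1 - z) * (1 - z)⁻¹ = 1 := mul_inv_cancel₀ h0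
  linear_combination (1 - z) ^ (-a - 1) * key - (1 - z) ^ (-a - 1) *
    deriv (gaussF a b c) (z / (z - 1)) * (1 - z)⁻¹ * e4

/-- Pfaff's transformation. Differentiation takes the difference of the two sides to a multiple of the
same difference for `a + 1`, `b + 1`, `c + 1`, so all its derivatives vanish at the origin. -/
theorem gaussF_pfaff (a b : ℂ) {c : ℂ} (hc : ∀ k : ℕ, c ≠ -k) {z : ℂ} (hz : z ∈ cutPlane) :
    gaussF a b c z = (1 - z) ^ (-a) * gaussF a (c - b) c (z / (z - 1)) := by
  have hcn : ∀ n k : ℕ, c + n ≠ -k := fun n k h => hc (n + k) (by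
    push_cast; linear_combination h)
  refine eqOn_cutPlane (differentiableOn_gaussF a b hc)
    (g := fun z => (1 - z) ^ (-a) * gaussF a (c - b) c (z / (z - 1)))
    (fun y hy => (hasDerivAt_pfaff a (c - b) hc hy).differentiableAt.differentiableWithinAt)
    (fun y hy => ?_) hz
  have key := eq_zero_of_hasDerivAt_succ one_pos
    (fun n y => gaussF (a + n) (b + n) (c + n) y -
      (1 - y) ^ (-(a + n)) * gaussF (a + n) (c - b) (c + n) (y / (y - 1)))
    (fun n => (a + n) * (b + n) / (c + n)) ?_ ?_ hy
  · simpa [sub_eq_zero] using key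
  · intro n x hx
    have hx' := ball_subset_cutPlane hx
    have h1 := (differentiableAt_gaussF (a + n) (b + n) (hcn n) hx').hasDerivAt
    rw [deriv_gaussF _ _ (hcn n) hx'] at h1
    refine (h1.sub (hasDerivAt_pfaff (a + n) (c - b) (hcn n) hx')).congr_deriv ?_
    push_cast
    simp only [← add_assoc]
    rw [show c + n - (c - b) = b + n by ring]
    ring
  · intro n
    simp [gaussF_zero _ _ (hcn n)]

/-! ### Confluence of the series -/

lemma kummerM_eq_tsum (a t : ℂ) {c : ℂ} (hc : ∀ k : ℕ, c ≠ -k) :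
    kummerM a c t = ∑' n : ℕ, (n.factorial : ℂ)⁻¹ * (ascPochhammer ℂ n).eval a *
      ((ascPochhammer ℂ n).eval c)⁻¹ * t ^ n := by
  rw [kummerM, Complex.regularizedHGFun, FormalMultilinearSeries.sum, ← tsum_mul_left]
  refine tsum_congr fun n => ?_
  have hΓ := Complex.Gamma_ne_zero hc
  have h := Complex.Gamma_add_nat_div_Gamma_eq (n := n) c hc
  rw [div_eq_iff hΓ] at h
  rw [Complex.regularizedHGFunSeries, FormalMultilinearSeries.ofScalars_apply_eq,
    Complex.regularizedHGFunCoeff]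
  simp only [Multiset.map_singleton, Multiset.prod_singleton, smul_eq_mul, h]
  field_simp

lemma ascPochhammer_eval_eq_prod (n : ℕ) (a : ℂ) :
    (ascPochhammer ℂ n).eval a = ∏ k ∈ Finset.range n, (a + k) := by
  induction n with
  | zero => simp
  | succ n ih => rw [ascPochhammer_succ_eval, ih, Finset.prod_range_succ]

/-- The series dominating the confluent limit. -/
lemma summable_confluent_bound (q r : ℂ) {T : ℝ} (hT : 0 ≤ T) :
    Summable (fun n : ℕ => ‖(n.factorial : ℂ)⁻¹ * (ascPochhammer ℂ n).eval q *
      ((ascPochhammer ℂ n).eval r)⁻¹‖ * ∏ k ∈ Finset.range n, (T + k / 4)) := by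
  refine summable_of_ratio_norm_eventually_le (r := 1 / 2) (by norm_num) ?_
  obtain ⟨N, hN⟩ := exists_nat_gt (4 * (T + ‖q‖ + ‖r‖ + 1))
  filter_upwards [eventually_ge_atTop N] with n hn
  have hn' : 4 * (T + ‖q‖ + ‖r‖ + 1) ≤ n := hN.le.trans (by exact_mod_cast hn)
  have hP : ∀ m : ℕ, 0 ≤ ∏ k ∈ Finset.range m, (T + k / 4) := fun m =>
    Finset.prod_nonneg fun k _ => by positivity
  rw [norm_mul, norm_norm, norm_mul _ (∏ k ∈ Finset.range n, (T + k / 4)), norm_norm,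
    Real.norm_of_nonneg (hP _), Real.norm_of_nonneg (hP _), Finset.prod_range_succ,
    ascPochhammer_succ_eval, ascPochhammer_succ_eval, Nat.factorial_succ]
  push_cast
  have hq0 := norm_nonneg q
  have hr0 := norm_nonneg r
  have hrn : (n : ℝ) - ‖r‖ ≤ ‖r + n‖ := by
    have := norm_sub_norm_le (n : ℂ) (-r)
    rw [norm_neg, Complex.norm_natCast, sub_neg_eq_add, add_comm (n : ℂ)] at this
    exact this
  have hqn : ‖q + n‖ ≤ ‖q‖ + n := by
    simpa using norm_add_le q (n : ℂ)
  have hrpos : 0 < ‖r + n‖ := by linarith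
  have hn1 : ‖(n + 1 : ℂ)‖ = n + 1 := by
    rw [← Nat.cast_add_one, Complex.norm_natCast]; push_cast; ring
  have hineq : ‖q + n‖ * (T + n / 4) ≤ 1 / 2 * (‖r + n‖ * (n + 1)) := by
    have h1 : ‖q + n‖ * (T + n / 4) ≤ (‖q‖ + n) * (T + n / 4) := by gcongr
    have h2 : (n - ‖r‖) * (n + 1) ≤ ‖r + n‖ * ((n : ℝ) + 1) := by gcongr
    have h3 : (‖q‖ + n) * (T + n / 4) ≤ 1 / 2 * ((n - ‖r‖) * (n + 1)) := by
      nlinarith [mul_nonneg hq0 (by linarith : 0 ≤ (n : ℝ) - 4 * T),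
        mul_nonneg (by linarith : 0 ≤ (n : ℝ)) (by linarith :
          0 ≤ (n : ℝ) - 4 * (T + ‖q‖ + ‖r‖ + 1)), mul_nonneg hr0 (by linarith : 0 ≤ (n : ℝ) - 1),
        mul_nonneg hq0 hT]
    linarith
  simp only [norm_mul, norm_inv, mul_inv]
  rw [hn1]
  have hineq' : ‖q + n‖ * (T + n / 4) * (‖r + n‖⁻¹ * ((n : ℝ) + 1)⁻¹) ≤ 1 / 2 := by
    rw [← mul_inv, ← div_eq_mul_inv, div_le_iff₀ (by positivity)]
    exact hineq
  have hpos : 0 ≤ ‖(n.factorial : ℂ)‖⁻¹ * ‖(ascPochhammer ℂ n).eval q‖ *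
      ‖(ascPochhammer ℂ n).eval r‖⁻¹ * ∏ k ∈ Finset.range n, (T + k / 4) := by
    have := hP n
    positivity
  calc _ = (‖q + n‖ * (T + n / 4) * (‖r + n‖⁻¹ * ((n : ℝ) + 1)⁻¹)) *
        (‖(n.factorial : ℂ)‖⁻¹ * ‖(ascPochhammer ℂ n).eval q‖ *
          ‖(ascPochhammer ℂ n).eval r‖⁻¹ * ∏ k ∈ Finset.range n, (T + k / 4)) := by ring
    _ ≤ _ := mul_le_mul_of_nonneg_right hineq' hpos

/-- The confluent limit `₂F₁(p + X, q; r; t / X) → ₁F₁(q; r; t)` as `X → ∞`. -/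
theorem tendsto_hypergeometric_confluent {ι : Type*} {l : Filter ι} {X : ι → ℂ}
    (hX : Tendsto (fun i => ‖X i‖) l atTop) (p q : ℂ) {r : ℂ} (hr : ∀ k : ℕ, r ≠ -k) (t : ℂ) :
    Tendsto (fun i => ₂F₁ (p + X i) q r (t / X i)) l (𝓝 (kummerM q r t)) := by
  have hinv : Tendsto (fun i => (X i)⁻¹) l (𝓝 0) := by
    rw [tendsto_zero_iff_norm_tendsto_zero]
    simp only [norm_inv]
    exact hX.inv_tendsto_atTop
  simp only [kummerM_eq_tsum q t hr, ordinaryHypergeometric_eq_tsum]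
  refine tendsto_tsum_of_dominated_convergence
    (summable_confluent_bound q r (T := ‖t‖ * (1 + ‖p‖)) (by positivity)) ?_ ?_
  · intro n
    have hprod : Tendsto (fun i => ∏ k ∈ Finset.range n, ((p + X i + k) * (X i)⁻¹)) l
        (𝓝 (∏ k ∈ Finset.range n, (1 : ℂ))) := by
      refine tendsto_finsetProd _ fun k _ => ?_
      have h := (hinv.const_mul (p + k)).add_const 1
      simp only [mul_zero, zero_add] at h
      refine h.congr' ?_
      filter_upwards [hX.eventually_gt_atTop 0] with i hi
      have : X i ≠ 0 := norm_pos_iff.1 hi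
      field_simp
      ring
    have h := hprod.const_mul ((n.factorial : ℂ)⁻¹ * (ascPochhammer ℂ n).eval q *
      ((ascPochhammer ℂ n).eval r)⁻¹ * t ^ n)
    rw [Finset.prod_const_one, mul_one] at h
    refine h.congr fun i => ?_
    rw [Finset.prod_mul_distrib, ← ascPochhammer_eval_eq_prod, Finset.prod_const,
      Finset.card_range, smul_eq_mul, div_eq_mul_inv, mul_pow]
    ring
  · filter_upwards [hX.eventually_ge_atTop (1 + 4 * ‖t‖)] with i hi n
    have ht0 := norm_nonneg t
    have hXpos : 0 < ‖X i‖ := by linarith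
    rw [smul_eq_mul]
    have e : (n.factorial : ℂ)⁻¹ * (ascPochhammer ℂ n).eval (p + X i) *
        (ascPochhammer ℂ n).eval q * ((ascPochhammer ℂ n).eval r)⁻¹ * (t / X i) ^ n =
        ((n.factorial : ℂ)⁻¹ * (ascPochhammer ℂ n).eval q * ((ascPochhammer ℂ n).eval r)⁻¹) *
          ∏ k ∈ Finset.range n, ((p + X i + k) * (t / X i)) := by
      rw [Finset.prod_mul_distrib, ← ascPochhammer_eval_eq_prod, Finset.prod_const,
        Finset.card_range]
      ring
    rw [e, norm_mul, norm_prod]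
    refine mul_le_mul_of_nonneg_left ?_ (norm_nonneg _)
    refine Finset.prod_le_prod (fun _ _ => norm_nonneg _) fun k _ => ?_
    rw [norm_mul, norm_div]
    have h1 : ‖p + X i + k‖ ≤ ‖p‖ + ‖X i‖ + k := by
      refine (norm_add_le _ _).trans ?_
      rw [Complex.norm_natCast]
      gcongr
      exact norm_add_le _ _
    calc ‖p + X i + k‖ * (‖t‖ / ‖X i‖) ≤ (‖p‖ + ‖X i‖ + k) * (‖t‖ / ‖X i‖) := by gcongr
      _ ≤ ‖t‖ * (1 + ‖p‖) + k / 4 := by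
        rw [← mul_div_assoc, div_le_iff₀ hXpos]
        have hk : (0 : ℝ) ≤ k := k.cast_nonneg
        have hp := norm_nonneg p
        nlinarith [mul_nonneg hk (by linarith : 0 ≤ ‖X i‖ - 4 * ‖t‖),
          mul_nonneg (mul_nonneg ht0 hp) (by linarith : 0 ≤ ‖X i‖ - 1)]

/-! ### Ratios of Gamma functions -/

/-- The ratio of `Γ(z + a)` to its leading asymptotics `Γ(z) z^a`. -/
noncomputable def gammaQuot (a z : ℂ) : ℂ :=
  Complex.Gamma (z + a) / (Complex.Gamma z * z ^ a)

lemma natCast_add_normSq_le {z : ℂ} (hz : 0 ≤ z.re) (k : ℕ) :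
    (‖z‖ + k) ^ 2 ≤ 2 * ‖z + k‖ ^ 2 := by
  have h1 : ‖z‖ ^ 2 = z.re ^ 2 + z.im ^ 2 := by
    rw [← Complex.normSq_eq_norm_sq, Complex.normSq_apply]; ring
  have h2 : ‖z + k‖ ^ 2 = (z.re + k) ^ 2 + z.im ^ 2 := by
    rw [← Complex.normSq_eq_norm_sq, Complex.normSq_apply]; simp; ring
  have hk : (0 : ℝ) ≤ k := k.cast_nonneg
  nlinarith [sq_nonneg (‖z‖ - k), mul_nonneg hz hk]

lemma norm_le_norm_add_natCast {z : ℂ} (hz : 0 ≤ z.re) (k : ℕ) : ‖z‖ ≤ ‖z + k‖ := by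
  rw [← sq_le_sq₀ (norm_nonneg _) (norm_nonneg _)]
  have h1 : ‖z‖ ^ 2 = z.re ^ 2 + z.im ^ 2 := by
    rw [← Complex.normSq_eq_norm_sq, Complex.normSq_apply]; ring
  have h2 : ‖z + k‖ ^ 2 = (z.re + k) ^ 2 + z.im ^ 2 := by
    rw [← Complex.normSq_eq_norm_sq, Complex.normSq_apply]; simp; ring
  have hk : (0 : ℝ) ≤ k := k.cast_nonneg
  nlinarith [mul_nonneg hz hk]

lemma add_ne_neg_nat {a z : ℂ} (hz : 0 ≤ z.re) (ha : ‖a‖ < ‖z‖) (k : ℕ) : z + a ≠ -k := by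
  intro h
  have h1 := norm_le_norm_add_natCast hz k
  rw [show z + k = -a by linear_combination h, norm_neg] at h1
  linarith

lemma log_add_one_sub_log {z : ℂ} (hz : 0 ≤ z.re) (h0 : z ≠ 0) :
    Complex.log (z + 1) = Complex.log z + Complex.log (1 + z⁻¹) := by
  have h1 : z + 1 = z * (1 + z⁻¹) := by field_simp
  have hre : 0 < (z + 1).re := by simpa using add_pos_of_nonneg_of_pos hz one_pos
  have hz1 : z + 1 ≠ 0 := fun h => by simp [h] at hre
  have hw : 1 + z⁻¹ ≠ 0 := fun h => hz1 (by rw [h1, h, mul_zero])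
  have a1 := Complex.abs_arg_le_pi_div_two_iff.2 hz
  have hwre : 0 < (1 + z⁻¹).re := by
    rw [Complex.add_re, Complex.one_re, Complex.inv_re]
    have := div_nonneg hz (Complex.normSq_nonneg z)
    linarith
  have a2 := Complex.abs_arg_lt_pi_div_two_iff.2 (Or.inl hwre)
  rw [h1, Complex.log_mul h0 hw]
  rw [abs_le] at a1
  rw [abs_lt] at a2
  constructor <;> linarith

/-- The logarithm of `gammaQuot a z / gammaQuot a (z + 1)`. -/
noncomputable def logGammaStep (a z : ℂ) : ℂ :=
  a * Complex.log (1 + z⁻¹) - Complex.log (1 + a * z⁻¹)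

lemma gammaQuot_eq {a z : ℂ} (hz : 0 ≤ z.re) (ha : ‖a‖ < ‖z‖) :
    gammaQuot a z = Complex.exp (logGammaStep a z) * gammaQuot a (z + 1) := by
  have h0 : z ≠ 0 := norm_pos_iff.1 ((norm_nonneg a).trans_lt ha)
  have hza : z + a ≠ 0 := by simpa using add_ne_neg_nat hz ha 0
  have hre : 0 < (z + 1).re := by simpa using add_pos_of_nonneg_of_pos hz one_pos
  have hz1 : z + 1 ≠ 0 := fun h => by simp [h] at hre
  have h1 : 1 + a * z⁻¹ ≠ 0 := fun h => hza (by
    have : z + a = z * (1 + a * z⁻¹) := by field_simp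
    rw [this, h, mul_zero])
  have hΓ : Complex.Gamma (z + 1) ≠ 0 := Complex.Gamma_ne_zero_of_re_pos hre
  have hΓ' : Complex.Gamma z ≠ 0 := fun h => hΓ (by rw [Complex.Gamma_add_one z h0, h, mul_zero])
  have e2 : (z + 1) ^ a = z ^ a * Complex.exp (a * Complex.log (1 + z⁻¹)) := by
    rw [Complex.cpow_def_of_ne_zero hz1, Complex.cpow_def_of_ne_zero h0,
      log_add_one_sub_log hz h0, ← Complex.exp_add]
    congr 1
    ring
  rw [gammaQuot, gammaQuot, show z + 1 + a = z + a + 1 by ring, Complex.Gamma_add_one _ hza,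
    Complex.Gamma_add_one _ h0, logGammaStep, Complex.exp_sub, Complex.exp_log h1, e2]
  have hzp : z ^ a ≠ 0 := by simp [Complex.cpow_eq_zero_iff, h0]
  have hE := Complex.exp_ne_zero (a * Complex.log (1 + z⁻¹))
  have h3 : z + a = z * (1 + a * z⁻¹) := by field_simp
  rw [h3]
  generalize Complex.exp (a * Complex.log (1 + z⁻¹)) = E at *
  field_simp

lemma norm_log_one_add_sub_le {w : ℂ} (hw : ‖w‖ ≤ 1 / 2) :
    ‖Complex.log (1 + w) - w‖ ≤ ‖w‖ ^ 2 := by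
  refine (Complex.norm_log_one_add_sub_self_le (by linarith)).trans ?_
  have : (1 - ‖w‖)⁻¹ ≤ 2 := by
    rw [inv_le_comm₀ (by linarith) two_pos]
    linarith
  have h2 := sq_nonneg ‖w‖
  nlinarith

lemma norm_logGammaStep_le {a z : ℂ} (hz1 : 2 ≤ ‖z‖) (hza : 2 * ‖a‖ ≤ ‖z‖) :
    ‖logGammaStep a z‖ ≤ (‖a‖ + ‖a‖ ^ 2) / ‖z‖ ^ 2 := by
  have hpos : 0 < ‖z‖ := by linarith
  have w1 : ‖z⁻¹‖ ≤ 1 / 2 := by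
    rw [norm_inv, inv_le_comm₀ hpos (by norm_num)]
    simpa using hz1
  have w2 : ‖a * z⁻¹‖ ≤ 1 / 2 := by
    rw [norm_mul, norm_inv, ← div_eq_mul_inv, div_le_iff₀ hpos]
    linarith
  have e : logGammaStep a z = a * (Complex.log (1 + z⁻¹) - z⁻¹) -
      (Complex.log (1 + a * z⁻¹) - a * z⁻¹) := by
    rw [logGammaStep]; ring
  rw [e]
  refine (norm_sub_le _ _).trans ?_
  rw [norm_mul]
  have b1 := norm_log_one_add_sub_le w1
  have b2 := norm_log_one_add_sub_le w2
  calc _ ≤ ‖a‖ * ‖z⁻¹‖ ^ 2 + ‖a * z⁻¹‖ ^ 2 := by gcongr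
    _ = _ := by rw [norm_mul, norm_inv]; field_simp

/-- Iterating the step gives `gammaQuot a z` up to a uniformly small factor from its values far to
the right. -/
lemma exists_gammaQuot_eq {a z : ℂ} (hz : 0 ≤ z.re) (hz1 : 2 ≤ ‖z‖) (hza : 2 * ‖a‖ ≤ ‖z‖)
    (ha : ‖a‖ < ‖z‖) (n : ℕ) :
    ∃ S : ℂ, gammaQuot a z = Complex.exp S * gammaQuot a (z + n) ∧
      ‖S‖ ≤ 2 * (‖a‖ + ‖a‖ ^ 2) * (1 / (‖z‖ - 1) - 1 / (‖z‖ + n - 1)) := by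
  induction n with
  | zero => exact ⟨0, by simp, by simp⟩
  | succ n ih =>
    obtain ⟨S, hS, hSn⟩ := ih
    have hre : 0 ≤ (z + n).re := by simpa using add_nonneg hz n.cast_nonneg
    have hle := norm_le_norm_add_natCast hz n
    refine ⟨S + logGammaStep a (z + n), ?_, ?_⟩
    · rw [hS, gammaQuot_eq hre (ha.trans_le hle), Complex.exp_add]
      push_cast
      rw [add_assoc]
      ring
    · refine (norm_add_le _ _).trans ?_
      have h1 := norm_logGammaStep_le (a := a) (hz1.trans hle) (hza.trans hle)
      have h2 := natCast_add_normSq_le hz n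
      have hn : (0 : ℝ) ≤ n := n.cast_nonneg
      have h3 : 1 / ‖z + n‖ ^ 2 ≤ 2 * (1 / (‖z‖ + n - 1) - 1 / (‖z‖ + n)) := by
        rw [div_sub_div _ _ (by linarith) (by linarith), ← mul_div_assoc,
          div_le_div_iff₀ (by nlinarith) (by nlinarith)]
        nlinarith
      have h4 : ‖logGammaStep a (z + n)‖ ≤
          2 * (‖a‖ + ‖a‖ ^ 2) * (1 / (‖z‖ + n - 1) - 1 / (‖z‖ + n)) := by
        refine h1.trans ?_
        rw [div_eq_mul_one_div]
        have : 0 ≤ ‖a‖ + ‖a‖ ^ 2 := by positivity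
        nlinarith
      push_cast
      rw [show ‖z‖ + (n + 1) - 1 = ‖z‖ + n by ring]
      linarith

lemma tendsto_gammaQuot_add_nat {a z : ℂ} (hz : 0 ≤ z.re) (ha : ‖a‖ < ‖z‖) :
    Tendsto (fun n : ℕ => gammaQuot a (z + n)) atTop (𝓝 1) := by
  have h0 : z ≠ 0 := norm_pos_iff.1 ((norm_nonneg a).trans_lt ha)
  have hzn : ∀ k : ℕ, z ≠ -k := fun k => by
    simpa using add_ne_neg_nat (a := 0) hz (by simpa using h0) k
  have hzan := add_ne_neg_nat hz ha
  have hΓ := Complex.Gamma_ne_zero hzn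
  have hΓa := Complex.Gamma_ne_zero hzan
  have hw : Tendsto (fun n : ℕ => (1 + (z + 1) / n) ^ a) atTop (𝓝 1) := by
    have h1 : Tendsto (fun n : ℕ => 1 + (z + 1) / n) atTop (𝓝 1) := by
      simpa using (tendsto_const_div_atTop_nhds_zero_nat (z + 1)).const_add 1
    simpa using h1.cpow tendsto_const_nhds (by simp)
  have hlim := ((Complex.GammaSeq_tendsto_Gamma z).div (Complex.GammaSeq_tendsto_Gamma (z + a))
    hΓa).mul_const (Complex.Gamma (z + a) / Complex.Gamma z)
  have hlim2 := hlim.div hw one_ne_zero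
  rw [show Complex.Gamma z / Complex.Gamma (z + a) * (Complex.Gamma (z + a) / Complex.Gamma z) / 1
    = 1 by field_simp] at hlim2
  rw [← tendsto_add_atTop_iff_nat 1]
  refine hlim2.congr' ?_
  filter_upwards [eventually_gt_atTop 0] with n hn
  have hnR : (0 : ℝ) < n := by exact_mod_cast hn
  have hnC : (n : ℂ) ≠ 0 := by exact_mod_cast hn.ne'
  have p1 := ascPochhammer_eval_ne_zero hzn (n + 1)
  have p2 := ascPochhammer_eval_ne_zero hzan (n + 1)
  have g1 := Complex.Gamma_add_nat_div_Gamma_eq (n := n + 1) z hzn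
  have g2 := Complex.Gamma_add_nat_div_Gamma_eq (n := n + 1) (z + a) hzan
  rw [div_eq_iff hΓ] at g1
  rw [div_eq_iff hΓa] at g2
  have hzn1 : z + ((n + 1 : ℕ) : ℂ) = ((n : ℝ) : ℂ) * (1 + (z + 1) / n) := by
    push_cast
    field_simp
    ring
  have hne : z + ((n + 1 : ℕ) : ℂ) ≠ 0 := fun h => hzn (n + 1) (by linear_combination h)
  have hne' : 1 + (z + 1) / n ≠ 0 := fun h => hne (by rw [hzn1, h, mul_zero])
  have hpow : (z + ((n + 1 : ℕ) : ℂ)) ^ a = (n : ℂ) ^ a * (1 + (z + 1) / n) ^ a := by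
    rw [hzn1, Complex.cpow_def_of_ne_zero (by rw [← hzn1]; exact hne),
      Complex.cpow_def_of_ne_zero hnC, Complex.cpow_def_of_ne_zero hne',
      Complex.log_ofReal_mul hnR hne', ← Complex.exp_add, Complex.ofReal_log hnR.le]
    push_cast
    congr 1
    ring
  have hnp : (n : ℂ) ^ a ≠ 0 := by simp [Complex.cpow_eq_zero_iff, hnC]
  have hnz : (n : ℂ) ^ z ≠ 0 := by simp [Complex.cpow_eq_zero_iff, hnC]
  have hwp : (1 + (z + 1) / n) ^ a ≠ 0 := by simp [Complex.cpow_eq_zero_iff, hne']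
  have hfac : (n.factorial : ℂ) ≠ 0 := by exact_mod_cast n.factorial_ne_zero
  rw [gammaQuot, show z + ((n + 1 : ℕ) : ℂ) + a = z + a + ((n + 1 : ℕ) : ℂ) by ring, g1, g2, hpow]
  simp only [Pi.div_apply]
  rw [Complex.GammaSeq, Complex.GammaSeq, ← ascPochhammer_eval_eq_prod,
    ← ascPochhammer_eval_eq_prod, Complex.cpow_add _ _ hnC]
  generalize (1 + (z + 1) / n) ^ a = w at *
  field_simp

lemma norm_gammaQuot_sub_one_le {a z : ℂ} (hz : 0 ≤ z.re) (hz1 : 2 ≤ ‖z‖) (hza : 2 * ‖a‖ ≤ ‖z‖)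
    (ha : ‖a‖ < ‖z‖) (hη : 2 * (‖a‖ + ‖a‖ ^ 2) * (1 / (‖z‖ - 1)) ≤ 1) :
    ‖gammaQuot a z - 1‖ ≤ 2 * (2 * (‖a‖ + ‖a‖ ^ 2) * (1 / (‖z‖ - 1))) := by
  set η := 2 * (‖a‖ + ‖a‖ ^ 2) * (1 / (‖z‖ - 1)) with hηdef
  have hlim := tendsto_gammaQuot_add_nat hz ha
  have hL : Tendsto (fun n : ℕ => ‖gammaQuot a z - gammaQuot a (z + n)‖) atTop
      (𝓝 ‖gammaQuot a z - 1‖) := (hlim.const_sub _).norm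
  have hR : Tendsto (fun n : ℕ => 2 * η * ‖gammaQuot a (z + n)‖) atTop (𝓝 (2 * η)) := by
    simpa using hlim.norm.const_mul (2 * η)
  refine le_of_tendsto_of_tendsto' hL hR fun n => ?_
  obtain ⟨S, hS, hSn⟩ := exists_gammaQuot_eq hz hz1 hza ha n
  have hn : (0 : ℝ) ≤ n := n.cast_nonneg
  have hSη : ‖S‖ ≤ η := by
    refine hSn.trans ?_
    rw [hηdef]
    have : 0 ≤ 1 / (‖z‖ + n - 1) := one_div_nonneg.2 (by linarith)
    gcongr
    linarith
  have hexp : ‖Complex.exp S - 1‖ ≤ 2 * ‖S‖ := Complex.norm_exp_sub_one_le (hSη.trans hη)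
  rw [hS, show Complex.exp S * gammaQuot a (z + n) - gammaQuot a (z + n) =
    (Complex.exp S - 1) * gammaQuot a (z + n) by ring, norm_mul]
  gcongr
  linarith

lemma tendsto_gammaQuot {ι : Type*} {l : Filter ι} {X : ι → ℂ}
    (hX : Tendsto (fun i => ‖X i‖) l atTop) (hre : ∀ i, 0 ≤ (X i).re) (a : ℂ) :
    Tendsto (fun i => gammaQuot a (X i)) l (𝓝 1) := by
  have hη : Tendsto (fun i => 2 * (‖a‖ + ‖a‖ ^ 2) * (1 / (‖X i‖ - 1))) l (𝓝 0) := by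
    have h1 : Tendsto (fun i => ‖X i‖ - 1) l atTop := by
      simpa [sub_eq_add_neg] using tendsto_atTop_add_const_right l (-1 : ℝ) hX
    have h2 := h1.inv_tendsto_atTop.const_mul (2 * (‖a‖ + ‖a‖ ^ 2))
    simp only [mul_zero] at h2
    refine h2.congr fun i => ?_
    simp
  rw [tendsto_iff_norm_sub_tendsto_zero]
  have h2η := hη.const_mul 2
  rw [mul_zero] at h2η
  refine squeeze_zero' (Eventually.of_forall fun _ => norm_nonneg _) ?_ h2η
  filter_upwards [hX.eventually_ge_atTop 2, hX.eventually_ge_atTop (2 * ‖a‖),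
    hX.eventually_gt_atTop ‖a‖, hη.eventually_le_const one_pos] with i h1 h2 h3 h4
  exact norm_gammaQuot_sub_one_le (hre i) h1 h2 h3 h4

/-- `Γ(X + p) / Γ(X + q) ∼ X^(p - q)` as `X → ∞` in the closed right half plane. -/
theorem tendsto_Gamma_div_Gamma {ι : Type*} {l : Filter ι} {X : ι → ℂ}
    (hX : Tendsto (fun i => ‖X i‖) l atTop) (hre : ∀ i, 0 ≤ (X i).re) (p q : ℂ) :
    Tendsto (fun i => Complex.Gamma (X i + p) / Complex.Gamma (X i + q) * X i ^ (q - p)) l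
      (𝓝 1) := by
  have h := (tendsto_gammaQuot hX hre p).div (tendsto_gammaQuot hX hre q) one_ne_zero
  rw [div_one] at h
  refine h.congr' ?_
  filter_upwards [hX.eventually_gt_atTop 0] with i hi
  have h0 : X i ≠ 0 := norm_pos_iff.1 hi
  have hΓ : Complex.Gamma (X i) ≠ 0 := Complex.Gamma_ne_zero fun k => by
    simpa using add_ne_neg_nat (a := 0) (hre i) (by simpa using h0) k
  have hp : X i ^ p ≠ 0 := by simp [Complex.cpow_eq_zero_iff, h0]
  have hq : X i ^ q ≠ 0 := by simp [Complex.cpow_eq_zero_iff, h0]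
  simp only [Pi.div_apply, gammaQuot]
  rw [Complex.cpow_sub _ _ h0]
  field_simp

/-! ### The basis at the origin and the connection matrices -/

lemma ne_zero_of_im_pos {z : ℂ} (hz : 0 < z.im) : z ≠ 0 := fun h => by simp [h] at hz

lemma one_sub_ne_zero_of_im_pos {z : ℂ} (hz : 0 < z.im) : 1 - z ≠ 0 := fun h => by
  have := congrArg Complex.im h
  simp at this
  exact hz.ne' this

lemma mem_cutPlane_of_im_pos {z : ℂ} (hz : 0 < z.im) : z ∈ cutPlane := by
  change 1 - z ∈ Complex.slitPlane
  rw [Complex.mem_slitPlane_iff]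
  right
  simpa using hz.ne'

lemma log_im_mem_of_im_pos {z : ℂ} (hz : 0 < z.im) :
    0 < (Complex.log z).im ∧ (Complex.log z).im < Real.pi := by
  rw [Complex.log_im]
  refine ⟨lt_of_le_of_ne (Complex.arg_nonneg_iff.2 hz.le) fun h => ?_, ?_⟩
  · exact hz.ne' (Complex.arg_eq_zero_iff.1 h.symm).2
  · exact Complex.arg_lt_pi_iff.2 (Or.inr hz.ne')

lemma log_im_mem_of_im_neg {z : ℂ} (hz : z.im < 0) :
    -Real.pi < (Complex.log z).im ∧ (Complex.log z).im < 0 := by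
  rw [Complex.log_im]
  exact ⟨Complex.neg_pi_lt_arg z, Complex.arg_neg_iff.2 hz⟩

lemma one_sub_inv_im_pos {z : ℂ} (hz : 0 < z.im) : 0 < (1 - 1 / z).im := by
  have h0 := Complex.normSq_pos.2 (ne_zero_of_im_pos hz)
  rw [one_div, Complex.sub_im, Complex.inv_im, Complex.one_im]
  have := div_pos hz h0
  rw [neg_div]
  linarith

/-- The three logarithms in the upper half plane. -/
lemma log_one_sub_inv {z : ℂ} (hz : 0 < z.im) :
    Complex.log (1 - 1 / z) = -Complex.log z + Real.pi * Complex.I + Complex.log (1 - z) := by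
  have h0 := ne_zero_of_im_pos hz
  have h1 := one_sub_ne_zero_of_im_pos hz
  have hv := one_sub_inv_im_pos hz
  have l1 := log_im_mem_of_im_pos hz
  have l2 := log_im_mem_of_im_pos hv
  have l3 := log_im_mem_of_im_neg (z := 1 - z) (by simpa using hz)
  have he : Complex.exp (Complex.log (1 - 1 / z)) =
      Complex.exp (-Complex.log z + Real.pi * Complex.I + Complex.log (1 - z)) := by
    rw [Complex.exp_add, Complex.exp_add, Complex.exp_neg, Complex.exp_log h0,
      Complex.exp_log h1, Complex.exp_log (ne_zero_of_im_pos hv), Complex.exp_pi_mul_I]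
    field_simp
    ring
  obtain ⟨n, hn⟩ := Complex.exp_eq_exp_iff_exists_int.1 he
  have him := congrArg Complex.im hn
  have e2 : ((n : ℂ) * (2 * Real.pi * Complex.I)).im = n * (2 * Real.pi) := by
    simp
  rw [Complex.add_im, e2] at him
  simp only [Complex.add_im, Complex.neg_im, Complex.mul_im, Complex.ofReal_re, Complex.I_im,
    Complex.ofReal_im, Complex.I_re, mul_one, mul_zero, add_zero] at him
  have hπ := Real.pi_pos
  have n1 : -1 < (n : ℝ) := by nlinarith
  have n2 : (n : ℝ) < 1 := by nlinarith
  have n3 : n = 0 := by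
    have a1 : -1 < n := by exact_mod_cast n1
    have a2 : n < 1 := by exact_mod_cast n2
    omega
  rw [hn, n3]
  simp

lemma log_inv_of_im_pos {z : ℂ} (hz : 0 < z.im) : Complex.log (1 / z) = -Complex.log z := by
  rw [one_div, Complex.log_inv]
  rw [← Complex.log_im]
  exact (log_im_mem_of_im_pos hz).2.ne

/-- The expansion at the origin of `₂F₁` in the variable `1 / z`. -/
lemma gaussF_inv {a b c z : ℂ} (hab : ∀ m : ℤ, a - b ≠ m) (hc : ∀ k : ℕ, c ≠ -k)
    (hz : 0 < z.im) :
    gaussF a b c (1 / z) =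
      connCoeff a b c * (Complex.exp (a * (Complex.log z - Real.pi * Complex.I)) *
        gaussF a (a - c + 1) (a - b + 1) z) +
      connCoeff b a c * (Complex.exp (b * (Complex.log z - Real.pi * Complex.I)) *
        gaussF b (b - c + 1) (b - a + 1) z) := by
  have h0 := ne_zero_of_im_pos hz
  have l1 := log_im_mem_of_im_pos hz
  have hs : -(Complex.log z - Real.pi * Complex.I) ∈ logStrip := by
    change |(-(Complex.log z - Real.pi * Complex.I)).im| < Real.pi
    rw [abs_lt]
    simp only [Complex.sub_im, Complex.neg_im, Complex.mul_im, Complex.ofReal_re, Complex.I_im,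
      Complex.ofReal_im, Complex.I_re, mul_one, mul_zero, add_zero]
    constructor <;> linarith
  have e1 : -Complex.exp (-(Complex.log z - Real.pi * Complex.I)) = 1 / z := by
    rw [neg_sub, Complex.exp_sub, Complex.exp_pi_mul_I, Complex.exp_log h0]
    ring
  have e2 : -Complex.exp (Complex.log z - Real.pi * Complex.I) = z := by
    rw [Complex.exp_sub, Complex.exp_pi_mul_I, Complex.exp_log h0]
    ring
  have h := expF_eq_connCoeff hab hc hs
  simp only [expF, expG, neg_neg, mul_neg] at h
  rw [e1, e2] at h
  rw [h]

/-- The expansion at the origin of `₂F₁` in the variable `1 - 1 / z`. -/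
lemma gaussF_one_sub_inv {a b c z : ℂ} (hab : ∀ m : ℤ, a - b ≠ m) (hc : ∀ k : ℕ, c ≠ -k)
    (hz : 0 < z.im) :
    gaussF a b c (1 - 1 / z) =
      connCoeff a b c * (Complex.exp (a * Complex.log z) * gaussF a (c - b) (a - b + 1) z) +
      connCoeff b a c * (Complex.exp (b * Complex.log z) * gaussF b (c - a) (b - a + 1) z) := by
  have h0 := ne_zero_of_im_pos hz
  have h1 := one_sub_ne_zero_of_im_pos hz
  have hba := sub_ne_intCast_symm hab
  have h1' : z - 1 ≠ 0 := fun h => h1 (by linear_combination -h)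
  have hv := one_sub_inv_im_pos hz
  have l2 := log_im_mem_of_im_pos hv
  have hcut := mem_cutPlane_of_im_pos hz
  have hs : -(Complex.log z - Complex.log (1 - z)) ∈ logStrip := by
    have e : -(Complex.log z - Complex.log (1 - z)) =
        Complex.log (1 - 1 / z) - Real.pi * Complex.I := by
      rw [log_one_sub_inv hz]; ring
    rw [e]
    change |(Complex.log (1 - 1 / z) - Real.pi * Complex.I).im| < Real.pi
    rw [abs_lt]
    simp only [Complex.sub_im, Complex.mul_im, Complex.ofReal_re, Complex.I_im,
      Complex.ofReal_im, Complex.I_re, mul_one, mul_zero, add_zero] at l2 ⊢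
    constructor <;> linarith
  have e1 : -Complex.exp (-(Complex.log z - Complex.log (1 - z))) = 1 - 1 / z := by
    rw [neg_sub, Complex.exp_sub, Complex.exp_log h0, Complex.exp_log h1]
    field_simp
    ring
  have e2 : -Complex.exp (Complex.log z - Complex.log (1 - z)) = z / (z - 1) := by
    rw [Complex.exp_sub, Complex.exp_log h0, Complex.exp_log h1]
    field_simp
    ring
  have h := expF_eq_connCoeff hab hc hs
  simp only [expF, expG, neg_neg, mul_neg] at h
  rw [e1, e2] at h
  have key : ∀ a b : ℂ, (∀ m : ℤ, a - b ≠ m) →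
      Complex.exp (a * (Complex.log z - Complex.log (1 - z))) *
        gaussF a (a - c + 1) (a - b + 1) (z / (z - 1)) =
      Complex.exp (a * Complex.log z) * gaussF a (c - b) (a - b + 1) z := by
    intro a b hab
    rw [gaussF_pfaff a (c - b) (sub_add_one_ne_neg_nat hab) hcut,
      show a - b + 1 - (c - b) = a - c + 1 by ring, Complex.cpow_def_of_ne_zero h1,
      mul_sub, Complex.exp_sub, mul_neg, Complex.exp_neg, mul_comm (Complex.log (1 - z))]
    ring
  rw [h, key a b hab, key b a hba]

/-- Euler's transformation. -/
lemma gaussF_euler (a b : ℂ) {c : ℂ} (hc : ∀ k : ℕ, c ≠ -k) {z : ℂ} (hz : z ∈ cutPlane) :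
    gaussF a b c z = (1 - z) ^ (c - a - b) * gaussF (c - a) (c - b) c z := by
  have h1 : 1 - z ≠ 0 := Complex.slitPlane_ne_zero hz
  have hu := div_sub_one_mem_cutPlane hz
  rw [gaussF_pfaff a b hc hz, gaussF_symm (c - a) (c - b) hc hz, gaussF_pfaff (c - b) (c - a) hc hz,
    gaussF_symm a (c - b) hc hu, sub_sub_cancel, ← mul_assoc, ← Complex.cpow_add _ _ h1]
  congr 2
  ring

/-- The solutions of the hypergeometric BPZ equation with exponents `bQ/2 ∓ ibθ₀` at `z = 0`, for
`τ = ±1`. -/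
noncomputable def F0comp (b θ₀ θ₁ θi τ z : ℂ) : ℂ :=
  Complex.exp (((b ^ 2 + 1) / 2 - τ * (Complex.I * b) * θ₀) * Complex.log z) *
    (1 - z) ^ ((b ^ 2 + 1) / 2 + Complex.I * b * θ₁) *
    gaussF (1 / 2 + Complex.I * b * (-τ * θ₀ + θ₁ + θi))
      (1 / 2 + Complex.I * b * (-τ * θ₀ + θ₁ - θi)) (1 - τ * (2 * Complex.I * b * θ₀)) z

/-- The coefficients of `F^1_σ` in the basis at `z = 0`. -/
noncomputable def coeff1 (b θ₀ θ₁ θi σ τ : ℂ) : ℂ :=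
  Complex.exp (Real.pi * Complex.I * ((b ^ 2 + 1) / 2 + σ * (Complex.I * b) * θ₁)) *
    (Complex.Gamma (1 + σ * (2 * Complex.I * b * θ₁)) *
      Complex.Gamma (τ * (2 * Complex.I * b * θ₀)) /
      (Complex.Gamma (1 / 2 + Complex.I * b * (τ * θ₀ + σ * θ₁ + θi)) *
        Complex.Gamma (1 / 2 + Complex.I * b * (τ * θ₀ + σ * θ₁ - θi))))

/-- The coefficients of `F^∞_σ` in the basis at `z = 0`. -/
noncomputable def coeffInf (b θ₀ θ₁ θi σ τ : ℂ) : ℂ :=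
  Complex.exp (Real.pi * Complex.I *
      (b ^ 2 / 2 + τ * (Complex.I * b) * θ₀ + σ * (Complex.I * b) * θi)) *
    (Complex.Gamma (1 - σ * (2 * Complex.I * b * θi)) *
      Complex.Gamma (τ * (2 * Complex.I * b * θ₀)) /
      (Complex.Gamma (1 / 2 + Complex.I * b * (τ * θ₀ + θ₁ - σ * θi)) *
        Complex.Gamma (1 / 2 + Complex.I * b * (τ * θ₀ - θ₁ - σ * θi))))

/-- The connection matrix from `z = 0` to `z = 1`. -/
noncomputable def conn10 (b θ₀ θ₁ θi : ℂ) : Matrix (Fin 2) (Fin 2) ℂ :=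
  !![coeff1 b θ₀ θ₁ θi 1 1, coeff1 b θ₀ θ₁ θi 1 (-1);
    coeff1 b θ₀ θ₁ θi (-1) 1, coeff1 b θ₀ θ₁ θi (-1) (-1)]

/-- The connection matrix from `z = 0` to `z = ∞`. -/
noncomputable def connInf0 (b θ₀ θ₁ θi : ℂ) : Matrix (Fin 2) (Fin 2) ℂ :=
  !![coeffInf b θ₀ θ₁ θi 1 1, coeffInf b θ₀ θ₁ θi 1 (-1);
    coeffInf b θ₀ θ₁ θi (-1) 1, coeffInf b θ₀ θ₁ θi (-1) (-1)]

/-- The basis at `z = 0`. -/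
noncomputable def F0 (b θ₀ θ₁ θi z : ℂ) : Fin 2 → ℂ :=
  ![F0comp b θ₀ θ₁ θi 1 z, F0comp b θ₀ θ₁ θi (-1) z]

lemma b_mul_Q {b : ℂ} (hb : b ≠ 0) : b * Q b = b ^ 2 + 1 := by
  rw [Q]; field_simp

section ConnectionMatrices

variable {b θ₀ θ₁ θi : ℂ}

lemma param_sub_ne_intCast (hθ₀ : ∀ m : ℤ, 2 * Complex.I * b * θ₀ ≠ m) {x y : ℂ}
    (h : y - x = 2 * Complex.I * b * θ₀) (m : ℤ) : x - y ≠ m := by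
  intro hm
  exact hθ₀ (-m) (by push_cast; linear_combination -h - hm)

lemma one_sub_ne_neg_nat {x : ℂ} (hx : ∀ m : ℤ, x ≠ m) (k : ℕ) : 1 - x ≠ -k := by
  intro h
  exact hx (k + 1) (by push_cast; linear_combination -h)

lemma one_add_ne_neg_nat {x : ℂ} (hx : ∀ m : ℤ, x ≠ m) (k : ℕ) : 1 + x ≠ -k := by
  intro h
  exact hx (-k - 1) (by push_cast; linear_combination h)

lemma FInfcomp_eq (hb : b ≠ 0) (hθ₀ : ∀ m : ℤ, 2 * Complex.I * b * θ₀ ≠ m) {σ : ℂ}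
    (hσ : σ = 1 ∨ σ = -1) (hC : ∀ k : ℕ, 1 - σ * (2 * Complex.I * b * θi) ≠ -k) {z : ℂ}
    (hz : 0 < z.im) :
    FInfcomp b θ₀ θ₁ θi σ z = coeffInf b θ₀ θ₁ θi σ 1 * F0comp b θ₀ θ₁ θi 1 z +
      coeffInf b θ₀ θ₁ θi σ (-1) * F0comp b θ₀ θ₁ θi (-1) z := by
  have h0 := ne_zero_of_im_pos hz
  have hz1 : (1 : ℂ) / z ≠ 0 := one_div_ne_zero h0
  have hv := ne_zero_of_im_pos (one_sub_inv_im_pos hz)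
  have hcut := mem_cutPlane_of_im_pos hz
  have h1z := one_sub_ne_zero_of_im_pos hz
  have hC' : ∀ k : ℕ, 1 - σ * 2 * Complex.I * b * θi ≠ -k := by
    simpa only [mul_assoc] using hC
  have hs : gaussF (1 / 2 + Complex.I * b * (1 * θ₀ + θ₁ - σ * θi))
      (1 / 2 + Complex.I * b * (1 * θ₀ + θ₁ + σ * θi)) (1 - -1 * (2 * Complex.I * b * θ₀)) z =
      gaussF (1 / 2 + Complex.I * b * (1 * θ₀ + θ₁ + θi))
      (1 / 2 + Complex.I * b * (1 * θ₀ + θ₁ - θi)) (1 - -1 * (2 * Complex.I * b * θ₀)) z := by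
    have hc1 : ∀ k : ℕ, 1 - -1 * (2 * Complex.I * b * θ₀) ≠ -k := by
      simpa using one_add_ne_neg_nat hθ₀
    rcases hσ with rfl | rfl
    · rw [gaussF_symm _ _ hc1 hcut]; simp
    · simp [sub_eq_add_neg]
  have hs' : gaussF (1 / 2 + Complex.I * b * (-1 * θ₀ + θ₁ - σ * θi))
      (1 / 2 + Complex.I * b * (-1 * θ₀ + θ₁ + σ * θi)) (1 - 1 * (2 * Complex.I * b * θ₀)) z =
      gaussF (1 / 2 + Complex.I * b * (-1 * θ₀ + θ₁ + θi))
      (1 / 2 + Complex.I * b * (-1 * θ₀ + θ₁ - θi)) (1 - 1 * (2 * Complex.I * b * θ₀)) z := by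
    have hc1 : ∀ k : ℕ, 1 - 1 * (2 * Complex.I * b * θ₀) ≠ -k := by
      simpa using one_sub_ne_neg_nat hθ₀
    rcases hσ with rfl | rfl
    · rw [gaussF_symm _ _ hc1 hcut]; simp
    · simp [sub_eq_add_neg]
  have hab := param_sub_ne_intCast hθ₀
    (x := 1 / 2 - Complex.I * b * (θ₀ - θ₁ + σ * θi))
    (y := 1 / 2 + Complex.I * b * (θ₀ + θ₁ - σ * θi)) (by ring)
  rw [FInfcomp, gaussF_inv (sub_ne_intCast_symm hab) hC' hz, Complex.cpow_def_of_ne_zero hz1,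
    Complex.cpow_def_of_ne_zero hv, log_one_sub_inv hz, log_inv_of_im_pos hz, b_mul_Q hb]
  have p1 : (1 / 2 + Complex.I * b * (θ₀ + θ₁ - σ * θi)) =
      1 / 2 + Complex.I * b * (1 * θ₀ + θ₁ - σ * θi) := by ring
  have p2 : (1 / 2 - Complex.I * b * (θ₀ - θ₁ + σ * θi)) =
      1 / 2 + Complex.I * b * (-1 * θ₀ + θ₁ - σ * θi) := by ring
  rw [p1, p2]
  rw [show 1 / 2 + Complex.I * b * (1 * θ₀ + θ₁ - σ * θi) - (1 - σ * 2 * Complex.I * b * θi) + 1 =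
      1 / 2 + Complex.I * b * (1 * θ₀ + θ₁ + σ * θi) by ring,
    show 1 / 2 + Complex.I * b * (1 * θ₀ + θ₁ - σ * θi) -
      (1 / 2 + Complex.I * b * (-1 * θ₀ + θ₁ - σ * θi)) + 1 =
      1 - -1 * (2 * Complex.I * b * θ₀) by ring,
    show 1 / 2 + Complex.I * b * (-1 * θ₀ + θ₁ - σ * θi) - (1 - σ * 2 * Complex.I * b * θi) + 1 =
      1 / 2 + Complex.I * b * (-1 * θ₀ + θ₁ + σ * θi) by ring,
    show 1 / 2 + Complex.I * b * (-1 * θ₀ + θ₁ - σ * θi) -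
      (1 / 2 + Complex.I * b * (1 * θ₀ + θ₁ - σ * θi)) + 1 =
      1 - 1 * (2 * Complex.I * b * θ₀) by ring, hs, hs']
  rw [connCoeff, connCoeff, coeffInf, coeffInf, F0comp, F0comp, Complex.cpow_def_of_ne_zero h1z]
  rw [show 1 / 2 + Complex.I * b * (-1 * θ₀ + θ₁ - σ * θi) -
      (1 / 2 + Complex.I * b * (1 * θ₀ + θ₁ - σ * θi)) = -1 * (2 * Complex.I * b * θ₀) by ring,
    show 1 / 2 + Complex.I * b * (1 * θ₀ + θ₁ - σ * θi) -
      (1 / 2 + Complex.I * b * (-1 * θ₀ + θ₁ - σ * θi)) = 1 * (2 * Complex.I * b * θ₀) by ring,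
    show 1 - σ * 2 * Complex.I * b * θi - (1 / 2 + Complex.I * b * (1 * θ₀ + θ₁ - σ * θi)) =
      1 / 2 + Complex.I * b * (-1 * θ₀ - θ₁ - σ * θi) by ring,
    show 1 - σ * 2 * Complex.I * b * θi - (1 / 2 + Complex.I * b * (-1 * θ₀ + θ₁ - σ * θi)) =
      1 / 2 + Complex.I * b * (1 * θ₀ - θ₁ - σ * θi) by ring,
    show σ * 2 * Complex.I * b * θi = σ * (2 * Complex.I * b * θi) by ring, neg_neg]
  generalize Complex.log z = ℓ
  generalize Complex.log (1 - z) = m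
  generalize gaussF (1 / 2 + Complex.I * b * (1 * θ₀ + θ₁ + θi)) _ _ _ = G1
  generalize gaussF (1 / 2 + Complex.I * b * (-1 * θ₀ + θ₁ + θi)) _ _ _ = G2
  have x1 : Complex.exp (-ℓ * (-(1 / 2) - b ^ 2 - σ * Complex.I * b * θi)) *
      Complex.exp ((-ℓ + Real.pi * Complex.I + m) * ((b ^ 2 + 1) / 2 + Complex.I * b * θ₁)) *
      Complex.exp ((1 / 2 + Complex.I * b * (1 * θ₀ + θ₁ - σ * θi)) *
        (ℓ - Real.pi * Complex.I)) =
      Complex.exp (Real.pi * Complex.I * (b ^ 2 / 2 + -1 * (Complex.I * b) * θ₀ +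
        σ * (Complex.I * b) * θi)) *
      Complex.exp (((b ^ 2 + 1) / 2 - -1 * (Complex.I * b) * θ₀) * ℓ) *
      Complex.exp (m * ((b ^ 2 + 1) / 2 + Complex.I * b * θ₁)) := by
    rw [← Complex.exp_add, ← Complex.exp_add, ← Complex.exp_add, ← Complex.exp_add]
    congr 1
    ring
  have x2 : Complex.exp (-ℓ * (-(1 / 2) - b ^ 2 - σ * Complex.I * b * θi)) *
      Complex.exp ((-ℓ + Real.pi * Complex.I + m) * ((b ^ 2 + 1) / 2 + Complex.I * b * θ₁)) *
      Complex.exp ((1 / 2 + Complex.I * b * (-1 * θ₀ + θ₁ - σ * θi)) *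
        (ℓ - Real.pi * Complex.I)) =
      Complex.exp (Real.pi * Complex.I * (b ^ 2 / 2 + 1 * (Complex.I * b) * θ₀ +
        σ * (Complex.I * b) * θi)) *
      Complex.exp (((b ^ 2 + 1) / 2 - 1 * (Complex.I * b) * θ₀) * ℓ) *
      Complex.exp (m * ((b ^ 2 + 1) / 2 + Complex.I * b * θ₁)) := by
    rw [← Complex.exp_add, ← Complex.exp_add, ← Complex.exp_add, ← Complex.exp_add]
    congr 1
    ring
  generalize Complex.Gamma (1 - σ * (2 * Complex.I * b * θi)) = g₀
  generalize Complex.Gamma (1 * (2 * Complex.I * b * θ₀)) = g₁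
  generalize Complex.Gamma (-1 * (2 * Complex.I * b * θ₀)) = g₂
  generalize Complex.Gamma (1 / 2 + Complex.I * b * (1 * θ₀ + θ₁ - σ * θi)) = g₃
  generalize Complex.Gamma (1 / 2 + Complex.I * b * (-1 * θ₀ + θ₁ - σ * θi)) = g₄
  generalize Complex.Gamma (1 / 2 + Complex.I * b * (1 * θ₀ - θ₁ - σ * θi)) = g₅
  generalize Complex.Gamma (1 / 2 + Complex.I * b * (-1 * θ₀ - θ₁ - σ * θi)) = g₆
  linear_combination g₀ * g₂ / (g₄ * g₆) * G1 * x1 + g₀ * g₁ / (g₃ * g₅) * G2 * x2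

lemma F1comp_eq (hb : b ≠ 0) (hθ₀ : ∀ m : ℤ, 2 * Complex.I * b * θ₀ ≠ m) {σ : ℂ}
    (hσ : σ = 1 ∨ σ = -1) (hC : ∀ k : ℕ, 1 + σ * (2 * Complex.I * b * θ₁) ≠ -k) {z : ℂ}
    (hz : 0 < z.im) :
    F1comp b θ₀ θ₁ θi σ z = coeff1 b θ₀ θ₁ θi σ 1 * F0comp b θ₀ θ₁ θi 1 z +
      coeff1 b θ₀ θ₁ θi σ (-1) * F0comp b θ₀ θ₁ θi (-1) z := by
  have h0 := ne_zero_of_im_pos hz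
  have hv := ne_zero_of_im_pos (one_sub_inv_im_pos hz)
  have hcut := mem_cutPlane_of_im_pos hz
  have h1z := one_sub_ne_zero_of_im_pos hz
  have hC' : ∀ k : ℕ, 1 + σ * 2 * Complex.I * b * θ₁ ≠ -k := by
    simpa only [mul_assoc] using hC
  -- For `σ = -1` Euler's transformation is needed.
  have hs : ∀ τ : ℂ, (∀ k : ℕ, 1 - τ * (2 * Complex.I * b * θ₀) ≠ -k) →
      (1 - z) ^ ((b ^ 2 + 1) / 2 + σ * Complex.I * b * θ₁) *
        gaussF (1 / 2 + Complex.I * b * (-τ * θ₀ + σ * θ₁ + θi))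
          (1 / 2 + Complex.I * b * (-τ * θ₀ + σ * θ₁ - θi))
          (1 - τ * (2 * Complex.I * b * θ₀)) z =
      (1 - z) ^ ((b ^ 2 + 1) / 2 + Complex.I * b * θ₁) *
        gaussF (1 / 2 + Complex.I * b * (-τ * θ₀ + θ₁ + θi))
          (1 / 2 + Complex.I * b * (-τ * θ₀ + θ₁ - θi))
          (1 - τ * (2 * Complex.I * b * θ₀)) z := by
    intro τ hc
    rcases hσ with rfl | rfl
    · simp
    · rw [gaussF_euler _ _ hc hcut, gaussF_symm _ _ hc hcut, ← mul_assoc,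
        ← Complex.cpow_add _ _ h1z]
      congr 2 <;> ring
  have hab := param_sub_ne_intCast hθ₀
    (x := 1 / 2 - Complex.I * b * (θ₀ - σ * θ₁ - θi))
    (y := 1 / 2 + Complex.I * b * (θ₀ + σ * θ₁ + θi)) (by ring)
  rw [F1comp, gaussF_one_sub_inv hab hC' hz, Complex.cpow_def_of_ne_zero h0,
    Complex.cpow_def_of_ne_zero hv, log_one_sub_inv hz, b_mul_Q hb]
  rw [show (1 / 2 + Complex.I * b * (θ₀ + σ * θ₁ + θi)) =
      1 / 2 + Complex.I * b * (1 * θ₀ + σ * θ₁ + θi) by ring,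
    show (1 / 2 - Complex.I * b * (θ₀ - σ * θ₁ - θi)) =
      1 / 2 + Complex.I * b * (-1 * θ₀ + σ * θ₁ + θi) by ring]
  rw [show 1 / 2 + Complex.I * b * (-1 * θ₀ + σ * θ₁ + θi) -
      (1 / 2 + Complex.I * b * (1 * θ₀ + σ * θ₁ + θi)) + 1 =
      1 - 1 * (2 * Complex.I * b * θ₀) by ring,
    show 1 / 2 + Complex.I * b * (1 * θ₀ + σ * θ₁ + θi) -
      (1 / 2 + Complex.I * b * (-1 * θ₀ + σ * θ₁ + θi)) + 1 =
      1 - -1 * (2 * Complex.I * b * θ₀) by ring,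
    show 1 + σ * 2 * Complex.I * b * θ₁ - (1 / 2 + Complex.I * b * (1 * θ₀ + σ * θ₁ + θi)) =
      1 / 2 + Complex.I * b * (-1 * θ₀ + σ * θ₁ - θi) by ring,
    show 1 + σ * 2 * Complex.I * b * θ₁ - (1 / 2 + Complex.I * b * (-1 * θ₀ + σ * θ₁ + θi)) =
      1 / 2 + Complex.I * b * (1 * θ₀ + σ * θ₁ - θi) by ring]
  have hs1 := hs 1 (by simpa using one_sub_ne_neg_nat hθ₀)
  have hs2 := hs (-1) (by simpa using one_add_ne_neg_nat hθ₀)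
  rw [neg_neg] at hs2
  rw [connCoeff, connCoeff, coeff1, coeff1, F0comp, F0comp, neg_neg,
    mul_assoc (Complex.exp (((b ^ 2 + 1) / 2 - 1 * (Complex.I * b) * θ₀) * Complex.log z)),
    mul_assoc (Complex.exp (((b ^ 2 + 1) / 2 - -1 * (Complex.I * b) * θ₀) * Complex.log z)),
    ← hs1, ← hs2, Complex.cpow_def_of_ne_zero h1z]
  rw [show 1 / 2 + Complex.I * b * (-1 * θ₀ + σ * θ₁ + θi) -
      (1 / 2 + Complex.I * b * (1 * θ₀ + σ * θ₁ + θi)) = -1 * (2 * Complex.I * b * θ₀) by ring,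
    show 1 / 2 + Complex.I * b * (1 * θ₀ + σ * θ₁ + θi) -
      (1 / 2 + Complex.I * b * (-1 * θ₀ + σ * θ₁ + θi)) = 1 * (2 * Complex.I * b * θ₀) by ring,
    show 1 + σ * 2 * Complex.I * b * θ₁ - (1 / 2 + Complex.I * b * (1 * θ₀ + σ * θ₁ + θi)) =
      1 / 2 + Complex.I * b * (-1 * θ₀ + σ * θ₁ - θi) by ring,
    show 1 + σ * 2 * Complex.I * b * θ₁ - (1 / 2 + Complex.I * b * (-1 * θ₀ + σ * θ₁ + θi)) =
      1 / 2 + Complex.I * b * (1 * θ₀ + σ * θ₁ - θi) by ring,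
    show σ * 2 * Complex.I * b * θ₁ = σ * (2 * Complex.I * b * θ₁) by ring]
  generalize Complex.log z = ℓ
  generalize Complex.log (1 - z) = m
  generalize gaussF (1 / 2 + Complex.I * b * (1 * θ₀ + σ * θ₁ + θi)) _ _ _ = G1
  generalize gaussF (1 / 2 + Complex.I * b * (-1 * θ₀ + σ * θ₁ + θi)) _ _ _ = G2
  have x : ∀ τ : ℂ, Complex.exp ((-ℓ + Real.pi * Complex.I + m) *
        ((b ^ 2 + 1) / 2 + σ * Complex.I * b * θ₁)) *
      Complex.exp (ℓ * (1 / 2 + b ^ 2 - Complex.I * b * θi)) *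
      Complex.exp ((1 / 2 + Complex.I * b * (τ * θ₀ + σ * θ₁ + θi)) * ℓ) =
      Complex.exp (Real.pi * Complex.I * ((b ^ 2 + 1) / 2 + σ * (Complex.I * b) * θ₁)) *
      (Complex.exp (((b ^ 2 + 1) / 2 - -τ * (Complex.I * b) * θ₀) * ℓ) *
      Complex.exp (m * ((b ^ 2 + 1) / 2 + σ * Complex.I * b * θ₁))) := by
    intro τ
    rw [← Complex.exp_add, ← Complex.exp_add, ← Complex.exp_add, ← Complex.exp_add]
    congr 1
    ring
  have x1 := x 1
  have x2 := x (-1)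
  rw [neg_neg] at x2
  generalize Complex.Gamma (1 + σ * (2 * Complex.I * b * θ₁)) = g₀
  generalize Complex.Gamma (1 * (2 * Complex.I * b * θ₀)) = g₁
  generalize Complex.Gamma (-1 * (2 * Complex.I * b * θ₀)) = g₂
  generalize Complex.Gamma (1 / 2 + Complex.I * b * (1 * θ₀ + σ * θ₁ + θi)) = g₃
  generalize Complex.Gamma (1 / 2 + Complex.I * b * (-1 * θ₀ + σ * θ₁ + θi)) = g₄
  generalize Complex.Gamma (1 / 2 + Complex.I * b * (1 * θ₀ + σ * θ₁ - θi)) = g₅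
  generalize Complex.Gamma (1 / 2 + Complex.I * b * (-1 * θ₀ + σ * θ₁ - θi)) = g₆
  linear_combination g₀ * g₂ / (g₄ * g₆) * G1 * x1 + g₀ * g₁ / (g₃ * g₅) * G2 * x2

end ConnectionMatrices

/-! ### The connection matrix `C_{∞1}` -/

lemma inv_Gamma_half_mul (s t : ℂ) (h : s + t = 1) :
    (Complex.Gamma s)⁻¹ * (Complex.Gamma t)⁻¹ = Complex.cos (Real.pi * (s - 1 / 2)) / Real.pi := by
  obtain rfl : t = 1 - s := by linear_combination h
  rw [← mul_inv, Complex.Gamma_mul_Gamma_one_sub, inv_div, mul_sub,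
    show (Real.pi : ℂ) * (1 / 2) = Real.pi / 2 by ring, Complex.cos_sub_pi_div_two]

/-- The trigonometric identity behind the composition of connection matrices. -/
lemma exp_mul_sin_two_mul (u v : ℂ) :
    Complex.exp (u * Complex.I) * Complex.sin (2 * v) =
      Complex.I * (Complex.cos (u - v) * Complex.exp (-v * Complex.I) -
        Complex.cos (u + v) * Complex.exp (v * Complex.I)) := by
  have e : ∀ x y : ℂ, Complex.exp (x * Complex.I) * Complex.exp (y * Complex.I) =
      Complex.exp ((x + y) * Complex.I) := fun x y => by rw [← Complex.exp_add, add_mul]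
  rw [Complex.sin, Complex.cos, Complex.cos]
  have h1 := e u (-(2 * v))
  have h2 := e u (2 * v)
  have h3 := e (u - v) (-v)
  have h4 := e (-(u - v)) (-v)
  have h5 := e (u + v) v
  have h6 := e (-(u + v)) v
  rw [show u - v + -v = u + -(2 * v) by ring] at h3
  rw [show -(u - v) + -v = -u by ring] at h4
  rw [show u + v + v = u + 2 * v by ring] at h5
  rw [show -(u + v) + v = -u by ring] at h6
  linear_combination Complex.I / 2 * h1 - Complex.I / 2 * h2 - Complex.I / 2 * h3 -
    Complex.I / 2 * h4 + Complex.I / 2 * h5 + Complex.I / 2 * h6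

lemma sin_pi_mul_ne_zero {x : ℂ} (hx : ∀ m : ℤ, x ≠ m) : Complex.sin (Real.pi * x) ≠ 0 := by
  rw [Ne, Complex.sin_eq_zero_iff]
  rintro ⟨k, hk⟩
  refine hx k (mul_left_cancel₀ (Complex.ofReal_ne_zero.2 Real.pi_ne_zero) ?_)
  rw [hk, mul_comm]

/-- Composition of the connection coefficients, from `0` to `1` to `∞`. -/
lemma gamma_connection {x y w : ℂ} (hy : ∀ m : ℤ, 2 * y ≠ m) :
    Complex.Gamma (-(2 * y)) * Complex.Gamma (1 + 2 * y) *
        Complex.exp (Real.pi * Complex.I * (1 / 2 + y)) *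
        ((Complex.Gamma (1 / 2 + x - y - w))⁻¹ * (Complex.Gamma (1 / 2 - x - y - w))⁻¹ *
        (Complex.Gamma (1 / 2 + x + y + w))⁻¹ * (Complex.Gamma (1 / 2 + x + y - w))⁻¹) +
      Complex.Gamma (2 * y) * Complex.Gamma (1 - 2 * y) *
        Complex.exp (Real.pi * Complex.I * (1 / 2 - y)) *
        ((Complex.Gamma (1 / 2 + x + y - w))⁻¹ * (Complex.Gamma (1 / 2 - x + y - w))⁻¹ *
        (Complex.Gamma (1 / 2 + x - y + w))⁻¹ * (Complex.Gamma (1 / 2 + x - y - w))⁻¹) =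
      Complex.exp (Real.pi * Complex.I * (x + w)) *
        ((Complex.Gamma (1 / 2 + x + y - w))⁻¹ * (Complex.Gamma (1 / 2 + x - y - w))⁻¹) := by
  have hπ : (Real.pi : ℂ) ≠ 0 := Complex.ofReal_ne_zero.2 Real.pi_ne_zero
  have hs := sin_pi_mul_ne_zero hy
  have r1 := Complex.Gamma_mul_Gamma_one_sub (-(2 * y))
  have r2 := Complex.Gamma_mul_Gamma_one_sub (2 * y)
  rw [sub_neg_eq_add, mul_neg, Complex.sin_neg] at r1
  have c1 := inv_Gamma_half_mul (1 / 2 + x + y + w) (1 / 2 - x - y - w) (by ring)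
  have c2 := inv_Gamma_half_mul (1 / 2 + x - y + w) (1 / 2 - x + y - w) (by ring)
  rw [show 1 / 2 + x + y + w - 1 / 2 = (x + w) + y by ring, mul_add] at c1
  rw [show 1 / 2 + x - y + w - 1 / 2 = (x + w) - y by ring, mul_sub] at c2
  have t := exp_mul_sin_two_mul (Real.pi * (x + w)) (Real.pi * y)
  have e1 : Complex.exp (Real.pi * Complex.I * (1 / 2 + y)) =
      Complex.I * Complex.exp (Real.pi * y * Complex.I) := by
    rw [show Real.pi * Complex.I * (1 / 2 + y) =
      Real.pi / 2 * Complex.I + Real.pi * y * Complex.I by ring, Complex.exp_add,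
      Complex.exp_pi_div_two_mul_I]
  have e2 : Complex.exp (Real.pi * Complex.I * (1 / 2 - y)) =
      Complex.I * Complex.exp (-(Real.pi * y) * Complex.I) := by
    rw [show Real.pi * Complex.I * (1 / 2 - y) =
      Real.pi / 2 * Complex.I + -(Real.pi * y) * Complex.I by ring, Complex.exp_add,
      Complex.exp_pi_div_two_mul_I]
  rw [r1, r2, e1, e2, show Real.pi * Complex.I * (x + w) = Real.pi * (x + w) * Complex.I by ring]
  rw [show 2 * (Real.pi * y) = Real.pi * (2 * y) by ring] at t
  generalize Complex.sin (Real.pi * (2 * y)) = S at *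
  generalize Complex.exp (Real.pi * (x + w) * Complex.I) = E at *
  have hE : E = (Complex.I * (Complex.cos (Real.pi * (x + w) - Real.pi * y) *
      Complex.exp (-(Real.pi * y) * Complex.I) -
        Complex.cos (Real.pi * (x + w) + Real.pi * y) *
          Complex.exp (Real.pi * y * Complex.I))) / S := by
    rw [eq_div_iff hs, t]
  rw [hE]
  generalize (Complex.Gamma (1 / 2 + x + y - w))⁻¹ = g1
  generalize (Complex.Gamma (1 / 2 + x - y - w))⁻¹ = g2
  generalize (Complex.Gamma (1 / 2 + x + y + w))⁻¹ = g3 at *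
  generalize (Complex.Gamma (1 / 2 - x - y - w))⁻¹ = g4 at *
  generalize (Complex.Gamma (1 / 2 + x - y + w))⁻¹ = g5 at *
  generalize (Complex.Gamma (1 / 2 - x + y - w))⁻¹ = g6 at *
  generalize Complex.cos (Real.pi * (x + w) - Real.pi * y) = k1 at *
  generalize Complex.cos (Real.pi * (x + w) + Real.pi * y) = k2 at *
  rw [show g2 * g4 * g3 * g1 = g1 * g2 * (g3 * g4) by ring,
    show g1 * g6 * g5 * g2 = g1 * g2 * (g5 * g6) by ring, c1, c2]
  field_simp
  ring

section ConnectionMatrices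

variable {b θ₀ θ₁ θi : ℂ}

/-- The entries of `C_{∞1}`, indexed by signs. -/
noncomputable def coeffInf1 (b θ₀ θ₁ θi σ ρ : ℂ) : ℂ :=
  Complex.Gamma (-(ρ * (2 * (Complex.I * b * θ₁)))) *
      Complex.Gamma (1 - σ * (2 * Complex.I * b * θi)) /
    (Complex.Gamma (1 / 2 + Complex.I * b * (θ₀ - ρ * θ₁ - σ * θi)) *
      Complex.Gamma (1 / 2 + Complex.I * b * (-θ₀ - ρ * θ₁ - σ * θi)))

lemma connInf1_eq (b θ₀ θ₁ θi : ℂ) : connInf1 b θ₀ θ₁ θi =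
    !![coeffInf1 b θ₀ θ₁ θi 1 1, coeffInf1 b θ₀ θ₁ θi 1 (-1);
      coeffInf1 b θ₀ θ₁ θi (-1) 1, coeffInf1 b θ₀ θ₁ θi (-1) (-1)] := by
  have h : ∀ x y u v p q r s : ℂ, x = y → u = v → p = q → r = s →
      Complex.Gamma x * Complex.Gamma u / (Complex.Gamma p * Complex.Gamma r) =
      Complex.Gamma y * Complex.Gamma v / (Complex.Gamma q * Complex.Gamma s) := by
    rintro x _ u _ p _ r _ rfl rfl rfl rfl
    rfl
  have h' : ∀ x y u v p q r s : ℂ, x = y → u = v → p = s → r = q →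
      Complex.Gamma x * Complex.Gamma u / (Complex.Gamma p * Complex.Gamma r) =
      Complex.Gamma y * Complex.Gamma v / (Complex.Gamma q * Complex.Gamma s) := by
    rintro x _ u _ p _ r _ rfl rfl rfl rfl
    rw [mul_comm (Complex.Gamma p)]
  ext i j
  fin_cases i <;> fin_cases j
  · exact h _ _ _ _ _ _ _ _ (by ring) (by ring) (by ring) (by ring)
  · exact h _ _ _ _ _ _ _ _ (by ring) (by ring) (by ring) (by ring)
  · exact h' _ _ _ _ _ _ _ _ (by ring) (by ring) (by ring) (by ring)
  · exact h' _ _ _ _ _ _ _ _ (by ring) (by ring) (by ring) (by ring)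

lemma coeffInf1_mul_coeff1 (hθ₁ : ∀ m : ℤ, 2 * Complex.I * b * θ₁ ≠ m) {σ τ : ℂ}
    (hσ : σ = 1 ∨ σ = -1) (hτ : τ = 1 ∨ τ = -1) :
    coeffInf1 b θ₀ θ₁ θi σ 1 * coeff1 b θ₀ θ₁ θi 1 τ +
      coeffInf1 b θ₀ θ₁ θi σ (-1) * coeff1 b θ₀ θ₁ θi (-1) τ = coeffInf b θ₀ θ₁ θi σ τ := by
  have hy : ∀ m : ℤ, 2 * (Complex.I * b * θ₁) ≠ m := by simpa only [mul_assoc] using hθ₁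
  have key := gamma_connection (x := τ * (Complex.I * b * θ₀))
    (w := σ * (Complex.I * b * θi)) hy
  have hP : ∀ ρ : ℂ, (Complex.Gamma (1 / 2 + Complex.I * b * (τ * θ₀ + ρ * θ₁ + θi)))⁻¹ *
      (Complex.Gamma (1 / 2 + Complex.I * b * (τ * θ₀ + ρ * θ₁ - θi)))⁻¹ =
      (Complex.Gamma (1 / 2 + τ * (Complex.I * b * θ₀) + ρ * (Complex.I * b * θ₁) +
        σ * (Complex.I * b * θi)))⁻¹ *
      (Complex.Gamma (1 / 2 + τ * (Complex.I * b * θ₀) + ρ * (Complex.I * b * θ₁) -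
        σ * (Complex.I * b * θi)))⁻¹ := by
    intro ρ
    rcases hσ with rfl | rfl
    · congr 3 <;> ring
    · rw [mul_comm]
      congr 3 <;> ring
  have hR : ∀ ρ : ℂ, (Complex.Gamma (1 / 2 + Complex.I * b * (θ₀ - ρ * θ₁ - σ * θi)))⁻¹ *
      (Complex.Gamma (1 / 2 + Complex.I * b * (-θ₀ - ρ * θ₁ - σ * θi)))⁻¹ =
      (Complex.Gamma (1 / 2 + τ * (Complex.I * b * θ₀) - ρ * (Complex.I * b * θ₁) -
        σ * (Complex.I * b * θi)))⁻¹ *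
      (Complex.Gamma (1 / 2 - τ * (Complex.I * b * θ₀) - ρ * (Complex.I * b * θ₁) -
        σ * (Complex.I * b * θi)))⁻¹ := by
    intro ρ
    rcases hτ with rfl | rfl
    · congr 3 <;> ring
    · rw [mul_comm]
      congr 3 <;> ring
  have hexp : ∀ u : ℂ, Complex.exp (Real.pi * Complex.I * ((b ^ 2 + 1) / 2 + u)) =
      Complex.exp (Real.pi * Complex.I * (b ^ 2 / 2)) *
        Complex.exp (Real.pi * Complex.I * (1 / 2 + u)) := by
    intro u
    rw [← Complex.exp_add]
    congr 1
    ring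
  have hexp2 : Complex.exp (Real.pi * Complex.I * (b ^ 2 / 2 + τ * (Complex.I * b) * θ₀ +
      σ * (Complex.I * b) * θi)) = Complex.exp (Real.pi * Complex.I * (b ^ 2 / 2)) *
        Complex.exp (Real.pi * Complex.I * (τ * (Complex.I * b * θ₀) +
          σ * (Complex.I * b * θi))) := by
    rw [← Complex.exp_add]
    congr 1
    ring
  have e1 : ∀ ρ : ℂ, coeffInf1 b θ₀ θ₁ θi σ ρ =
      Complex.Gamma (-(ρ * (2 * (Complex.I * b * θ₁)))) *
        Complex.Gamma (1 - σ * (2 * Complex.I * b * θi)) *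
      ((Complex.Gamma (1 / 2 + τ * (Complex.I * b * θ₀) - ρ * (Complex.I * b * θ₁) -
        σ * (Complex.I * b * θi)))⁻¹ *
      (Complex.Gamma (1 / 2 - τ * (Complex.I * b * θ₀) - ρ * (Complex.I * b * θ₁) -
        σ * (Complex.I * b * θi)))⁻¹) := fun ρ => by
    rw [← hR, coeffInf1, div_eq_mul_inv, mul_inv]
  have e2 : ∀ ρ : ℂ, coeff1 b θ₀ θ₁ θi ρ τ =
      Complex.exp (Real.pi * Complex.I * (b ^ 2 / 2)) *
        Complex.exp (Real.pi * Complex.I * (1 / 2 + ρ * (Complex.I * b * θ₁))) *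
      (Complex.Gamma (1 + ρ * (2 * (Complex.I * b * θ₁))) *
        Complex.Gamma (τ * (2 * Complex.I * b * θ₀)) *
      ((Complex.Gamma (1 / 2 + τ * (Complex.I * b * θ₀) + ρ * (Complex.I * b * θ₁) +
        σ * (Complex.I * b * θi)))⁻¹ *
      (Complex.Gamma (1 / 2 + τ * (Complex.I * b * θ₀) + ρ * (Complex.I * b * θ₁) -
        σ * (Complex.I * b * θi)))⁻¹)) := fun ρ => by
    rw [← hP, ← hexp, coeff1, div_eq_mul_inv (_ * _), mul_inv, mul_assoc 2 Complex.I b,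
      mul_assoc 2 (Complex.I * b) θ₁, mul_assoc ρ (Complex.I * b)]
  have e3 : coeffInf b θ₀ θ₁ θi σ τ = Complex.exp (Real.pi * Complex.I * (b ^ 2 / 2)) *
        Complex.exp (Real.pi * Complex.I * (τ * (Complex.I * b * θ₀) +
          σ * (Complex.I * b * θi))) *
      (Complex.Gamma (1 - σ * (2 * Complex.I * b * θi)) *
        Complex.Gamma (τ * (2 * Complex.I * b * θ₀)) *
      ((Complex.Gamma (1 / 2 + τ * (Complex.I * b * θ₀) + Complex.I * b * θ₁ -
        σ * (Complex.I * b * θi)))⁻¹ *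
      (Complex.Gamma (1 / 2 + τ * (Complex.I * b * θ₀) - Complex.I * b * θ₁ -
        σ * (Complex.I * b * θi)))⁻¹)) := by
    rw [← hexp2, coeffInf, div_eq_mul_inv (_ * _), mul_inv]
    congr 5 <;> ring_nf
  rw [e1, e1, e2, e2, e3]
  simp only [one_mul, neg_mul, neg_neg, sub_neg_eq_add, ← sub_eq_add_neg]
  linear_combination Complex.exp (Real.pi * Complex.I * (b ^ 2 / 2)) *
    Complex.Gamma (1 - σ * (2 * Complex.I * b * θi)) *
    Complex.Gamma (τ * (2 * Complex.I * b * θ₀)) * key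

lemma connInf1_mul_conn10 (hθ₁ : ∀ m : ℤ, 2 * Complex.I * b * θ₁ ≠ m) :
    connInf1 b θ₀ θ₁ θi * conn10 b θ₀ θ₁ θi = connInf0 b θ₀ θ₁ θi := by
  rw [connInf1_eq, conn10, connInf0, Matrix.mul_fin_two,
    coeffInf1_mul_coeff1 hθ₁ (Or.inl rfl) (Or.inl rfl),
    coeffInf1_mul_coeff1 hθ₁ (Or.inl rfl) (Or.inr rfl),
    coeffInf1_mul_coeff1 hθ₁ (Or.inr rfl) (Or.inl rfl),
    coeffInf1_mul_coeff1 hθ₁ (Or.inr rfl) (Or.inr rfl)]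

end ConnectionMatrices

/-! ### Uniqueness of the connection matrix -/

section ConnectionMatrices

variable {b θ₀ θ₁ θi : ℂ}

lemma F1_eq_conn10_mulVec (hb : b ≠ 0) (hθ₀ : ∀ m : ℤ, 2 * Complex.I * b * θ₀ ≠ m)
    (h₁ : ∀ k : ℕ, 1 + 2 * Complex.I * b * θ₁ ≠ -k)
    (h₂ : ∀ k : ℕ, 1 - 2 * Complex.I * b * θ₁ ≠ -k) {z : ℂ} (hz : 0 < z.im) :
    F1 b θ₀ θ₁ θi z = conn10 b θ₀ θ₁ θi *ᵥ F0 b θ₀ θ₁ θi z := by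
  rw [F1, conn10, F0, Matrix.mulVec_fin_two,
    F1comp_eq hb hθ₀ (Or.inl rfl) (by simpa using h₁) hz,
    F1comp_eq hb hθ₀ (Or.inr rfl) (by simpa [← sub_eq_add_neg] using h₂) hz]
  rfl

lemma FInf_eq_connInf0_mulVec (hb : b ≠ 0) (hθ₀ : ∀ m : ℤ, 2 * Complex.I * b * θ₀ ≠ m)
    (h₁ : ∀ k : ℕ, 1 + 2 * Complex.I * b * θi ≠ -k)
    (h₂ : ∀ k : ℕ, 1 - 2 * Complex.I * b * θi ≠ -k) {z : ℂ} (hz : 0 < z.im) :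
    FInf b θ₀ θ₁ θi z = connInf0 b θ₀ θ₁ θi *ᵥ F0 b θ₀ θ₁ θi z := by
  rw [FInf, connInf0, F0, Matrix.mulVec_fin_two,
    FInfcomp_eq hb hθ₀ (Or.inl rfl) (by simpa using h₂) hz,
    FInfcomp_eq hb hθ₀ (Or.inr rfl) (by simpa using h₁) hz]
  rfl

lemma Gamma_ne_zero_of_ne_intCast {x : ℂ} (hx : ∀ m : ℤ, x ≠ m) : Complex.Gamma x ≠ 0 :=
  Complex.Gamma_ne_zero fun k h => hx (-k) (by simpa using h)

lemma det_conn10_ne_zero (hθ₀ : ∀ m : ℤ, 2 * Complex.I * b * θ₀ ≠ m)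
    (hθ₁ : ∀ m : ℤ, 2 * Complex.I * b * θ₁ ≠ m) : (conn10 b θ₀ θ₁ θi).det ≠ 0 := by
  have hπ : (Real.pi : ℂ) ≠ 0 := Complex.ofReal_ne_zero.2 Real.pi_ne_zero
  have e : ∀ ρ τ : ℂ, coeff1 b θ₀ θ₁ θi ρ τ =
      Complex.exp (Real.pi * Complex.I * ((b ^ 2 + 1) / 2 + ρ * (Complex.I * b) * θ₁)) *
      (Complex.Gamma (1 + ρ * (2 * Complex.I * b * θ₁)) *
        Complex.Gamma (τ * (2 * Complex.I * b * θ₀)) *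
      ((Complex.Gamma (1 / 2 + Complex.I * b * (τ * θ₀ + ρ * θ₁ + θi)))⁻¹ *
      (Complex.Gamma (1 / 2 + Complex.I * b * (τ * θ₀ + ρ * θ₁ - θi)))⁻¹)) := fun ρ τ => by
    rw [coeff1, div_eq_mul_inv (_ * _), mul_inv]
  have hc : ∀ ρ τ : ℂ, ((Complex.Gamma (1 / 2 + Complex.I * b * (τ * θ₀ + ρ * θ₁ + θi)))⁻¹ *
      (Complex.Gamma (1 / 2 + Complex.I * b * (τ * θ₀ + ρ * θ₁ - θi)))⁻¹) *
      ((Complex.Gamma (1 / 2 + Complex.I * b * (-τ * θ₀ + -ρ * θ₁ + θi)))⁻¹ *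
      (Complex.Gamma (1 / 2 + Complex.I * b * (-τ * θ₀ + -ρ * θ₁ - θi)))⁻¹) =
      Complex.cos (Real.pi * (Complex.I * b * (τ * θ₀ + ρ * θ₁ + θi))) / Real.pi *
      (Complex.cos (Real.pi * (Complex.I * b * (τ * θ₀ + ρ * θ₁ - θi))) / Real.pi) := by
    intro ρ τ
    have h1 := inv_Gamma_half_mul (1 / 2 + Complex.I * b * (τ * θ₀ + ρ * θ₁ + θi))
      (1 / 2 + Complex.I * b * (-τ * θ₀ + -ρ * θ₁ - θi)) (by ring)
    have h2 := inv_Gamma_half_mul (1 / 2 + Complex.I * b * (τ * θ₀ + ρ * θ₁ - θi))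
      (1 / 2 + Complex.I * b * (-τ * θ₀ + -ρ * θ₁ + θi)) (by ring)
    rw [add_sub_cancel_left] at h1 h2
    rw [← h1, ← h2]
    ring
  have hx : ∀ ρ : ℂ, Complex.exp (Real.pi * Complex.I * ((b ^ 2 + 1) / 2 +
      ρ * (Complex.I * b) * θ₁)) * Complex.exp (Real.pi * Complex.I * ((b ^ 2 + 1) / 2 +
      -ρ * (Complex.I * b) * θ₁)) = Complex.exp (Real.pi * Complex.I * (b ^ 2 + 1)) := by
    intro ρ
    rw [← Complex.exp_add]
    congr 1
    ring
  have htrig : Complex.cos (Real.pi * (Complex.I * b * (1 * θ₀ + 1 * θ₁ + θi))) *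
      Complex.cos (Real.pi * (Complex.I * b * (1 * θ₀ + 1 * θ₁ - θi))) -
      Complex.cos (Real.pi * (Complex.I * b * (1 * θ₀ + -1 * θ₁ + θi))) *
      Complex.cos (Real.pi * (Complex.I * b * (1 * θ₀ + -1 * θ₁ - θi))) =
      -(Complex.sin (Real.pi * (2 * Complex.I * b * θ₀)) *
        Complex.sin (Real.pi * (2 * Complex.I * b * θ₁))) := by
    have p : ∀ u v : ℂ, Complex.cos (u + v) * Complex.cos (u - v) =
        (Complex.cos (2 * u) + Complex.cos (2 * v)) / 2 := by
      intro u v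
      rw [Complex.cos_add_cos, show (2 * u + 2 * v) / 2 = u + v by ring,
        show (2 * u - 2 * v) / 2 = u - v by ring]
      ring
    have q : ∀ u v : ℂ, Complex.cos (u + v) - Complex.cos (u - v) =
        -2 * (Complex.sin u * Complex.sin v) := by
      intro u v
      rw [Complex.cos_add, Complex.cos_sub]
      ring
    have p1 := p (Real.pi * (Complex.I * b * (θ₀ + θ₁))) (Real.pi * (Complex.I * b * θi))
    have p2 := p (Real.pi * (Complex.I * b * (θ₀ - θ₁))) (Real.pi * (Complex.I * b * θi))
    have q1 := q (Real.pi * (2 * Complex.I * b * θ₀)) (Real.pi * (2 * Complex.I * b * θ₁))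
    rw [show Real.pi * (Complex.I * b * (1 * θ₀ + 1 * θ₁ + θi)) =
        Real.pi * (Complex.I * b * (θ₀ + θ₁)) + Real.pi * (Complex.I * b * θi) by ring,
      show Real.pi * (Complex.I * b * (1 * θ₀ + 1 * θ₁ - θi)) =
        Real.pi * (Complex.I * b * (θ₀ + θ₁)) - Real.pi * (Complex.I * b * θi) by ring,
      show Real.pi * (Complex.I * b * (1 * θ₀ + -1 * θ₁ + θi)) =
        Real.pi * (Complex.I * b * (θ₀ - θ₁)) + Real.pi * (Complex.I * b * θi) by ring,
      show Real.pi * (Complex.I * b * (1 * θ₀ + -1 * θ₁ - θi)) =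
        Real.pi * (Complex.I * b * (θ₀ - θ₁)) - Real.pi * (Complex.I * b * θi) by ring, p1, p2]
    rw [show Real.pi * (2 * Complex.I * b * θ₀) + Real.pi * (2 * Complex.I * b * θ₁) =
        2 * (Real.pi * (Complex.I * b * (θ₀ + θ₁))) by ring,
      show Real.pi * (2 * Complex.I * b * θ₀) - Real.pi * (2 * Complex.I * b * θ₁) =
        2 * (Real.pi * (Complex.I * b * (θ₀ - θ₁))) by ring] at q1
    linear_combination q1 / 2
  have key : (conn10 b θ₀ θ₁ θi).det = -(Complex.exp (Real.pi * Complex.I * (b ^ 2 + 1)) *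
      (Complex.Gamma (1 + 2 * Complex.I * b * θ₁) * Complex.Gamma (1 - 2 * Complex.I * b * θ₁)) *
      (Complex.Gamma (2 * Complex.I * b * θ₀) * Complex.Gamma (-(2 * Complex.I * b * θ₀))) *
      (Complex.sin (Real.pi * (2 * Complex.I * b * θ₀)) *
        Complex.sin (Real.pi * (2 * Complex.I * b * θ₁))) / Real.pi ^ 2) := by
    have c1 := hc 1 1
    have c2 := hc (-1) 1
    have x1 := hx 1
    rw [neg_neg] at c2
    rw [conn10, Matrix.det_fin_two_of, e, e, e, e]
    simp only [one_mul, neg_mul, ← sub_eq_add_neg] at c1 c2 x1 htrig ⊢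
    generalize Complex.exp (Real.pi * Complex.I * ((b ^ 2 + 1) / 2 + Complex.I * b * θ₁)) = E₁ at *
    generalize Complex.exp (Real.pi * Complex.I * ((b ^ 2 + 1) / 2 - Complex.I * b * θ₁)) = E₂ at *
    generalize Complex.Gamma (1 + 2 * Complex.I * b * θ₁) = g₁
    generalize Complex.Gamma (1 - 2 * Complex.I * b * θ₁) = g₂
    generalize Complex.Gamma (2 * Complex.I * b * θ₀) = g₃
    generalize Complex.Gamma (-(2 * Complex.I * b * θ₀)) = g₄
    linear_combination E₁ * E₂ * (g₁ * g₂ * g₃ * g₄) * (c1 - c2 + htrig / Real.pi ^ 2) -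
      g₁ * g₂ * g₃ * g₄ * Complex.sin (Real.pi * (2 * Complex.I * b * θ₀)) *
        Complex.sin (Real.pi * (2 * Complex.I * b * θ₁)) / Real.pi ^ 2 * x1
  rw [key]
  have a1 := Gamma_ne_zero_of_ne_intCast hθ₀
  have a2 : Complex.Gamma (-(2 * Complex.I * b * θ₀)) ≠ 0 :=
    Gamma_ne_zero_of_ne_intCast fun m h => hθ₀ (-m) (by push_cast; linear_combination -h)
  have a3 : Complex.Gamma (1 + 2 * Complex.I * b * θ₁) ≠ 0 :=
    Complex.Gamma_ne_zero (one_add_ne_neg_nat hθ₁)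
  have a4 : Complex.Gamma (1 - 2 * Complex.I * b * θ₁) ≠ 0 :=
    Complex.Gamma_ne_zero (one_sub_ne_neg_nat hθ₁)
  have a5 := sin_pi_mul_ne_zero hθ₀
  have a6 := sin_pi_mul_ne_zero hθ₁
  refine neg_ne_zero.2 (div_ne_zero ?_ (pow_ne_zero _ hπ))
  exact mul_ne_zero (mul_ne_zero (mul_ne_zero (Complex.exp_ne_zero _) (mul_ne_zero a3 a4))
    (mul_ne_zero a1 a2)) (mul_ne_zero a5 a6)

end ConnectionMatrices

/-- The two solutions at the origin are linearly independent on the upper half plane. -/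
lemma F0comp_linearIndependent {b θ₀ θ₁ θi A B : ℂ} (hθ₀ : ∀ m : ℤ, 2 * Complex.I * b * θ₀ ≠ m)
    (h : ∀ z : ℂ, 0 < z.im →
      A * F0comp b θ₀ θ₁ θi 1 z + B * F0comp b θ₀ θ₁ θi (-1) z = 0) : A = 0 ∧ B = 0 := by
  set p : ℂ := 1 / 2 + Complex.I * b * (-θ₀ + θ₁ + θi) with hp
  set q : ℂ := 1 / 2 + Complex.I * b * (θ₀ + θ₁ + θi) with hq
  set c : ℂ := 1 + 2 * (Complex.I * b * θi) with hc
  have hpq : ∀ m : ℤ, p - q ≠ m := param_sub_ne_intCast hθ₀ (by rw [hp, hq]; ring)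
  have hqp := sub_ne_intCast_symm hpq
  set A' := A * Complex.exp (p * (Real.pi * Complex.I)) with hA'
  set B' := B * Complex.exp (q * (Real.pi * Complex.I)) with hB'
  have hdiff : DifferentiableOn ℂ (fun s => A' * expG p q c s + B' * expG q p c s) logStrip :=
    ((differentiableOn_expG c hpq).const_mul A').add ((differentiableOn_expG c hqp).const_mul B')
  have hsmall : ∀ s : ℂ, 0 < s.im → s.im < Real.pi →
      A' * expG p q c s + B' * expG q p c s = 0 := by
    intro s h0 h1
    set ℓ : ℂ := Real.pi * Complex.I - s with hℓ
    have him : ℓ.im = Real.pi - s.im := by simp [hℓ]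
    have hlog : Complex.log (Complex.exp ℓ) = ℓ :=
      Complex.log_exp (by rw [him]; linarith) (by rw [him]; linarith)
    have hz : 0 < (Complex.exp ℓ).im := by
      rw [Complex.exp_im]
      exact mul_pos (Real.exp_pos _)
        (Real.sin_pos_of_pos_of_lt_pi (by rw [him]; linarith) (by rw [him]; linarith))
    have h1z := one_sub_ne_zero_of_im_pos hz
    have hz' : -Complex.exp (-s) = Complex.exp ℓ := by
      rw [hℓ, sub_eq_add_neg, Complex.exp_add, Complex.exp_pi_mul_I]
      ring
    have hF := h _ hz
    rw [F0comp, F0comp, hlog] at hF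
    rw [expG, expG, expF, expF, hz']
    rw [show p - c + 1 = 1 / 2 + Complex.I * b * (-1 * θ₀ + θ₁ - θi) by rw [hp, hc]; ring,
      show q - c + 1 = 1 / 2 + Complex.I * b * (- -1 * θ₀ + θ₁ - θi) by rw [hq, hc]; ring,
      show p - q + 1 = 1 - 1 * (2 * Complex.I * b * θ₀) by rw [hp, hq]; ring,
      show q - p + 1 = 1 - -1 * (2 * Complex.I * b * θ₀) by rw [hp, hq]; ring]
    have e1 : gaussF p = gaussF (1 / 2 + Complex.I * b * (-1 * θ₀ + θ₁ + θi)) := by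
      rw [hp]; congr 1; ring
    have e2 : gaussF q = gaussF (1 / 2 + Complex.I * b * (- -1 * θ₀ + θ₁ + θi)) := by
      rw [hq]; congr 1; ring
    rw [e1, e2]
    generalize gaussF (1 / 2 + Complex.I * b * (-1 * θ₀ + θ₁ + θi)) _ _ _ = G1 at *
    generalize gaussF (1 / 2 + Complex.I * b * (- -1 * θ₀ + θ₁ + θi)) _ _ _ = G2 at *
    have hw : (1 - Complex.exp ℓ) ^ ((b ^ 2 + 1) / 2 + Complex.I * b * θ₁) ≠ 0 := by
      rw [Complex.cpow_def_of_ne_zero h1z]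
      exact Complex.exp_ne_zero _
    generalize (1 - Complex.exp ℓ) ^ ((b ^ 2 + 1) / 2 + Complex.I * b * θ₁) = w at *
    have x1 : Complex.exp (p * (Real.pi * Complex.I)) * Complex.exp (-(p * s)) =
        Complex.exp ((1 / 2 + Complex.I * b * (θ₁ + θi) - (b ^ 2 + 1) / 2) * ℓ) *
        Complex.exp (((b ^ 2 + 1) / 2 - 1 * (Complex.I * b) * θ₀) * ℓ) := by
      rw [← Complex.exp_add, ← Complex.exp_add, hp, hℓ]
      congr 1
      ring
    have x2 : Complex.exp (q * (Real.pi * Complex.I)) * Complex.exp (-(q * s)) =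
        Complex.exp ((1 / 2 + Complex.I * b * (θ₁ + θi) - (b ^ 2 + 1) / 2) * ℓ) *
        Complex.exp (((b ^ 2 + 1) / 2 - -1 * (Complex.I * b) * θ₀) * ℓ) := by
      rw [← Complex.exp_add, ← Complex.exp_add, hq, hℓ]
      congr 1
      ring
    refine mul_right_cancel₀ hw ?_
    rw [hA', hB']
    linear_combination Complex.exp ((1 / 2 + Complex.I * b * (θ₁ + θi) - (b ^ 2 + 1) / 2) * ℓ) * hF
      + A * G1 * w * x1 + B * G2 * w * x2
  have hmem : (Complex.I : ℂ) ∈ logStrip := by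
    change |Complex.I.im| < Real.pi
    rw [Complex.I_im, abs_one]
    linarith [Real.pi_gt_three]
  have hall : Set.EqOn (fun s => A' * expG p q c s + B' * expG q p c s) (fun _ => 0) logStrip := by
    refine (hdiff.analyticOnNhd isOpen_logStrip).eqOn_of_preconnected_of_eventuallyEq
      analyticOnNhd_const convex_logStrip.isPreconnected hmem ?_
    have o1 : IsOpen {s : ℂ | 0 < s.im ∧ s.im < Real.pi} :=
      (isOpen_lt continuous_const Complex.continuous_im).inter
        (isOpen_lt Complex.continuous_im continuous_const)
    filter_upwards [o1.mem_nhds (x := Complex.I)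
      ⟨by simp, by rw [Complex.I_im]; linarith [Real.pi_gt_three]⟩] with s hs
    exact hsmall s hs.1 hs.2
  obtain ⟨hA, hB⟩ := expG_linearIndependent c hpq hall
  exact ⟨(mul_eq_zero.1 hA).resolve_right (Complex.exp_ne_zero _),
    (mul_eq_zero.1 hB).resolve_right (Complex.exp_ne_zero _)⟩

/-- A matrix annihilating the basis at the origin vanishes. -/
lemma eq_zero_of_mulVec_F0 {b θ₀ θ₁ θi : ℂ} (hθ₀ : ∀ m : ℤ, 2 * Complex.I * b * θ₀ ≠ m)
    {M : Matrix (Fin 2) (Fin 2) ℂ} (h : ∀ z : ℂ, 0 < z.im → M *ᵥ F0 b θ₀ θ₁ θi z = 0) :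
    M = 0 := by
  have hrow : ∀ i, M i 0 = 0 ∧ M i 1 = 0 := fun i =>
    F0comp_linearIndependent (θ₁ := θ₁) (θi := θi) hθ₀ fun z hz => by
      have := congrFun (h z hz) i
      simpa [F0, Matrix.mulVec, dotProduct, Fin.sum_univ_two] using this
  ext i j
  fin_cases j
  · exact (hrow i).1
  · exact (hrow i).2

lemma Qnorm_ne_zero {b θs Λ : ℂ} (hb : b ≠ 0) (hΛ : Λ ≠ 0) (σ : ℂ) : Qnorm b θs Λ σ ≠ 0 := by
  have h : Complex.I * b * Λ ≠ 0 := mul_ne_zero (mul_ne_zero Complex.I_ne_zero hb) hΛ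
  rw [Qnorm, Complex.cpow_def_of_ne_zero h]
  exact mul_ne_zero (mul_ne_zero (Complex.exp_ne_zero _) (Complex.exp_ne_zero _))
    (Complex.exp_ne_zero _)

lemma isUnit_det_Ninf {b θs Λ : ℂ} (hb : b ≠ 0) (hΛ : Λ ≠ 0) : IsUnit (Ninf b θs Λ).det := by
  rw [Ninf, Matrix.det_diagonal, Fin.prod_univ_two]
  exact (mul_ne_zero (Qnorm_ne_zero hb hΛ 1) (Qnorm_ne_zero hb hΛ (-1))).isUnit

/-- The renormalized connection matrix is the conjugate of `C_{∞1}`. -/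
lemma isConnInf1Tilde_iff {b θ₀ θs Λ : ℂ} (hb : b ≠ 0) (hΛ : Λ ≠ 0)
    (hθ₀ : ∀ m : ℤ, 2 * Complex.I * b * θ₀ ≠ m)
    (h₁ : ∀ m : ℤ, Complex.I * b * (Λ + θs) ≠ m) (h₂ : ∀ m : ℤ, Complex.I * b * (Λ - θs) ≠ m)
    (C : Matrix (Fin 2) (Fin 2) ℂ) :
    IsConnInf1Tilde b θ₀ θs Λ C ↔ C = connInf1Tilde b θ₀ θs Λ := by
  have h₁' : ∀ m : ℤ, 2 * Complex.I * b * ((Λ + θs) / 2) ≠ m := fun m h =>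
    h₁ m (by linear_combination h)
  have h₂' : ∀ m : ℤ, 2 * Complex.I * b * ((Λ - θs) / 2) ≠ m := fun m h =>
    h₂ m (by linear_combination h)
  have hN := isUnit_det_Ninf (θs := θs) hb hΛ
  have e1 : ∀ z : ℂ, 0 < z.im → F1Tilde b θ₀ θs z Λ =
      (Ninf b θs Λ * conn10 b θ₀ ((Λ + θs) / 2) ((Λ - θs) / 2)) *ᵥ
        F0 b θ₀ ((Λ + θs) / 2) ((Λ - θs) / 2) z := fun z hz => by
    rw [F1Tilde, F1_eq_conn10_mulVec hb hθ₀ (one_add_ne_neg_nat h₁') (one_sub_ne_neg_nat h₁') hz,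
      Matrix.mulVec_mulVec]
  have e2 : ∀ z : ℂ, 0 < z.im → FInfTilde b θ₀ θs z Λ =
      (Ninf b θs Λ * connInf1 b θ₀ ((Λ + θs) / 2) ((Λ - θs) / 2) *
        conn10 b θ₀ ((Λ + θs) / 2) ((Λ - θs) / 2)) *ᵥ
        F0 b θ₀ ((Λ + θs) / 2) ((Λ - θs) / 2) z := fun z hz => by
    rw [FInfTilde, FInf_eq_connInf0_mulVec hb hθ₀ (one_add_ne_neg_nat h₂')
      (one_sub_ne_neg_nat h₂') hz, Matrix.mulVec_mulVec, Matrix.mul_assoc,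
      connInf1_mul_conn10 h₁']
  constructor
  · intro hC
    have hz : (C * Ninf b θs Λ - Ninf b θs Λ * connInf1 b θ₀ ((Λ + θs) / 2) ((Λ - θs) / 2)) *
        conn10 b θ₀ ((Λ + θs) / 2) ((Λ - θs) / 2) = 0 := by
      refine eq_zero_of_mulVec_F0 (θ₁ := (Λ + θs) / 2) (θi := (Λ - θs) / 2) hθ₀ fun z hz => ?_
      have := hC z hz
      rw [e1 z hz, e2 z hz, Matrix.mulVec_mulVec] at this
      rw [Matrix.sub_mul, Matrix.sub_mulVec, this, Matrix.mul_assoc, sub_self]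
    have hdet := det_conn10_ne_zero (θi := (Λ - θs) / 2) hθ₀ h₁'
    have hz' := congrArg (· * (conn10 b θ₀ ((Λ + θs) / 2) ((Λ - θs) / 2))⁻¹) hz
    simp only [Matrix.mul_nonsing_inv_cancel_right _ _ hdet.isUnit, Matrix.zero_mul] at hz'
    rw [connInf1Tilde, ← sub_eq_zero.1 hz', Matrix.mul_nonsing_inv_cancel_right _ _ hN]
  · rintro rfl z hz
    rw [e1 z hz, e2 z hz, Matrix.mulVec_mulVec, connInf1Tilde, ← Matrix.mul_assoc,
      Matrix.nonsing_inv_mul_cancel_right _ _ hN]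

/-! ### Confluent hypergeometric functions -/

lemma tendsto_mul_log_one_sub_div {ι : Type*} {l : Filter ι} {X : ι → ℂ}
    (hX : Tendsto (fun i => ‖X i‖) l atTop) (t : ℂ) :
    Tendsto (fun i => X i * Complex.log (1 - t / X i)) l (𝓝 (-t)) := by
  have hd : HasDerivAt (fun w : ℂ => Complex.log (1 - t * w)) (-t) 0 := by
    have h1 : HasDerivAt (fun w : ℂ => 1 - t * w) (-t) 0 := by
      simpa using ((hasDerivAt_id (0 : ℂ)).const_mul t).const_sub 1
    simpa using h1.clog (by simp)
  have hX0 : Tendsto (fun i => (X i)⁻¹) l (𝓝[≠] 0) := by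
    refine tendsto_nhdsWithin_iff.2 ⟨?_, ?_⟩
    · exact tendsto_inv₀_cobounded.comp (tendsto_norm_atTop_iff_cobounded.1 hX)
    · filter_upwards [hX.eventually_gt_atTop 0] with i hi
      exact inv_ne_zero (norm_pos_iff.1 hi)
  have := (hasDerivAt_iff_tendsto_slope.1 hd).comp hX0
  refine this.congr fun i => ?_
  simp [slope_def_field, div_eq_mul_inv, mul_comm]

lemma tendsto_div_nhds_zero {ι : Type*} {l : Filter ι} {X : ι → ℂ}
    (hX : Tendsto (fun i => ‖X i‖) l atTop) (t : ℂ) : Tendsto (fun i => t / X i) l (𝓝 0) := by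
  have := (tendsto_inv₀_cobounded.comp (tendsto_norm_atTop_iff_cobounded.1 hX)).const_mul t
  simpa [div_eq_mul_inv] using this

lemma tendsto_one_sub_div_cpow {ι : Type*} {l : Filter ι} {X : ι → ℂ}
    (hX : Tendsto (fun i => ‖X i‖) l atTop) (t k d : ℂ) :
    Tendsto (fun i => (1 - t / X i) ^ (k * X i + d)) l (𝓝 (Complex.exp (-(k * t)))) := by
  have h0 := tendsto_div_nhds_zero hX t
  have h1 : Tendsto (fun i => Complex.log (1 - t / X i)) l (𝓝 0) := by
    have hc : ContinuousAt (fun w : ℂ => Complex.log (1 - w)) 0 :=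
      ContinuousAt.clog (by fun_prop) (by simp)
    have := hc.tendsto.comp h0
    simp only [sub_zero, Complex.log_one] at this
    exact this
  have h2 := ((tendsto_mul_log_one_sub_div hX t).const_mul k).add (h1.const_mul d)
  rw [mul_zero, add_zero, mul_neg] at h2
  refine (h2.cexp).congr' ?_
  filter_upwards [h0.eventually (eventually_ne_nhds (show (0 : ℂ) ≠ 1 by simp))] with i hi
  rw [Complex.cpow_def_of_ne_zero (sub_ne_zero.2 hi.symm)]
  congr 1
  ring

/-- Kummer's transformation, as the confluent limit of Pfaff's transformation. -/
lemma kummerM_kummer (a t : ℂ) {c : ℂ} (hc : ∀ k : ℕ, c ≠ -k) :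
    kummerM a c t = Complex.exp t * kummerM (c - a) c (-t) := by
  have hX : Tendsto (fun n : ℕ => ‖(n : ℂ)‖) atTop atTop := by
    simpa using tendsto_natCast_atTop_atTop (R := ℝ)
  have hY : Tendsto (fun n : ℕ => ‖(n : ℂ) - t‖) atTop atTop := by
    refine tendsto_atTop_mono (fun n => norm_sub_norm_le (n : ℂ) t) ?_
    exact tendsto_atTop_add_const_right _ _ hX
  have h1 := tendsto_hypergeometric_confluent hX 0 a hc t
  have h2 := tendsto_hypergeometric_confluent hY t (c - a) hc (-t)
  have h3 := tendsto_one_sub_div_cpow hX t (-1) 0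
  have hx0 := tendsto_div_nhds_zero hX t
  have hy0 := tendsto_div_nhds_zero hY (-t)
  rw [neg_mul, one_mul, neg_neg] at h3
  refine tendsto_nhds_unique h1 ((h3.mul h2).congr' ?_)
  filter_upwards [hx0.eventually (Metric.ball_mem_nhds _ one_pos),
    hy0.eventually (Metric.ball_mem_nhds _ one_pos), hX.eventually_gt_atTop 0,
    hY.eventually_gt_atTop 0] with n hx hy hn hn'
  have hn := norm_pos_iff.1 hn
  have hn' := norm_pos_iff.1 hn'
  have e : (t / n) / (t / n - 1) = -t / (n - t) := by
    rw [div_sub_one hn, div_div_div_cancel_right₀ hn, ← neg_sub (n : ℂ) t, div_neg, neg_div]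
  rw [← gaussF_eq _ _ hc hx, ← gaussF_eq _ _ hc hy, zero_add, add_sub_cancel,
    gaussF_pfaff _ _ hc (ball_subset_cutPlane hx), e]
  congr 2
  ring

section

variable {b θ₀ θs : ℂ}

/-- The solutions of the confluent BPZ equation with exponents `bQ/2 ∓ ibθ₀` at the origin, for
`τ = ±1`, at the point with logarithm `s`. -/
noncomputable def confXcomp (b θ₀ θs τ s : ℂ) : ℂ :=
  Complex.exp (((b ^ 2 + 1) / 2 - τ * (Complex.I * b) * θ₀) * s) *
    Complex.exp (-(Complex.exp s / 2)) *
    kummerM (1 / 2 + Complex.I * b * (-τ * θ₀ + θs)) (1 - τ * (2 * Complex.I * b * θ₀))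
      (Complex.exp s)

/-- The basis at the origin of the solutions of the confluent BPZ equation. -/
noncomputable def confX (b θ₀ θs s : ℂ) : Fin 2 → ℂ :=
  ![confXcomp b θ₀ θs 1 s, confXcomp b θ₀ θs (-1) s]

/-- The coefficients of a Whittaker solution in the basis at the origin: `σ = ±1` distinguishes the
two components of `D_n`, and `r` counts the turns around the origin. -/
noncomputable def coeffD (b θ₀ θs σ r τ : ℂ) : ℂ :=
  Complex.exp (-(2 * Real.pi * Complex.I * r *
      (1 / 2 + Complex.I * b * (σ * θs - τ * θ₀)))) *
    (Complex.Gamma (τ * (2 * Complex.I * b * θ₀)) /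
      Complex.Gamma (1 / 2 + Complex.I * b * (τ * θ₀ + σ * θs)))

/-- The connection matrix from the origin to the `n`-th Stokes sector. -/
noncomputable def connD (b θ₀ θs : ℂ) (n : ℤ) : Matrix (Fin 2) (Fin 2) ℂ :=
  let p : ℂ := (((n - 1) / 2 : ℤ) : ℂ)
  let q : ℂ := ((n / 2 : ℤ) : ℂ) - 1 / 2
  !![coeffD b θ₀ θs 1 p 1, coeffD b θ₀ θs 1 p (-1);
    coeffD b θ₀ θs (-1) q 1, coeffD b θ₀ θs (-1) q (-1)]

lemma confD_fst (m : ℤ) (s : ℂ) :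
    Complex.exp (b ^ 2 / 2 * s) * (Complex.exp (2 * Real.pi * b * θs * m) *
      whittakerW (-Complex.I * b * θs) (-Complex.I * b * θ₀) (s - 2 * Real.pi * Complex.I * m)) =
    coeffD b θ₀ θs 1 m 1 * confXcomp b θ₀ θs 1 s +
      coeffD b θ₀ θs 1 m (-1) * confXcomp b θ₀ θs (-1) s := by
  have hexp : Complex.exp (s - 2 * Real.pi * Complex.I * m) = Complex.exp s := by
    rw [Complex.exp_sub, mul_comm _ (m : ℂ), Complex.exp_int_mul_two_pi_mul_I, div_one]
  rw [whittakerW, tricomiU, hexp, coeffD, coeffD, confXcomp, confXcomp]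
  rw [show 1 - (1 + 2 * (-Complex.I * b * θ₀)) = 1 * (2 * Complex.I * b * θ₀) by ring,
    show 1 + 2 * (-Complex.I * b * θ₀) - 1 = -1 * (2 * Complex.I * b * θ₀) by ring,
    show 2 - (1 + 2 * (-Complex.I * b * θ₀)) = 1 - -1 * (2 * Complex.I * b * θ₀) by ring,
    show -Complex.I * b * θ₀ - -Complex.I * b * θs + 1 / 2 + 1 - (1 + 2 * (-Complex.I * b * θ₀)) =
      1 / 2 + Complex.I * b * (1 * θ₀ + 1 * θs) by ring,
    show 1 + 2 * (-Complex.I * b * θ₀) = 1 - 1 * (2 * Complex.I * b * θ₀) by ring,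
    show -Complex.I * b * θ₀ - -Complex.I * b * θs + 1 / 2 =
      1 / 2 + Complex.I * b * (-1 * θ₀ + 1 * θs) by ring]
  rw [show (- -1 * θ₀ + θs) = 1 * θ₀ + 1 * θs by ring,
    show (-1 * θ₀ + θs) = -1 * θ₀ + 1 * θs by ring]
  generalize kummerM (1 / 2 + Complex.I * b * (-1 * θ₀ + 1 * θs)) _ _ = M1
  generalize kummerM (1 / 2 + Complex.I * b * (1 * θ₀ + 1 * θs)) _ _ = M2
  have x1 : Complex.exp (b ^ 2 / 2 * s) * Complex.exp (2 * Real.pi * b * θs * m) *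
      Complex.exp ((-Complex.I * b * θ₀ + 1 / 2) * (s - 2 * Real.pi * Complex.I * m)) =
      Complex.exp (-(2 * Real.pi * Complex.I * m *
        (1 / 2 + Complex.I * b * (1 * θs - 1 * θ₀)))) *
      Complex.exp (((b ^ 2 + 1) / 2 - 1 * (Complex.I * b) * θ₀) * s) := by
    rw [← Complex.exp_add, ← Complex.exp_add, ← Complex.exp_add]
    congr 1
    linear_combination 2 * Real.pi * b * θs * m * Complex.I_sq
  have x2 : Complex.exp (b ^ 2 / 2 * s) * Complex.exp (2 * Real.pi * b * θs * m) *
      Complex.exp ((-Complex.I * b * θ₀ + 1 / 2) * (s - 2 * Real.pi * Complex.I * m)) *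
      Complex.exp (1 * (2 * Complex.I * b * θ₀) * (s - 2 * Real.pi * Complex.I * m)) =
      Complex.exp (-(2 * Real.pi * Complex.I * m *
        (1 / 2 + Complex.I * b * (1 * θs - -1 * θ₀)))) *
      Complex.exp (((b ^ 2 + 1) / 2 - -1 * (Complex.I * b) * θ₀) * s) := by
    rw [← Complex.exp_add, ← Complex.exp_add, ← Complex.exp_add, ← Complex.exp_add]
    congr 1
    linear_combination 2 * Real.pi * b * θs * m * Complex.I_sq
  generalize Complex.exp (-(Complex.exp s / 2)) = E
  generalize Complex.Gamma (1 * (2 * Complex.I * b * θ₀)) = g₁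
  generalize Complex.Gamma (-1 * (2 * Complex.I * b * θ₀)) = g₂
  generalize Complex.Gamma (1 / 2 + Complex.I * b * (1 * θ₀ + 1 * θs)) = g₃
  generalize Complex.Gamma (1 / 2 + Complex.I * b * (-1 * θ₀ + 1 * θs)) = g₄
  linear_combination E * (g₁ / g₃) * M1 * x1 + E * (g₂ / g₄) * M2 * x2

lemma confD_snd (hθ₀ : ∀ m : ℤ, 2 * Complex.I * b * θ₀ ≠ m) (m : ℤ) (s : ℂ) :
    Complex.exp (b ^ 2 / 2 * s) * (Complex.exp (-(2 * Real.pi * b * θs * (m - 1 / 2))) *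
      whittakerW (Complex.I * b * θs) (-Complex.I * b * θ₀)
        (s - 2 * Real.pi * Complex.I * (m - 1 / 2))) =
    coeffD b θ₀ θs (-1) (m - 1 / 2) 1 * confXcomp b θ₀ θs 1 s +
      coeffD b θ₀ θs (-1) (m - 1 / 2) (-1) * confXcomp b θ₀ θs (-1) s := by
  have hexp : Complex.exp (s - 2 * Real.pi * Complex.I * (m - 1 / 2)) = -Complex.exp s := by
    rw [show s - 2 * Real.pi * Complex.I * (m - 1 / 2) = s - m * (2 * Real.pi * Complex.I) +
      Real.pi * Complex.I by ring, Complex.exp_add, Complex.exp_sub,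
      Complex.exp_int_mul_two_pi_mul_I, div_one, Complex.exp_pi_mul_I, mul_neg_one]
  have hc1 : ∀ k : ℕ, 1 - 1 * (2 * Complex.I * b * θ₀) ≠ -k := by
    simpa using one_sub_ne_neg_nat hθ₀
  have hc2 : ∀ k : ℕ, 1 - -1 * (2 * Complex.I * b * θ₀) ≠ -k := by
    simpa using one_add_ne_neg_nat hθ₀
  rw [whittakerW, tricomiU, hexp, coeffD, coeffD, confXcomp, confXcomp, kummerM_kummer _ _ hc1,
    kummerM_kummer _ _ hc2]
  rw [show 1 - (1 + 2 * (-Complex.I * b * θ₀)) = 1 * (2 * Complex.I * b * θ₀) by ring,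
    show 1 + 2 * (-Complex.I * b * θ₀) - 1 = -1 * (2 * Complex.I * b * θ₀) by ring,
    show 2 - (1 + 2 * (-Complex.I * b * θ₀)) = 1 - -1 * (2 * Complex.I * b * θ₀) by ring,
    show -Complex.I * b * θ₀ - Complex.I * b * θs + 1 / 2 + 1 - (1 + 2 * (-Complex.I * b * θ₀)) =
      1 / 2 + Complex.I * b * (1 * θ₀ + -1 * θs) by ring,
    show 1 + 2 * (-Complex.I * b * θ₀) = 1 - 1 * (2 * Complex.I * b * θ₀) by ring,
    show -Complex.I * b * θ₀ - Complex.I * b * θs + 1 / 2 =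
      1 / 2 + Complex.I * b * (-1 * θ₀ + -1 * θs) by ring]
  rw [show 1 - 1 * (2 * Complex.I * b * θ₀) - (1 / 2 + Complex.I * b * (-1 * θ₀ + θs)) =
      1 / 2 + Complex.I * b * (-1 * θ₀ + -1 * θs) by ring,
    show 1 - -1 * (2 * Complex.I * b * θ₀) - (1 / 2 + Complex.I * b * (- -1 * θ₀ + θs)) =
      1 / 2 + Complex.I * b * (1 * θ₀ + -1 * θs) by ring]
  generalize kummerM (1 / 2 + Complex.I * b * (-1 * θ₀ + -1 * θs)) _ _ = M1
  generalize kummerM (1 / 2 + Complex.I * b * (1 * θ₀ + -1 * θs)) _ _ = M2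
  have x0 : Complex.exp (-(-Complex.exp s / 2)) =
      Complex.exp (-(Complex.exp s / 2)) * Complex.exp (Complex.exp s) := by
    rw [← Complex.exp_add]
    congr 1
    ring
  rw [x0]
  have x1 : Complex.exp (b ^ 2 / 2 * s) *
      Complex.exp (-(2 * Real.pi * b * θs * (m - 1 / 2))) *
      Complex.exp ((-Complex.I * b * θ₀ + 1 / 2) * (s - 2 * Real.pi * Complex.I * (m - 1 / 2))) =
      Complex.exp (-(2 * Real.pi * Complex.I * (m - 1 / 2) *
        (1 / 2 + Complex.I * b * (-1 * θs - 1 * θ₀)))) *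
      Complex.exp (((b ^ 2 + 1) / 2 - 1 * (Complex.I * b) * θ₀) * s) := by
    rw [← Complex.exp_add, ← Complex.exp_add, ← Complex.exp_add]
    congr 1
    linear_combination -(2 * Real.pi * b * θs * (m - 1 / 2)) * Complex.I_sq
  have x2 : Complex.exp (b ^ 2 / 2 * s) *
      Complex.exp (-(2 * Real.pi * b * θs * (m - 1 / 2))) *
      Complex.exp ((-Complex.I * b * θ₀ + 1 / 2) * (s - 2 * Real.pi * Complex.I * (m - 1 / 2))) *
      Complex.exp (1 * (2 * Complex.I * b * θ₀) * (s - 2 * Real.pi * Complex.I * (m - 1 / 2))) =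
      Complex.exp (-(2 * Real.pi * Complex.I * (m - 1 / 2) *
        (1 / 2 + Complex.I * b * (-1 * θs - -1 * θ₀)))) *
      Complex.exp (((b ^ 2 + 1) / 2 - -1 * (Complex.I * b) * θ₀) * s) := by
    rw [← Complex.exp_add, ← Complex.exp_add, ← Complex.exp_add, ← Complex.exp_add]
    congr 1
    linear_combination -(2 * Real.pi * b * θs * (m - 1 / 2)) * Complex.I_sq
  generalize Complex.exp (-(Complex.exp s / 2)) = E
  generalize Complex.exp (Complex.exp s) = E'
  generalize Complex.Gamma (1 * (2 * Complex.I * b * θ₀)) = g₁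
  generalize Complex.Gamma (-1 * (2 * Complex.I * b * θ₀)) = g₂
  generalize Complex.Gamma (1 / 2 + Complex.I * b * (1 * θ₀ + -1 * θs)) = g₃
  generalize Complex.Gamma (1 / 2 + Complex.I * b * (-1 * θ₀ + -1 * θs)) = g₄
  linear_combination E * E' * (g₁ / g₃) * M1 * x1 + E * E' * (g₂ / g₄) * M2 * x2

lemma confD_eq_connD_mulVec (hθ₀ : ∀ m : ℤ, 2 * Complex.I * b * θ₀ ≠ m) (n : ℤ) (s : ℂ) :
    confD b θ₀ θs n s = connD b θ₀ θs n *ᵥ confX b θ₀ θs s := by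
  rw [confD, connD, confX, Matrix.mulVec_fin_two]
  simp only [confD_fst, confD_snd hθ₀]
  rfl

/-- The effect on the bases `D_n` of turns around the origin. -/
lemma confD_add_two_mul (N : ℕ) (n : ℤ) (s : ℂ) :
    confD b θ₀ θs (n + 2 * N) s =
      phase b θs ^ N *ᵥ confD b θ₀ θs n (s - 2 * Real.pi * Complex.I * N) := by
  have h1 : (n + 2 * N - 1) / 2 = (n - 1) / 2 + N := by omega
  have h2 : (n + 2 * N) / 2 = n / 2 + N := by omega
  rw [phase, smul_pow, Matrix.diagonal_pow, confD, confD, h1, h2]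
  ext i
  rw [Matrix.smul_mulVec, Pi.smul_apply, Matrix.mulVec_diagonal, smul_eq_mul, Pi.pow_apply,
    ← Complex.exp_nat_mul]
  push_cast
  fin_cases i
  all_goals
    change Complex.exp _ * (Complex.exp _ * whittakerW _ _ _) =
      _ * (Complex.exp _ ^ N * (Complex.exp _ * (Complex.exp _ * whittakerW _ _ _)))
    rw [← Complex.exp_nat_mul, ← mul_assoc, ← mul_assoc, ← mul_assoc, ← mul_assoc,
      ← Complex.exp_add, ← Complex.exp_add, ← Complex.exp_add, ← Complex.exp_add]
    congr 2
    · ring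
    · ring

end

/-! ### Stokes matrices -/

lemma kummerM_zero (a : ℂ) {c : ℂ} (hc : ∀ k : ℕ, c ≠ -k) : kummerM a c 0 = 1 := by
  rw [kummerM_eq_tsum a 0 hc, tsum_eq_single 0 (fun n hn => by simp [hn])]
  simp

lemma continuousAt_kummerM_zero (a c : ℂ) : ContinuousAt (kummerM a c) 0 := by
  have hr : (Complex.regularizedHGFunSeries {a} {c}).radius = ⊤ :=
    Complex.radius_regularizedHGFunSeries_eq_top (by simp)
  have := (Complex.regularizedHGFunSeries {a} {c}).hasFPowerSeriesOnBall (by rw [hr]; simp)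
  exact continuousAt_const.mul this.hasFPowerSeriesAt.continuousAt

section

variable {b θ₀ θs : ℂ}

/-- A solution at the origin is multiplied by a constant under a turn around the origin. -/
lemma confXcomp_add_two_pi (τ s : ℂ) :
    confXcomp b θ₀ θs τ (s + 2 * Real.pi * Complex.I) =
      Complex.exp (((b ^ 2 + 1) / 2 - τ * (Complex.I * b) * θ₀) * (2 * Real.pi * Complex.I)) *
        confXcomp b θ₀ θs τ s := by
  have h : Complex.exp (s + 2 * Real.pi * Complex.I) = Complex.exp s := by
    rw [Complex.exp_add, Complex.exp_two_pi_mul_I, mul_one]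
  rw [confXcomp, confXcomp, h, mul_add, Complex.exp_add]
  ring

lemma exists_confXcomp_ne_zero {τ : ℂ} (hc : ∀ k : ℕ, 1 - τ * (2 * Complex.I * b * θ₀) ≠ -k) :
    ∃ s, confXcomp b θ₀ θs τ s ≠ 0 := by
  have h1 := (continuousAt_kummerM_zero (1 / 2 + Complex.I * b * (-τ * θ₀ + θs))
    (1 - τ * (2 * Complex.I * b * θ₀))).tendsto
  rw [kummerM_zero _ hc] at h1
  have h2 : Tendsto (fun x : ℝ => Complex.exp (x : ℂ)) atBot (𝓝 0) := by
    have := (Complex.continuous_ofReal.tendsto 0).comp Real.tendsto_exp_atBot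
    simpa [Function.comp_def] using this
  obtain ⟨x, hx⟩ := ((h1.comp h2).eventually (eventually_ne_nhds one_ne_zero)).exists
  exact ⟨x, mul_ne_zero (mul_ne_zero (Complex.exp_ne_zero _) (Complex.exp_ne_zero _)) hx⟩

lemma confXcomp_linearIndependent (hθ₀ : ∀ m : ℤ, 2 * Complex.I * b * θ₀ ≠ m) {A B : ℂ}
    (h : ∀ s, A * confXcomp b θ₀ θs 1 s + B * confXcomp b θ₀ θs (-1) s = 0) : A = 0 ∧ B = 0 := by
  have hc1 : ∀ k : ℕ, 1 - 1 * (2 * Complex.I * b * θ₀) ≠ -k := by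
    simpa using one_sub_ne_neg_nat hθ₀
  have hc2 : ∀ k : ℕ, 1 - -1 * (2 * Complex.I * b * θ₀) ≠ -k := by
    simpa using one_add_ne_neg_nat hθ₀
  -- The two solutions have different monodromy around the origin.
  have hne : Complex.exp (((b ^ 2 + 1) / 2 - 1 * (Complex.I * b) * θ₀) *
      (2 * Real.pi * Complex.I)) ≠ Complex.exp (((b ^ 2 + 1) / 2 - -1 * (Complex.I * b) * θ₀) *
      (2 * Real.pi * Complex.I)) := by
    intro he
    obtain ⟨n, hn⟩ := Complex.exp_eq_exp_iff_exists_int.1 he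
    refine hθ₀ (-n) (mul_right_cancel₀ Complex.two_pi_I_ne_zero ?_)
    push_cast
    linear_combination -hn
  have hA : ∀ s, A * confXcomp b θ₀ θs 1 s = 0 := fun s => by
    have h1 := h s
    have h2 := h (s + 2 * Real.pi * Complex.I)
    rw [confXcomp_add_two_pi, confXcomp_add_two_pi] at h2
    refine (mul_eq_zero.1 ?_).resolve_left (sub_ne_zero.2 hne)
    linear_combination h2 - Complex.exp (((b ^ 2 + 1) / 2 - -1 * (Complex.I * b) * θ₀) *
      (2 * Real.pi * Complex.I)) * h1
  obtain ⟨s, hs⟩ := exists_confXcomp_ne_zero (θs := θs) hc1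
  obtain ⟨s', hs'⟩ := exists_confXcomp_ne_zero (θs := θs) hc2
  refine ⟨(mul_eq_zero.1 (hA s)).resolve_right hs, ?_⟩
  have := h s'
  rw [hA, zero_add] at this
  exact (mul_eq_zero.1 this).resolve_right hs'

/-- A matrix annihilating the confluent basis at the origin vanishes. -/
lemma eq_zero_of_mulVec_confX (hθ₀ : ∀ m : ℤ, 2 * Complex.I * b * θ₀ ≠ m)
    {M : Matrix (Fin 2) (Fin 2) ℂ} (h : ∀ s, M *ᵥ confX b θ₀ θs s = 0) : M = 0 := by
  have hrow : ∀ i, M i 0 = 0 ∧ M i 1 = 0 := fun i =>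
    confXcomp_linearIndependent (θs := θs) hθ₀ fun s => by
      have := congrFun (h s) i
      simpa [confX, Matrix.mulVec, dotProduct, Fin.sum_univ_two] using this
  ext i j
  fin_cases j
  · exact (hrow i).1
  · exact (hrow i).2

lemma coeffD_eq (σ r τ : ℂ) : coeffD b θ₀ θs σ r τ =
    Complex.exp (-(2 * Real.pi * Complex.I * r * (1 / 2 + Complex.I * b * (σ * θs - τ * θ₀)))) *
    (Complex.Gamma (τ * (2 * Complex.I * b * θ₀)) *
      (Complex.Gamma (1 / 2 + Complex.I * b * (τ * θ₀ + σ * θs)))⁻¹) := by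
  rw [coeffD, div_eq_mul_inv (Complex.Gamma _)]

lemma connD_one : connD b θ₀ θs 1 =
    !![coeffD b θ₀ θs 1 0 1, coeffD b θ₀ θs 1 0 (-1);
      coeffD b θ₀ θs (-1) (-(1 / 2)) 1, coeffD b θ₀ θs (-1) (-(1 / 2)) (-1)] := by
  simp [connD]

lemma connD_two : connD b θ₀ θs 2 =
    !![coeffD b θ₀ θs 1 0 1, coeffD b θ₀ θs 1 0 (-1);
      coeffD b θ₀ θs (-1) (1 / 2) 1, coeffD b θ₀ θs (-1) (1 / 2) (-1)] := by
  have : (1 : ℂ) - 2⁻¹ = 2⁻¹ := by norm_num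
  simp [connD, this]

lemma connD_three : connD b θ₀ θs 3 =
    !![coeffD b θ₀ θs 1 1 1, coeffD b θ₀ θs 1 1 (-1);
      coeffD b θ₀ θs (-1) (1 / 2) 1, coeffD b θ₀ θs (-1) (1 / 2) (-1)] := by
  have : (1 : ℂ) - 2⁻¹ = 2⁻¹ := by norm_num
  simp [connD, this]

lemma two_I_sin (u : ℂ) : Complex.exp (-(u * Complex.I)) - Complex.exp (u * Complex.I) =
    -(2 * Complex.I * Complex.sin u) := by
  rw [Complex.sin, neg_mul]
  linear_combination (Complex.exp (-(u * Complex.I)) - Complex.exp (u * Complex.I)) * Complex.I_sq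

lemma stokes1_mul_connD : stokes1 b θ₀ θs * connD b θ₀ θs 1 = connD b θ₀ θs 2 := by
  have hπ : (Real.pi : ℂ) ≠ 0 := Complex.ofReal_ne_zero.2 Real.pi_ne_zero
  have key : ∀ τ : ℂ, τ = 1 ∨ τ = -1 →
      -(2 * Complex.I * Real.pi) / (Complex.Gamma (1 / 2 - Complex.I * b * (θ₀ + θs)) *
        Complex.Gamma (1 / 2 + Complex.I * b * (θ₀ - θs))) * coeffD b θ₀ θs 1 0 τ +
      coeffD b θ₀ θs (-1) (-(1 / 2)) τ = coeffD b θ₀ θs (-1) (1 / 2) τ := by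
    intro τ hτ
    have hΓ : (Complex.Gamma (1 / 2 - Complex.I * b * (θ₀ + θs)))⁻¹ *
        (Complex.Gamma (1 / 2 + Complex.I * b * (θ₀ - θs)))⁻¹ =
        (Complex.Gamma (1 / 2 - Complex.I * b * (τ * θ₀ + θs)))⁻¹ *
        (Complex.Gamma (1 / 2 + Complex.I * b * (τ * θ₀ + -1 * θs)))⁻¹ := by
      rcases hτ with rfl | rfl
      · congr 3 <;> ring
      · rw [mul_comm]; congr 3 <;> ring
    have hc := inv_Gamma_half_mul (1 / 2 + Complex.I * b * (τ * θ₀ + 1 * θs))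
      (1 / 2 - Complex.I * b * (τ * θ₀ + θs)) (by ring)
    have hs := two_I_sin (Real.pi / 2 - Real.pi * (Complex.I * b * (τ * θ₀ + 1 * θs)))
    rw [Complex.sin_pi_div_two_sub] at hs
    rw [add_sub_cancel_left, eq_div_iff hπ] at hc
    rw [div_eq_mul_inv, mul_inv, hΓ, coeffD_eq, coeffD_eq, coeffD_eq,
      show -(2 * Real.pi * Complex.I * 0 * (1 / 2 + Complex.I * b * (1 * θs - τ * θ₀))) = 0 by ring,
      Complex.exp_zero,
      show -(2 * Real.pi * Complex.I * -(1 / 2) * (1 / 2 + Complex.I * b * (-1 * θs - τ * θ₀))) =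
        (Real.pi / 2 - Real.pi * (Complex.I * b * (τ * θ₀ + 1 * θs))) * Complex.I by ring,
      show -(2 * Real.pi * Complex.I * (1 / 2) * (1 / 2 + Complex.I * b * (-1 * θs - τ * θ₀))) =
        -((Real.pi / 2 - Real.pi * (Complex.I * b * (τ * θ₀ + 1 * θs))) * Complex.I) by ring]
    generalize Complex.Gamma (τ * (2 * Complex.I * b * θ₀)) = g
    generalize (Complex.Gamma (1 / 2 + Complex.I * b * (τ * θ₀ + -1 * θs)))⁻¹ = g'
    linear_combination -(2 * Complex.I * g * g') * hc - g * g' * hs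
  rw [stokes1, connD_one, connD_two, Matrix.mul_fin_two, one_mul (coeffD _ _ _ (-1) _ 1),
    one_mul (coeffD _ _ _ (-1) _ (-1)), key 1 (Or.inl rfl), key (-1) (Or.inr rfl)]
  simp

lemma stokes2_mul_connD : stokes2 b θ₀ θs * connD b θ₀ θs 2 = connD b θ₀ θs 3 := by
  have hπ : (Real.pi : ℂ) ≠ 0 := Complex.ofReal_ne_zero.2 Real.pi_ne_zero
  have key : ∀ τ : ℂ, τ = 1 ∨ τ = -1 →
      coeffD b θ₀ θs 1 0 τ + -(2 * Complex.I * Real.pi * Complex.exp (2 * Real.pi * b * θs)) /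
        (Complex.Gamma (1 / 2 - Complex.I * b * (θ₀ - θs)) *
          Complex.Gamma (1 / 2 + Complex.I * b * (θ₀ + θs))) * coeffD b θ₀ θs (-1) (1 / 2) τ =
      coeffD b θ₀ θs 1 1 τ := by
    intro τ hτ
    have hΓ : (Complex.Gamma (1 / 2 - Complex.I * b * (θ₀ - θs)))⁻¹ *
        (Complex.Gamma (1 / 2 + Complex.I * b * (θ₀ + θs)))⁻¹ =
        (Complex.Gamma (1 / 2 - Complex.I * b * (τ * θ₀ - θs)))⁻¹ *
        (Complex.Gamma (1 / 2 + Complex.I * b * (τ * θ₀ + 1 * θs)))⁻¹ := by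
      rcases hτ with rfl | rfl
      · congr 3 <;> ring
      · rw [mul_comm]; congr 3 <;> ring
    have hc := inv_Gamma_half_mul (1 / 2 + Complex.I * b * (τ * θ₀ + -1 * θs))
      (1 / 2 - Complex.I * b * (τ * θ₀ - θs)) (by ring)
    have hs := two_I_sin (Real.pi / 2 - Real.pi * (Complex.I * b * (τ * θ₀ + -1 * θs)))
    rw [Complex.sin_pi_div_two_sub] at hs
    rw [add_sub_cancel_left, eq_div_iff hπ] at hc
    have h1 : Complex.exp (-(2 * Real.pi * Complex.I * 1 *
        (1 / 2 + Complex.I * b * (1 * θs - τ * θ₀)))) =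
        Complex.exp (-((Real.pi / 2 - Real.pi * (Complex.I * b * (τ * θ₀ + -1 * θs))) *
          Complex.I)) *
        Complex.exp (-((Real.pi / 2 - Real.pi * (Complex.I * b * (τ * θ₀ + -1 * θs))) *
          Complex.I)) := by
      rw [← Complex.exp_add]; congr 1; ring
    have h2 : Complex.exp (2 * Real.pi * b * θs) *
        Complex.exp (-(2 * Real.pi * Complex.I * (1 / 2) *
          (1 / 2 + Complex.I * b * (-1 * θs - τ * θ₀)))) =
        Complex.exp (-((Real.pi / 2 - Real.pi * (Complex.I * b * (τ * θ₀ + -1 * θs))) *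
          Complex.I)) := by
      rw [← Complex.exp_add]; congr 1
      linear_combination 2 * Real.pi * b * θs * Complex.I_sq
    have h3 : Complex.exp (-((Real.pi / 2 - Real.pi * (Complex.I * b * (τ * θ₀ + -1 * θs))) *
        Complex.I)) *
        Complex.exp ((Real.pi / 2 - Real.pi * (Complex.I * b * (τ * θ₀ + -1 * θs))) *
          Complex.I) = 1 := by
      rw [← Complex.exp_add, neg_add_cancel, Complex.exp_zero]
    rw [div_eq_mul_inv, mul_inv, hΓ, coeffD_eq, coeffD_eq, coeffD_eq, h1,
      show -(2 * Real.pi * Complex.I * 0 * (1 / 2 + Complex.I * b * (1 * θs - τ * θ₀))) = 0 by ring,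
      Complex.exp_zero]
    generalize Complex.exp (-(2 * Real.pi * Complex.I * (1 / 2) *
          (1 / 2 + Complex.I * b * (-1 * θs - τ * θ₀)))) = e at *
    generalize Complex.exp (-((Real.pi / 2 - Real.pi * (Complex.I * b * (τ * θ₀ + -1 * θs))) *
        Complex.I)) = e₁ at *
    generalize Complex.exp ((Real.pi / 2 - Real.pi * (Complex.I * b * (τ * θ₀ + -1 * θs))) *
        Complex.I) = e₂ at *
    generalize Complex.Gamma (τ * (2 * Complex.I * b * θ₀)) = g
    generalize (Complex.Gamma (1 / 2 + Complex.I * b * (τ * θ₀ + 1 * θs)))⁻¹ = g'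
    generalize (Complex.Gamma (1 / 2 + Complex.I * b * (τ * θ₀ + -1 * θs)))⁻¹ = g₁ at *
    generalize (Complex.Gamma (1 / 2 - Complex.I * b * (τ * θ₀ - θs)))⁻¹ = g₂ at *
    linear_combination -(2 * Complex.I * g * g' * e₁) * hc - g * g' * e₁ * hs - g * g' * h3 -
      2 * Complex.I * Real.pi * g₂ * g' * g * g₁ * h2
  rw [stokes2, connD_two, connD_three, Matrix.mul_fin_two, one_mul (coeffD _ _ _ 1 _ 1),
    one_mul (coeffD _ _ _ 1 _ (-1)),     key 1 (Or.inl rfl), key (-1) (Or.inr rfl)]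
  simp

lemma det_connD_one_ne_zero (hθ₀ : ∀ m : ℤ, 2 * Complex.I * b * θ₀ ≠ m) :
    (connD b θ₀ θs 1).det ≠ 0 := by
  have hπ : (Real.pi : ℂ) ≠ 0 := Complex.ofReal_ne_zero.2 Real.pi_ne_zero
  have c1 := inv_Gamma_half_mul (1 / 2 + Complex.I * b * (1 * θ₀ + 1 * θs))
    (1 / 2 + Complex.I * b * (-1 * θ₀ + -1 * θs)) (by ring)
  have c2 := inv_Gamma_half_mul (1 / 2 + Complex.I * b * (1 * θ₀ + -1 * θs))
    (1 / 2 + Complex.I * b * (-1 * θ₀ + 1 * θs)) (by ring)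
  rw [add_sub_cancel_left] at c1 c2
  have t := exp_mul_sin_two_mul (Real.pi * (Complex.I * b * θs)) (Real.pi * (Complex.I * b * θ₀))
  rw [show 2 * (Real.pi * (Complex.I * b * θ₀)) = Real.pi * (2 * Complex.I * b * θ₀) by ring] at t
  have e1 : Complex.exp (-(2 * Real.pi * Complex.I * -(1 / 2) *
      (1 / 2 + Complex.I * b * (-1 * θs - -1 * θ₀)))) =
      Complex.exp (Real.pi * Complex.I * (1 / 2 - Complex.I * b * θs)) *
      Complex.exp (Real.pi * (Complex.I * b * θ₀) * Complex.I) := by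
    rw [← Complex.exp_add]; congr 1; ring
  have e2 : Complex.exp (-(2 * Real.pi * Complex.I * -(1 / 2) *
      (1 / 2 + Complex.I * b * (-1 * θs - 1 * θ₀)))) =
      Complex.exp (Real.pi * Complex.I * (1 / 2 - Complex.I * b * θs)) *
      Complex.exp (-(Real.pi * (Complex.I * b * θ₀)) * Complex.I) := by
    rw [← Complex.exp_add]; congr 1; ring
  have key : (connD b θ₀ θs 1).det = Complex.I / Real.pi *
      (Complex.Gamma (2 * Complex.I * b * θ₀) * Complex.Gamma (-(2 * Complex.I * b * θ₀))) *
      Complex.exp (Real.pi * Complex.I * (1 / 2 - Complex.I * b * θs)) *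
      (Complex.exp (Real.pi * (Complex.I * b * θs) * Complex.I) *
        Complex.sin (Real.pi * (2 * Complex.I * b * θ₀))) := by
    rw [connD_one, Matrix.det_fin_two_of, coeffD_eq, coeffD_eq, coeffD_eq, coeffD_eq, e1, e2, t,
      show ∀ u : ℂ, -(2 * Real.pi * Complex.I * 0 * u) = 0 by intro u; ring,
      show ∀ u : ℂ, -(2 * Real.pi * Complex.I * 0 * u) = 0 by intro u; ring, Complex.exp_zero,
      ← Complex.cos_neg (Real.pi * (Complex.I * b * θs) - _),
      show -(Real.pi * (Complex.I * b * θs) - Real.pi * (Complex.I * b * θ₀)) =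
        Real.pi * (Complex.I * b * (1 * θ₀ + -1 * θs)) by ring,
      show Real.pi * (Complex.I * b * θs) + Real.pi * (Complex.I * b * θ₀) =
        Real.pi * (Complex.I * b * (1 * θ₀ + 1 * θs)) by ring, one_mul (2 * Complex.I * b * θ₀),
      neg_one_mul (2 * Complex.I * b * θ₀)]
    generalize Complex.exp (Real.pi * Complex.I * (1 / 2 - Complex.I * b * θs)) = E
    generalize Complex.exp (Real.pi * (Complex.I * b * θ₀) * Complex.I) = x₁
    generalize Complex.exp (-(Real.pi * (Complex.I * b * θ₀)) * Complex.I) = x₂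
    generalize Complex.Gamma (2 * Complex.I * b * θ₀) = g₁
    generalize Complex.Gamma (-(2 * Complex.I * b * θ₀)) = g₂
    generalize Complex.cos (Real.pi * (Complex.I * b * (1 * θ₀ + -1 * θs))) = k₁ at *
    generalize Complex.cos (Real.pi * (Complex.I * b * (1 * θ₀ + 1 * θs))) = k₂ at *
    linear_combination E * g₁ * g₂ * x₁ * c1 - E * g₁ * g₂ * x₂ * c2 +
      g₁ * g₂ * E / Real.pi * (k₂ * x₁ - k₁ * x₂) * Complex.I_sq
  rw [key]
  have a1 := Gamma_ne_zero_of_ne_intCast hθ₀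
  have a2 : Complex.Gamma (-(2 * Complex.I * b * θ₀)) ≠ 0 :=
    Gamma_ne_zero_of_ne_intCast fun m h => hθ₀ (-m) (by push_cast; linear_combination -h)
  have a3 := sin_pi_mul_ne_zero hθ₀
  exact mul_ne_zero (mul_ne_zero (mul_ne_zero (div_ne_zero Complex.I_ne_zero hπ)
    (mul_ne_zero a1 a2)) (Complex.exp_ne_zero _)) (mul_ne_zero (Complex.exp_ne_zero _) a3)

lemma det_connD_two_ne_zero (hθ₀ : ∀ m : ℤ, 2 * Complex.I * b * θ₀ ≠ m) :
    (connD b θ₀ θs 2).det ≠ 0 := by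
  rw [← stokes1_mul_connD, Matrix.det_mul, stokes1, Matrix.det_fin_two_of]
  simpa using det_connD_one_ne_zero hθ₀

lemma isStokesMatrix_iff (hθ₀ : ∀ m : ℤ, 2 * Complex.I * b * θ₀ ≠ m) {n : ℤ}
    (hdet : (connD b θ₀ θs n).det ≠ 0) {S₀ : Matrix (Fin 2) (Fin 2) ℂ}
    (hS₀ : S₀ * connD b θ₀ θs n = connD b θ₀ θs (n + 1)) (S : Matrix (Fin 2) (Fin 2) ℂ) :
    IsStokesMatrix b θ₀ θs n S ↔ S = S₀ := by
  constructor
  · intro h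
    have hz : (S - S₀) * connD b θ₀ θs n = 0 := by
      refine eq_zero_of_mulVec_confX (θs := θs) hθ₀ fun s => ?_
      have := h s
      rw [confD_eq_connD_mulVec hθ₀, confD_eq_connD_mulVec hθ₀, Matrix.mulVec_mulVec] at this
      rw [Matrix.sub_mul, Matrix.sub_mulVec, hS₀, this, sub_self]
    have hz' := congrArg (· * (connD b θ₀ θs n)⁻¹) hz
    simp only [Matrix.mul_nonsing_inv_cancel_right _ _ hdet.isUnit, Matrix.zero_mul] at hz'
    exact sub_eq_zero.1 hz'
  · rintro rfl s
    rw [confD_eq_connD_mulVec hθ₀, confD_eq_connD_mulVec hθ₀, Matrix.mulVec_mulVec, hS₀]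

end

/-! ### Confluent limits -/

lemma log_exp_div {s X : ℂ} (hX : X ≠ 0) (h0 : 0 < (s - Complex.log X).im)
    (h1 : (s - Complex.log X).im < Real.pi) :
    0 < (Complex.exp s / X).im ∧ Complex.log (Complex.exp s / X) = s - Complex.log X := by
  have e : Complex.exp s / X = Complex.exp (s - Complex.log X) := by
    rw [Complex.exp_sub, Complex.exp_log hX]
  rw [e]
  refine ⟨?_, Complex.log_exp (by linarith [Real.pi_pos]) h1.le⟩
  rw [Complex.exp_im]
  exact mul_pos (Real.exp_pos _) (Real.sin_pos_of_pos_of_lt_pi h0 h1)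

lemma eventually_add_ne_intCast {ι : Type*} {l : Filter ι} {X : ι → ℂ}
    (hX : Tendsto (fun i => ‖X i‖) l atTop) (hre : ∀ i, (X i).re = 0) (v : ℂ) :
    ∀ᶠ i in l, ∀ m : ℤ, X i + v ≠ m := by
  filter_upwards [hX.eventually_gt_atTop |v.im|] with i hi m hm
  have him := congrArg Complex.im hm
  rw [Complex.add_im, Complex.intCast_im] at him
  have hn : ‖X i‖ = |(X i).im| := by
    rw [← Complex.re_add_im (X i), hre]
    simp
  rw [hn, eq_neg_of_add_eq_zero_left him, abs_neg] at hi
  exact lt_irrefl _ hi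

section

variable {ι : Type*} {l : Filter ι} {Λ : ι → ℂ} {b θ₀ θs ε : ℂ}

/-- The hypergeometric solutions at the origin have a confluent limit. -/
lemma tendsto_F0comp (hX : Tendsto (fun i => ‖Complex.I * b * Λ i‖) l atTop) {τ s : ℂ}
    (hc : ∀ k : ℕ, 1 - τ * (2 * Complex.I * b * θ₀) ≠ -k)
    (hlog : ∀ᶠ i in l, Complex.log (Complex.exp s / (Complex.I * b * Λ i)) =
      s - Complex.log (Complex.I * b * Λ i)) :
    Tendsto (fun i => Complex.exp (((b ^ 2 + 1) / 2 - τ * (Complex.I * b) * θ₀) *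
        Complex.log (Complex.I * b * Λ i)) *
      F0comp b θ₀ ((Λ i + θs) / 2) ((Λ i - θs) / 2) τ (Complex.exp s / (Complex.I * b * Λ i))) l
      (𝓝 (confXcomp b θ₀ θs τ s)) := by
  have h1 := tendsto_one_sub_div_cpow hX (Complex.exp s) (1 / 2)
    ((b ^ 2 + 1) / 2 + Complex.I * b * θs / 2)
  have h2 := tendsto_hypergeometric_confluent hX (1 / 2 + Complex.I * b * (-τ * θ₀))
    (1 / 2 + Complex.I * b * (-τ * θ₀ + θs)) hc (Complex.exp s)
  have h3 := (h1.mul h2).const_mul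
    (Complex.exp (((b ^ 2 + 1) / 2 - τ * (Complex.I * b) * θ₀) * s))
  rw [one_div_mul_eq_div, ← mul_assoc (Complex.exp _) (Complex.exp _) (kummerM _ _ _)] at h3
  refine h3.congr' ?_
  filter_upwards [hlog, (tendsto_div_nhds_zero hX (Complex.exp s)).eventually
    (Metric.ball_mem_nhds _ one_pos)] with i hi hball
  rw [F0comp, hi, ← gaussF_eq _ _ hc hball,
    show 1 / 2 + Complex.I * b * (-τ * θ₀ + (Λ i + θs) / 2 + (Λ i - θs) / 2) =
      1 / 2 + Complex.I * b * (-τ * θ₀) + Complex.I * b * Λ i by ring,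
    show 1 / 2 + Complex.I * b * (-τ * θ₀ + (Λ i + θs) / 2 - (Λ i - θs) / 2) =
      1 / 2 + Complex.I * b * (-τ * θ₀ + θs) by ring,
    show (b ^ 2 + 1) / 2 + Complex.I * b * ((Λ i + θs) / 2) =
      1 / 2 * (Complex.I * b * Λ i) + ((b ^ 2 + 1) / 2 + Complex.I * b * θs / 2) by ring,
    mul_sub, Complex.exp_sub]
  have := Complex.exp_ne_zero (((b ^ 2 + 1) / 2 - τ * (Complex.I * b) * θ₀) *
    Complex.log (Complex.I * b * Λ i))
  field_simp

lemma tendsto_Gamma_quotient {Y : ι → ℂ} (hY : Tendsto (fun i => ‖Y i‖) l atTop)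
    (hre : ∀ i, (Y i).re = 0) (p q : ℂ) :
    Tendsto (fun i => Complex.Gamma (Y i + p) / Complex.Gamma (Y i + q) *
      Complex.exp (Complex.log (Y i) * (q - p))) l (𝓝 1) := by
  refine (tendsto_Gamma_div_Gamma hY (fun i => (hre i).ge) p q).congr' ?_
  filter_upwards [hY.eventually_gt_atTop 0] with i hi
  rw [Complex.cpow_def_of_ne_zero (norm_pos_iff.1 hi)]

/-- The renormalized coefficient of `F^1_σ` in the basis at the origin. -/
noncomputable def scaledCoeff1 (b θ₀ θs Λ σ τ : ℂ) : ℂ :=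
  Qnorm b θs Λ σ * coeff1 b θ₀ ((Λ + θs) / 2) ((Λ - θs) / 2) σ τ *
    Complex.exp (-(((b ^ 2 + 1) / 2 - τ * (Complex.I * b) * θ₀) * Complex.log (Complex.I * b * Λ)))

/-- The renormalized coefficient of `F^∞_σ` in the basis at the origin. -/
noncomputable def scaledCoeffInf (b θ₀ θs Λ σ τ : ℂ) : ℂ :=
  Qnorm b θs Λ σ * coeffInf b θ₀ ((Λ + θs) / 2) ((Λ - θs) / 2) σ τ *
    Complex.exp (-(((b ^ 2 + 1) / 2 - τ * (Complex.I * b) * θ₀) * Complex.log (Complex.I * b * Λ)))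

/-- The exponential `exp(πb(θs + Λ)/2)` in `Q_+` cancels the one in the coefficient of `F^1_+`.
What is left depends on `Λ` through `Γ(X + p) / Γ(X + q)` and a power of `X = ibΛ`. -/
lemma tendsto_scaledCoeff1_one (hb : b ≠ 0)
    (hX : Tendsto (fun i => ‖Complex.I * b * Λ i‖) l atTop)
    (hre : ∀ i, (Complex.I * b * Λ i).re = 0) (τ : ℂ) :
    Tendsto (fun i => scaledCoeff1 b θ₀ θs (Λ i) 1 τ) l (𝓝 (coeffD b θ₀ θs 1 0 τ)) := by
  have h := (tendsto_Gamma_quotient hX hre (1 + Complex.I * b * θs)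
    (1 / 2 + Complex.I * b * (τ * θ₀))).const_mul (coeffD b θ₀ θs 1 0 τ)
  rw [mul_one] at h
  refine h.congr' ?_
  filter_upwards [hX.eventually_gt_atTop 0] with i hi
  rw [scaledCoeff1, Qnorm, coeff1, coeffD, mul_assoc Complex.I (Real.pi : ℂ) b,
    mul_assoc Complex.I _ (Q b), mul_assoc (Real.pi : ℂ) b, b_mul_Q hb,
    Complex.cpow_def_of_ne_zero (norm_pos_iff.1 hi)]
  rw [show 1 + 1 * (2 * Complex.I * b * ((Λ i + θs) / 2)) =
      Complex.I * b * Λ i + (1 + Complex.I * b * θs) by ring,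
    show 1 / 2 + Complex.I * b * (τ * θ₀ + 1 * ((Λ i + θs) / 2) + (Λ i - θs) / 2) =
      Complex.I * b * Λ i + (1 / 2 + Complex.I * b * (τ * θ₀)) by ring,
    show 1 / 2 + Complex.I * b * (τ * θ₀ + 1 * ((Λ i + θs) / 2) - (Λ i - θs) / 2) =
      1 / 2 + Complex.I * b * (τ * θ₀ + 1 * θs) by ring]
  have x : Complex.exp (-(2 * Real.pi * Complex.I * 0 *
        (1 / 2 + Complex.I * b * (1 * θs - τ * θ₀)))) *
      Complex.exp (Complex.log (Complex.I * b * Λ i) *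
        (1 / 2 + Complex.I * b * (τ * θ₀) - (1 + Complex.I * b * θs))) =
      Complex.exp (-(Complex.I * (Real.pi * (b ^ 2 + 1)) / 2)) *
        Complex.exp (1 * (Real.pi * b / 2) * (θs + Λ i)) *
        Complex.exp (Complex.log (Complex.I * b * Λ i) * (b / 2 * (b - 1 * 2 * Complex.I * θs))) *
        Complex.exp (Real.pi * Complex.I *
          ((b ^ 2 + 1) / 2 + 1 * (Complex.I * b) * ((Λ i + θs) / 2))) *
        Complex.exp (-(((b ^ 2 + 1) / 2 - τ * (Complex.I * b) * θ₀) *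
          Complex.log (Complex.I * b * Λ i))) := by
    simp only [← Complex.exp_add]
    congr 1
    linear_combination -(Real.pi * b / 2 * (Λ i + θs)) * Complex.I_sq
  generalize Complex.Gamma (τ * (2 * Complex.I * b * θ₀)) = g₀
  generalize Complex.Gamma (Complex.I * b * Λ i + (1 + Complex.I * b * θs)) = g₁
  generalize Complex.Gamma (Complex.I * b * Λ i + (1 / 2 + Complex.I * b * (τ * θ₀))) = g₂
  generalize Complex.Gamma (1 / 2 + Complex.I * b * (τ * θ₀ + 1 * θs)) = g₃
  linear_combination g₀ / g₃ * (g₁ / g₂) * x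

/-- Here the Gamma functions are those of `-X`, where `X = ibΛ`. The sign `ε` of `Im X` enters through
`log (-X) = log X - iπε`, and becomes half a turn in the Whittaker function of the limit. -/
lemma tendsto_scaledCoeff1_neg_one (hb : b ≠ 0)
    (hX : Tendsto (fun i => ‖Complex.I * b * Λ i‖) l atTop)
    (hre : ∀ i, (Complex.I * b * Λ i).re = 0)
    (hε : ∀ᶠ i in l, Complex.log (-(Complex.I * b * Λ i)) =
      Complex.log (Complex.I * b * Λ i) - Real.pi * Complex.I * ε) (τ : ℂ) :
    Tendsto (fun i => scaledCoeff1 b θ₀ θs (Λ i) (-1) τ) l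
      (𝓝 (coeffD b θ₀ θs (-1) (ε / 2) τ)) := by
  have h := (tendsto_Gamma_quotient (Y := fun i => -(Complex.I * b * Λ i)) (by simpa using hX)
    (fun i => by rw [Complex.neg_re, hre, neg_zero]) (1 - Complex.I * b * θs)
    (1 / 2 + Complex.I * b * (τ * θ₀))).const_mul (coeffD b θ₀ θs (-1) (ε / 2) τ)
  rw [mul_one] at h
  refine h.congr' ?_
  filter_upwards [hX.eventually_gt_atTop 0, hε] with i hi hlog
  rw [scaledCoeff1, Qnorm, coeff1, coeffD, mul_assoc Complex.I (Real.pi : ℂ) b,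
    mul_assoc Complex.I _ (Q b), mul_assoc (Real.pi : ℂ) b, b_mul_Q hb,
    Complex.cpow_def_of_ne_zero (norm_pos_iff.1 hi), hlog]
  rw [show 1 + -1 * (2 * Complex.I * b * ((Λ i + θs) / 2)) =
      -(Complex.I * b * Λ i) + (1 - Complex.I * b * θs) by ring,
    show 1 / 2 + Complex.I * b * (τ * θ₀ + -1 * ((Λ i + θs) / 2) + (Λ i - θs) / 2) =
      1 / 2 + Complex.I * b * (τ * θ₀ + -1 * θs) by ring,
    show 1 / 2 + Complex.I * b * (τ * θ₀ + -1 * ((Λ i + θs) / 2) - (Λ i - θs) / 2) =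
      -(Complex.I * b * Λ i) + (1 / 2 + Complex.I * b * (τ * θ₀)) by ring]
  have x : Complex.exp (-(2 * Real.pi * Complex.I * (ε / 2) *
        (1 / 2 + Complex.I * b * (-1 * θs - τ * θ₀)))) *
      Complex.exp ((Complex.log (Complex.I * b * Λ i) - Real.pi * Complex.I * ε) *
        (1 / 2 + Complex.I * b * (τ * θ₀) - (1 - Complex.I * b * θs))) =
      Complex.exp (-(Complex.I * (Real.pi * (b ^ 2 + 1)) / 2)) *
        Complex.exp (-1 * (Real.pi * b / 2) * (θs + Λ i)) *
        Complex.exp (Complex.log (Complex.I * b * Λ i) * (b / 2 * (b - -1 * 2 * Complex.I * θs))) *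
        Complex.exp (Real.pi * Complex.I *
          ((b ^ 2 + 1) / 2 + -1 * (Complex.I * b) * ((Λ i + θs) / 2))) *
        Complex.exp (-(((b ^ 2 + 1) / 2 - τ * (Complex.I * b) * θ₀) *
          Complex.log (Complex.I * b * Λ i))) := by
    simp only [← Complex.exp_add]
    congr 1
    linear_combination (Real.pi * b / 2 * (Λ i + θs)) * Complex.I_sq
  generalize Complex.Gamma (τ * (2 * Complex.I * b * θ₀)) = g₀
  generalize Complex.Gamma (-(Complex.I * b * Λ i) + (1 - Complex.I * b * θs)) = g₁
  generalize Complex.Gamma (-(Complex.I * b * Λ i) + (1 / 2 + Complex.I * b * (τ * θ₀))) = g₂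
  generalize Complex.Gamma (1 / 2 + Complex.I * b * (τ * θ₀ + -1 * θs)) = g₃
  linear_combination g₀ / g₃ * (g₁ / g₂) * x

/-- The Gamma functions are those of `-X`, where `X = ibΛ`; the limit is on the sheet `0` or `1` of the
Whittaker function according to the sign `ε` of `Im X`. -/
lemma tendsto_scaledCoeffInf_one (hb : b ≠ 0)
    (hX : Tendsto (fun i => ‖Complex.I * b * Λ i‖) l atTop)
    (hre : ∀ i, (Complex.I * b * Λ i).re = 0)
    (hε : ∀ᶠ i in l, Complex.log (-(Complex.I * b * Λ i)) =
      Complex.log (Complex.I * b * Λ i) - Real.pi * Complex.I * ε) (τ : ℂ) :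
    Tendsto (fun i => scaledCoeffInf b θ₀ θs (Λ i) 1 τ) l
      (𝓝 (coeffD b θ₀ θs 1 ((1 + ε) / 2) τ)) := by
  have h := (tendsto_Gamma_quotient (Y := fun i => -(Complex.I * b * Λ i)) (by simpa using hX)
    (fun i => by rw [Complex.neg_re, hre, neg_zero]) (1 + Complex.I * b * θs)
    (1 / 2 + Complex.I * b * (τ * θ₀))).const_mul (coeffD b θ₀ θs 1 ((1 + ε) / 2) τ)
  rw [mul_one] at h
  refine h.congr' ?_
  filter_upwards [hX.eventually_gt_atTop 0, hε] with i hi hlog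
  rw [scaledCoeffInf, Qnorm, coeffInf, coeffD, mul_assoc Complex.I (Real.pi : ℂ) b,
    mul_assoc Complex.I _ (Q b), mul_assoc (Real.pi : ℂ) b, b_mul_Q hb,
    Complex.cpow_def_of_ne_zero (norm_pos_iff.1 hi), hlog]
  rw [show 1 - 1 * (2 * Complex.I * b * ((Λ i - θs) / 2)) =
      -(Complex.I * b * Λ i) + (1 + Complex.I * b * θs) by ring,
    show 1 / 2 + Complex.I * b * (τ * θ₀ + (Λ i + θs) / 2 - 1 * ((Λ i - θs) / 2)) =
      1 / 2 + Complex.I * b * (τ * θ₀ + 1 * θs) by ring,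
    show 1 / 2 + Complex.I * b * (τ * θ₀ - (Λ i + θs) / 2 - 1 * ((Λ i - θs) / 2)) =
      -(Complex.I * b * Λ i) + (1 / 2 + Complex.I * b * (τ * θ₀)) by ring]
  have x : Complex.exp (-(2 * Real.pi * Complex.I * ((1 + ε) / 2) *
        (1 / 2 + Complex.I * b * (1 * θs - τ * θ₀)))) *
      Complex.exp ((Complex.log (Complex.I * b * Λ i) - Real.pi * Complex.I * ε) *
        (1 / 2 + Complex.I * b * (τ * θ₀) - (1 + Complex.I * b * θs))) =
      Complex.exp (-(Complex.I * (Real.pi * (b ^ 2 + 1)) / 2)) *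
        Complex.exp (1 * (Real.pi * b / 2) * (θs + Λ i)) *
        Complex.exp (Complex.log (Complex.I * b * Λ i) * (b / 2 * (b - 1 * 2 * Complex.I * θs))) *
        Complex.exp (Real.pi * Complex.I *
          (b ^ 2 / 2 + τ * (Complex.I * b) * θ₀ + 1 * (Complex.I * b) * ((Λ i - θs) / 2))) *
        Complex.exp (-(((b ^ 2 + 1) / 2 - τ * (Complex.I * b) * θ₀) *
          Complex.log (Complex.I * b * Λ i))) := by
    simp only [← Complex.exp_add]
    congr 1
    linear_combination -(Real.pi * b / 2 * (Λ i + θs)) * Complex.I_sq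
  generalize Complex.Gamma (τ * (2 * Complex.I * b * θ₀)) = g₀
  generalize Complex.Gamma (-(Complex.I * b * Λ i) + (1 + Complex.I * b * θs)) = g₁
  generalize Complex.Gamma (-(Complex.I * b * Λ i) + (1 / 2 + Complex.I * b * (τ * θ₀))) = g₂
  generalize Complex.Gamma (1 / 2 + Complex.I * b * (τ * θ₀ + 1 * θs)) = g₃
  linear_combination g₀ / g₃ * (g₁ / g₂) * x

lemma tendsto_scaledCoeffInf_neg_one (hb : b ≠ 0)
    (hX : Tendsto (fun i => ‖Complex.I * b * Λ i‖) l atTop)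
    (hre : ∀ i, (Complex.I * b * Λ i).re = 0) (τ : ℂ) :
    Tendsto (fun i => scaledCoeffInf b θ₀ θs (Λ i) (-1) τ) l
      (𝓝 (coeffD b θ₀ θs (-1) (1 / 2) τ)) := by
  have h := (tendsto_Gamma_quotient hX hre (1 - Complex.I * b * θs)
    (1 / 2 + Complex.I * b * (τ * θ₀))).const_mul (coeffD b θ₀ θs (-1) (1 / 2) τ)
  rw [mul_one] at h
  refine h.congr' ?_
  filter_upwards [hX.eventually_gt_atTop 0] with i hi
  rw [scaledCoeffInf, Qnorm, coeffInf, coeffD, mul_assoc Complex.I (Real.pi : ℂ) b,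
    mul_assoc Complex.I _ (Q b), mul_assoc (Real.pi : ℂ) b, b_mul_Q hb,
    Complex.cpow_def_of_ne_zero (norm_pos_iff.1 hi)]
  rw [show 1 - -1 * (2 * Complex.I * b * ((Λ i - θs) / 2)) =
      Complex.I * b * Λ i + (1 - Complex.I * b * θs) by ring,
    show 1 / 2 + Complex.I * b * (τ * θ₀ + (Λ i + θs) / 2 - -1 * ((Λ i - θs) / 2)) =
      Complex.I * b * Λ i + (1 / 2 + Complex.I * b * (τ * θ₀)) by ring,
    show 1 / 2 + Complex.I * b * (τ * θ₀ - (Λ i + θs) / 2 - -1 * ((Λ i - θs) / 2)) =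
      1 / 2 + Complex.I * b * (τ * θ₀ + -1 * θs) by ring]
  have x : Complex.exp (-(2 * Real.pi * Complex.I * (1 / 2) *
        (1 / 2 + Complex.I * b * (-1 * θs - τ * θ₀)))) *
      Complex.exp (Complex.log (Complex.I * b * Λ i) *
        (1 / 2 + Complex.I * b * (τ * θ₀) - (1 - Complex.I * b * θs))) =
      Complex.exp (-(Complex.I * (Real.pi * (b ^ 2 + 1)) / 2)) *
        Complex.exp (-1 * (Real.pi * b / 2) * (θs + Λ i)) *
        Complex.exp (Complex.log (Complex.I * b * Λ i) * (b / 2 * (b - -1 * 2 * Complex.I * θs))) *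
        Complex.exp (Real.pi * Complex.I *
          (b ^ 2 / 2 + τ * (Complex.I * b) * θ₀ + -1 * (Complex.I * b) * ((Λ i - θs) / 2))) *
        Complex.exp (-(((b ^ 2 + 1) / 2 - τ * (Complex.I * b) * θ₀) *
          Complex.log (Complex.I * b * Λ i))) := by
    simp only [← Complex.exp_add]
    congr 1
    linear_combination (Real.pi * b / 2 * (Λ i + θs)) * Complex.I_sq
  generalize Complex.Gamma (τ * (2 * Complex.I * b * θ₀)) = g₀
  generalize Complex.Gamma (Complex.I * b * Λ i + (1 - Complex.I * b * θs)) = g₁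
  generalize Complex.Gamma (Complex.I * b * Λ i + (1 / 2 + Complex.I * b * (τ * θ₀))) = g₂
  generalize Complex.Gamma (1 / 2 + Complex.I * b * (τ * θ₀ + -1 * θs)) = g₃
  linear_combination g₀ / g₃ * (g₁ / g₂) * x

end

/-! ### Limits of the bases and of the connection matrix -/

/-- The matrix `N_∞ C_{10}`, with columns scaled by powers of `ibΛ`. -/
noncomputable def scaledConn10 (b θ₀ θs Λ : ℂ) : Matrix (Fin 2) (Fin 2) ℂ :=
  !![scaledCoeff1 b θ₀ θs Λ 1 1, scaledCoeff1 b θ₀ θs Λ 1 (-1);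
    scaledCoeff1 b θ₀ θs Λ (-1) 1, scaledCoeff1 b θ₀ θs Λ (-1) (-1)]

/-- The matrix `N_∞ C_{∞0}`, with columns scaled by powers of `ibΛ`. -/
noncomputable def scaledConnInf0 (b θ₀ θs Λ : ℂ) : Matrix (Fin 2) (Fin 2) ℂ :=
  !![scaledCoeffInf b θ₀ θs Λ 1 1, scaledCoeffInf b θ₀ θs Λ 1 (-1);
    scaledCoeffInf b θ₀ θs Λ (-1) 1, scaledCoeffInf b θ₀ θs Λ (-1) (-1)]

/-- The basis at `z = 0`, scaled by powers of `ibΛ`. -/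
noncomputable def scaledF0 (b θ₀ θs Λ z : ℂ) : Fin 2 → ℂ :=
  ![Complex.exp (((b ^ 2 + 1) / 2 - 1 * (Complex.I * b) * θ₀) *
      Complex.log (Complex.I * b * Λ)) * F0comp b θ₀ ((Λ + θs) / 2) ((Λ - θs) / 2) 1 z,
    Complex.exp (((b ^ 2 + 1) / 2 - -1 * (Complex.I * b) * θ₀) *
      Complex.log (Complex.I * b * Λ)) * F0comp b θ₀ ((Λ + θs) / 2) ((Λ - θs) / 2) (-1) z]

/-- The diagonal matrix of the powers of `ibΛ` that scale the basis at `z = 0`. -/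
noncomputable def scaling (b θ₀ Λ : ℂ) : Matrix (Fin 2) (Fin 2) ℂ :=
  Matrix.diagonal
    ![Complex.exp (-(((b ^ 2 + 1) / 2 - 1 * (Complex.I * b) * θ₀) *
      Complex.log (Complex.I * b * Λ))),
    Complex.exp (-(((b ^ 2 + 1) / 2 - -1 * (Complex.I * b) * θ₀) *
      Complex.log (Complex.I * b * Λ)))]

section

variable {b θ₀ θs : ℂ}

lemma scaledConn10_eq (Λ : ℂ) : scaledConn10 b θ₀ θs Λ =
    Ninf b θs Λ * conn10 b θ₀ ((Λ + θs) / 2) ((Λ - θs) / 2) * scaling b θ₀ Λ := by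
  ext i j
  rw [scaling, Matrix.mul_diagonal, Ninf, Matrix.diagonal_mul]
  fin_cases i <;> fin_cases j <;> rfl

lemma scaledConnInf0_eq (Λ : ℂ) : scaledConnInf0 b θ₀ θs Λ =
    Ninf b θs Λ * connInf0 b θ₀ ((Λ + θs) / 2) ((Λ - θs) / 2) * scaling b θ₀ Λ := by
  ext i j
  rw [scaling, Matrix.mul_diagonal, Ninf, Matrix.diagonal_mul]
  fin_cases i <;> fin_cases j <;> rfl

lemma F0_eq_scaling_mulVec (Λ z : ℂ) : F0 b θ₀ ((Λ + θs) / 2) ((Λ - θs) / 2) z =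
    scaling b θ₀ Λ *ᵥ scaledF0 b θ₀ θs Λ z := by
  have h : ∀ x y : ℂ, y = Complex.exp (-x) * (Complex.exp x * y) := fun x y => by
    rw [← mul_assoc, ← Complex.exp_add, neg_add_cancel, Complex.exp_zero, one_mul]
  ext i
  rw [scaling, Matrix.mulVec_diagonal]
  fin_cases i
  · exact h _ _
  · exact h _ _

lemma F1Tilde_eq (hb : b ≠ 0) (hθ₀ : ∀ m : ℤ, 2 * Complex.I * b * θ₀ ≠ m) {Λ : ℂ}
    (h₁ : ∀ m : ℤ, 2 * Complex.I * b * ((Λ + θs) / 2) ≠ m) {z : ℂ} (hz : 0 < z.im) :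
    F1Tilde b θ₀ θs z Λ = scaledConn10 b θ₀ θs Λ *ᵥ scaledF0 b θ₀ θs Λ z := by
  rw [F1Tilde, F1_eq_conn10_mulVec hb hθ₀ (one_add_ne_neg_nat h₁) (one_sub_ne_neg_nat h₁) hz,
    F0_eq_scaling_mulVec, scaledConn10_eq, Matrix.mulVec_mulVec, Matrix.mulVec_mulVec]

lemma FInfTilde_eq (hb : b ≠ 0) (hθ₀ : ∀ m : ℤ, 2 * Complex.I * b * θ₀ ≠ m) {Λ : ℂ}
    (h₂ : ∀ m : ℤ, 2 * Complex.I * b * ((Λ - θs) / 2) ≠ m) {z : ℂ} (hz : 0 < z.im) :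
    FInfTilde b θ₀ θs z Λ = scaledConnInf0 b θ₀ θs Λ *ᵥ scaledF0 b θ₀ θs Λ z := by
  rw [FInfTilde, FInf_eq_connInf0_mulVec hb hθ₀ (one_add_ne_neg_nat h₂) (one_sub_ne_neg_nat h₂) hz,
    F0_eq_scaling_mulVec, scaledConnInf0_eq, Matrix.mulVec_mulVec, Matrix.mulVec_mulVec]

lemma connInf1Tilde_mul_scaledConn10 (hb : b ≠ 0) {Λ : ℂ} (hΛ : Λ ≠ 0)
    (h₁ : ∀ m : ℤ, 2 * Complex.I * b * ((Λ + θs) / 2) ≠ m) :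
    connInf1Tilde b θ₀ θs Λ * scaledConn10 b θ₀ θs Λ = scaledConnInf0 b θ₀ θs Λ := by
  rw [scaledConn10_eq, scaledConnInf0_eq, connInf1Tilde, ← connInf1_mul_conn10 h₁,
    ← Matrix.mul_assoc, ← Matrix.mul_assoc,
    Matrix.nonsing_inv_mul_cancel_right _ _ (isUnit_det_Ninf hb hΛ), Matrix.mul_assoc (Ninf _ _ _)]

end

lemma tendsto_matrix_fin_two {ι : Type*} {l : Filter ι} {a b c d : ι → ℂ} {a' b' c' d' : ℂ}
    (ha : Tendsto a l (𝓝 a')) (hb : Tendsto b l (𝓝 b')) (hc : Tendsto c l (𝓝 c'))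
    (hd : Tendsto d l (𝓝 d')) :
    Tendsto (fun i => !![a i, b i; c i, d i]) l (𝓝 !![a', b'; c', d']) := by
  refine tendsto_pi_nhds.2 fun i => tendsto_pi_nhds.2 fun j => ?_
  fin_cases i <;> fin_cases j
  exacts [ha, hb, hc, hd]

lemma tendsto_vec_fin_two {ι : Type*} {l : Filter ι} {a b : ι → ℂ} {a' b' : ℂ}
    (ha : Tendsto a l (𝓝 a')) (hb : Tendsto b l (𝓝 b')) :
    Tendsto (fun i => ![a i, b i]) l (𝓝 ![a', b']) := by
  refine tendsto_pi_nhds.2 fun i => ?_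
  fin_cases i
  exacts [ha, hb]

lemma tendsto_mulVec {ι : Type*} {l : Filter ι} {M : ι → Matrix (Fin 2) (Fin 2) ℂ}
    {v : ι → Fin 2 → ℂ} {M' : Matrix (Fin 2) (Fin 2) ℂ} {v' : Fin 2 → ℂ}
    (hM : Tendsto M l (𝓝 M')) (hv : Tendsto v l (𝓝 v')) :
    Tendsto (fun i => M i *ᵥ v i) l (𝓝 (M' *ᵥ v')) := by
  refine tendsto_pi_nhds.2 fun k => ?_
  simp only [Matrix.mulVec, dotProduct]
  exact tendsto_finsetSum _ fun m _ =>
    ((tendsto_pi_nhds.1 (tendsto_pi_nhds.1 hM k) m)).mul (tendsto_pi_nhds.1 hv m)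

/-- The limit of the solution `C i` of `C i * A i = B i`. -/
lemma tendsto_of_mul_eq {ι : Type*} {l : Filter ι} {A B C : ι → Matrix (Fin 2) (Fin 2) ℂ}
    {A' B' C' : Matrix (Fin 2) (Fin 2) ℂ} (hA : Tendsto A l (𝓝 A')) (hB : Tendsto B l (𝓝 B'))
    (hdet : A'.det ≠ 0) (h : ∀ᶠ i in l, C i * A i = B i) (h' : C' * A' = B') :
    Tendsto C l (𝓝 C') := by
  have hd : Tendsto (fun i => (A i).det) l (𝓝 A'.det) := by
    have hc : Continuous fun M : Matrix (Fin 2) (Fin 2) ℂ => M.det :=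
      Continuous.matrix_det continuous_id
    exact (hc.tendsto A').comp hA
  have hadj : Tendsto (fun i => (A i).adjugate) l (𝓝 A'.adjugate) := by
    have hc : Continuous fun M : Matrix (Fin 2) (Fin 2) ℂ => M.adjugate :=
      Continuous.matrix_adjugate continuous_id
    exact (hc.tendsto A').comp hA
  have hinv : Tendsto (fun i => (A i)⁻¹) l (𝓝 A'⁻¹) := by
    simp only [Matrix.inv_def, Ring.inverse_eq_inv']
    exact (hd.inv₀ hdet).smul hadj
  have hlim : Tendsto (fun i => B i * (A i)⁻¹) l (𝓝 (B' * A'⁻¹)) := by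
    refine tendsto_pi_nhds.2 fun j => tendsto_pi_nhds.2 fun k => ?_
    simp only [Matrix.mul_apply]
    exact tendsto_finsetSum _ fun m _ =>
      (tendsto_pi_nhds.1 (tendsto_pi_nhds.1 hB j) m).mul
        (tendsto_pi_nhds.1 (tendsto_pi_nhds.1 hinv m) k)
  rw [← h', Matrix.mul_nonsing_inv_cancel_right _ _ hdet.isUnit] at hlim
  refine hlim.congr' ?_
  filter_upwards [h, hd.eventually (eventually_ne_nhds hdet)] with i hi hdi
  rw [← hi, Matrix.mul_nonsing_inv_cancel_right _ _ hdi.isUnit]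

section

variable {ι : Type*} {l : Filter ι} {Λ : ι → ℂ} {b θ₀ θs ε : ℂ}

lemma tendsto_scaledConn10 (hb : b ≠ 0) (hX : Tendsto (fun i => ‖Complex.I * b * Λ i‖) l atTop)
    (hre : ∀ i, (Complex.I * b * Λ i).re = 0)
    (hε : ∀ᶠ i in l, Complex.log (-(Complex.I * b * Λ i)) =
      Complex.log (Complex.I * b * Λ i) - Real.pi * Complex.I * ε) :
    Tendsto (fun i => scaledConn10 b θ₀ θs (Λ i)) l
      (𝓝 !![coeffD b θ₀ θs 1 0 1, coeffD b θ₀ θs 1 0 (-1);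
        coeffD b θ₀ θs (-1) (ε / 2) 1, coeffD b θ₀ θs (-1) (ε / 2) (-1)]) :=
  tendsto_matrix_fin_two (tendsto_scaledCoeff1_one hb hX hre 1)
    (tendsto_scaledCoeff1_one hb hX hre (-1)) (tendsto_scaledCoeff1_neg_one hb hX hre hε 1)
    (tendsto_scaledCoeff1_neg_one hb hX hre hε (-1))

lemma tendsto_scaledConnInf0 (hb : b ≠ 0) (hX : Tendsto (fun i => ‖Complex.I * b * Λ i‖) l atTop)
    (hre : ∀ i, (Complex.I * b * Λ i).re = 0)
    (hε : ∀ᶠ i in l, Complex.log (-(Complex.I * b * Λ i)) =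
      Complex.log (Complex.I * b * Λ i) - Real.pi * Complex.I * ε) :
    Tendsto (fun i => scaledConnInf0 b θ₀ θs (Λ i)) l
      (𝓝 !![coeffD b θ₀ θs 1 ((1 + ε) / 2) 1, coeffD b θ₀ θs 1 ((1 + ε) / 2) (-1);
        coeffD b θ₀ θs (-1) (1 / 2) 1, coeffD b θ₀ θs (-1) (1 / 2) (-1)]) :=
  tendsto_matrix_fin_two (tendsto_scaledCoeffInf_one hb hX hre hε 1)
    (tendsto_scaledCoeffInf_one hb hX hre hε (-1)) (tendsto_scaledCoeffInf_neg_one hb hX hre 1)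
    (tendsto_scaledCoeffInf_neg_one hb hX hre (-1))

lemma eventually_two_mul_ne_intCast (hX : Tendsto (fun i => ‖Complex.I * b * Λ i‖) l atTop)
    (hre : ∀ i, (Complex.I * b * Λ i).re = 0) (v : ℂ) :
    ∀ᶠ i in l, ∀ m : ℤ, 2 * Complex.I * b * ((Λ i + v) / 2) ≠ m := by
  filter_upwards [eventually_add_ne_intCast hX hre (Complex.I * b * v)] with i hi m hm
  exact hi m (by linear_combination hm)

lemma tendsto_scaledF0 (hX : Tendsto (fun i => ‖Complex.I * b * Λ i‖) l atTop)
    (hθ₀ : ∀ m : ℤ, 2 * Complex.I * b * θ₀ ≠ m) {s : ℂ}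
    (hlog : ∀ᶠ i in l, Complex.log (Complex.exp s / (Complex.I * b * Λ i)) =
      s - Complex.log (Complex.I * b * Λ i)) :
    Tendsto (fun i => scaledF0 b θ₀ θs (Λ i) (Complex.exp s / (Complex.I * b * Λ i))) l
      (𝓝 (confX b θ₀ θs s)) :=
  tendsto_vec_fin_two
    (tendsto_F0comp hX (by simpa using one_sub_ne_neg_nat hθ₀) hlog)
    (tendsto_F0comp hX (by simpa using one_add_ne_neg_nat hθ₀) hlog)

lemma tendsto_F1Tilde (hb : b ≠ 0) (hθ₀ : ∀ m : ℤ, 2 * Complex.I * b * θ₀ ≠ m)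
    (hX : Tendsto (fun i => ‖Complex.I * b * Λ i‖) l atTop)
    (hre : ∀ i, (Complex.I * b * Λ i).re = 0) {s : ℂ} {M : Matrix (Fin 2) (Fin 2) ℂ}
    (hM : Tendsto (fun i => scaledConn10 b θ₀ θs (Λ i)) l (𝓝 M))
    (hs : ∀ᶠ i in l, 0 < (Complex.exp s / (Complex.I * b * Λ i)).im ∧
      Complex.log (Complex.exp s / (Complex.I * b * Λ i)) =
        s - Complex.log (Complex.I * b * Λ i)) :
    Tendsto (fun i => F1Tilde b θ₀ θs (Complex.exp s / (Complex.I * b * Λ i)) (Λ i)) l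
      (𝓝 (M *ᵥ confX b θ₀ θs s)) := by
  refine (tendsto_mulVec hM (tendsto_scaledF0 hX hθ₀ (hs.mono fun _ h => h.2))).congr' ?_
  filter_upwards [hs, eventually_two_mul_ne_intCast hX hre θs] with i hi h₁
  rw [F1Tilde_eq hb hθ₀ h₁ hi.1]

lemma tendsto_FInfTilde (hb : b ≠ 0) (hθ₀ : ∀ m : ℤ, 2 * Complex.I * b * θ₀ ≠ m)
    (hX : Tendsto (fun i => ‖Complex.I * b * Λ i‖) l atTop)
    (hre : ∀ i, (Complex.I * b * Λ i).re = 0) {s : ℂ} {M : Matrix (Fin 2) (Fin 2) ℂ}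
    (hM : Tendsto (fun i => scaledConnInf0 b θ₀ θs (Λ i)) l (𝓝 M))
    (hs : ∀ᶠ i in l, 0 < (Complex.exp s / (Complex.I * b * Λ i)).im ∧
      Complex.log (Complex.exp s / (Complex.I * b * Λ i)) =
        s - Complex.log (Complex.I * b * Λ i)) :
    Tendsto (fun i => FInfTilde b θ₀ θs (Complex.exp s / (Complex.I * b * Λ i)) (Λ i)) l
      (𝓝 (M *ᵥ confX b θ₀ θs s)) := by
  refine (tendsto_mulVec hM (tendsto_scaledF0 hX hθ₀ (hs.mono fun _ h => h.2))).congr' ?_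
  filter_upwards [hs, eventually_two_mul_ne_intCast hX hre (-θs)] with i hi h₂
  rw [FInfTilde_eq hb hθ₀ (by simpa only [← sub_eq_add_neg] using h₂) hi.1]

lemma tendsto_connInf1Tilde (hb : b ≠ 0) (hX : Tendsto (fun i => ‖Complex.I * b * Λ i‖) l atTop)
    (hre : ∀ i, (Complex.I * b * Λ i).re = 0) {A B S : Matrix (Fin 2) (Fin 2) ℂ}
    (hA : Tendsto (fun i => scaledConn10 b θ₀ θs (Λ i)) l (𝓝 A))
    (hB : Tendsto (fun i => scaledConnInf0 b θ₀ θs (Λ i)) l (𝓝 B))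
    (hdet : A.det ≠ 0) (hS : S * A = B) :
    Tendsto (fun i => connInf1Tilde b θ₀ θs (Λ i)) l (𝓝 S) := by
  refine tendsto_of_mul_eq hA hB hdet ?_ hS
  filter_upwards [eventually_two_mul_ne_intCast hX hre θs, hX.eventually_gt_atTop 0] with i h₁ hi
  exact connInf1Tilde_mul_scaledConn10 hb (right_ne_zero_of_mul (norm_pos_iff.1 hi)) h₁

end

/-! ### Large real `Λ` of either sign -/

section

variable {b : ℝ}

lemma tendsto_norm_I_mul (hb : 0 < b) :
    Tendsto (fun L : ℝ => ‖Complex.I * b * (L : ℂ)‖) atTop atTop := by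
  have h : Tendsto (fun L : ℝ => b * |L|) atTop atTop :=
    tendsto_abs_atTop_atTop.const_mul_atTop hb
  refine h.congr fun L => ?_
  simp [abs_of_pos hb]

lemma log_I_mul (hb : 0 < b) {L : ℝ} (hL : 0 < L) :
    Complex.log (Complex.I * b * L) = Real.log (b * L) + Real.pi / 2 * Complex.I := by
  rw [show Complex.I * b * L = ((b * L : ℝ) : ℂ) * Complex.I by push_cast; ring,
    Complex.log_ofReal_mul (mul_pos hb hL) Complex.I_ne_zero, Complex.log_I]

lemma log_neg_I_mul (hb : 0 < b) {L : ℝ} (hL : 0 < L) :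
    Complex.log (-(Complex.I * b * L)) = Real.log (b * L) - Real.pi / 2 * Complex.I := by
  rw [show -(Complex.I * b * L) = ((b * L : ℝ) : ℂ) * -Complex.I by push_cast; ring,
    Complex.log_ofReal_mul (mul_pos hb hL) (neg_ne_zero.2 Complex.I_ne_zero), Complex.log_neg_I]
  ring

lemma log_exp_div_pos (hb : 0 < b) {L : ℝ} (hL : 0 < L) {s : ℂ} (h0 : Real.pi / 2 < s.im)
    (h1 : s.im < 3 * Real.pi / 2) :
    0 < (Complex.exp s / (Complex.I * b * L)).im ∧
      Complex.log (Complex.exp s / (Complex.I * b * L)) = s - Complex.log (Complex.I * b * L) := by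
  have hne : Complex.I * b * L ≠ 0 := mul_ne_zero (mul_ne_zero Complex.I_ne_zero
    (Complex.ofReal_ne_zero.2 hb.ne')) (Complex.ofReal_ne_zero.2 hL.ne')
  have him : (s - Complex.log (Complex.I * b * L)).im = s.im - Real.pi / 2 := by
    rw [log_I_mul hb hL]
    simp
  exact log_exp_div hne (by rw [him]; linarith) (by rw [him]; linarith)

lemma log_exp_div_neg (hb : 0 < b) {L : ℝ} (hL : 0 < L) {s : ℂ} (h0 : -(Real.pi / 2) < s.im)
    (h1 : s.im < Real.pi / 2) :
    0 < (Complex.exp s / (Complex.I * b * -L)).im ∧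
      Complex.log (Complex.exp s / (Complex.I * b * -L)) =
        s - Complex.log (Complex.I * b * -L) := by
  have hne : Complex.I * b * -L ≠ 0 := mul_ne_zero (mul_ne_zero Complex.I_ne_zero
    (Complex.ofReal_ne_zero.2 hb.ne')) (neg_ne_zero.2 (Complex.ofReal_ne_zero.2 hL.ne'))
  have him : (s - Complex.log (Complex.I * b * -L)).im = s.im + Real.pi / 2 := by
    rw [mul_neg, log_neg_I_mul hb hL]
    simp
  exact log_exp_div hne (by rw [him]; linarith) (by rw [him]; linarith)

end

section

variable {b : ℝ} {θ₀ θs : ℂ}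

lemma tendsto_scaledConn10_pos (hb : 0 < b) :
    Tendsto (fun L : ℝ => scaledConn10 b θ₀ θs L) atTop (𝓝 (connD b θ₀ θs 2)) := by
  rw [connD_two]
  refine tendsto_scaledConn10 (ε := 1) (Λ := fun L : ℝ => (L : ℂ))
    (Complex.ofReal_ne_zero.2 hb.ne') (tendsto_norm_I_mul hb) (fun L => by simp) ?_
  filter_upwards [eventually_gt_atTop 0] with L hL
  rw [log_I_mul hb hL, log_neg_I_mul hb hL]
  ring

lemma tendsto_scaledConnInf0_pos (hb : 0 < b) :
    Tendsto (fun L : ℝ => scaledConnInf0 b θ₀ θs L) atTop (𝓝 (connD b θ₀ θs 3)) := by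
  have h := tendsto_scaledConnInf0 (θ₀ := θ₀) (θs := θs) (ε := 1) (Λ := fun L : ℝ => (L : ℂ))
    (Complex.ofReal_ne_zero.2 hb.ne') (tendsto_norm_I_mul hb) (fun L => by simp) (by
      filter_upwards [eventually_gt_atTop 0] with L hL
      rw [log_I_mul hb hL, log_neg_I_mul hb hL]
      ring)
  rwa [show ((1 : ℂ) + 1) / 2 = 1 by norm_num, ← connD_three] at h

lemma tendsto_scaledConn10_neg (hb : 0 < b) :
    Tendsto (fun L : ℝ => scaledConn10 b θ₀ θs (-L)) atTop (𝓝 (connD b θ₀ θs 1)) := by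
  have h := tendsto_scaledConn10 (θ₀ := θ₀) (θs := θs) (ε := -1) (Λ := fun L : ℝ => (-L : ℂ))
    (Complex.ofReal_ne_zero.2 hb.ne') (by simpa using tendsto_norm_I_mul hb) (fun L => by simp) (by
      filter_upwards [eventually_gt_atTop 0] with L hL
      rw [mul_neg, neg_neg, log_I_mul hb hL, log_neg_I_mul hb hL]
      ring)
  rwa [neg_div, ← connD_one] at h

lemma tendsto_scaledConnInf0_neg (hb : 0 < b) :
    Tendsto (fun L : ℝ => scaledConnInf0 b θ₀ θs (-L)) atTop (𝓝 (connD b θ₀ θs 2)) := by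
  have h := tendsto_scaledConnInf0 (θ₀ := θ₀) (θs := θs) (ε := -1) (Λ := fun L : ℝ => (-L : ℂ))
    (Complex.ofReal_ne_zero.2 hb.ne') (by simpa using tendsto_norm_I_mul hb) (fun L => by simp) (by
      filter_upwards [eventually_gt_atTop 0] with L hL
      rw [mul_neg, neg_neg, log_I_mul hb hL, log_neg_I_mul hb hL]
      ring)
  rwa [add_neg_cancel, zero_div, ← connD_two] at h

/-- The reduction of the limits on a sheet `j` of the universal cover to those on the first one. -/
lemma tendsto_phase_mulVec {F : ℝ → Fin 2 → ℂ} {n : ℤ} {s : ℂ} (N : ℕ)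
    (h : Tendsto F atTop (𝓝 (confD b θ₀ θs n (s - 2 * Real.pi * Complex.I * N)))) :
    Tendsto (fun L => phase b θs ^ N *ᵥ F L) atTop (𝓝 (confD b θ₀ θs (n + 2 * N) s)) := by
  rw [confD_add_two_mul]
  exact tendsto_mulVec tendsto_const_nhds h

lemma zPoint_succ (b Λ : ℂ) (N : ℕ) (s : ℂ) : zPoint b Λ (N + 1) s =
    Complex.exp (s - 2 * Real.pi * Complex.I * N) / (Complex.I * b * Λ) := by
  rw [zPoint]
  push_cast
  rw [add_sub_cancel_right]

lemma sub_two_pi_I_mul_im (s : ℂ) (N : ℕ) :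
    (s - 2 * Real.pi * Complex.I * N).im = s.im - 2 * Real.pi * N := by
  simp

end

end ConfluentBPZ

theorem proposition2p4 (b : ℝ) (hb : 0 < b) (θ₀ θs : ℂ)
    (hθ₀ : ∀ m : ℤ, 2 * Complex.I * (b : ℂ) * θ₀ ≠ (m : ℂ)) :
    -- confluent limits of the two bases
    (∀ j : ℕ, 1 ≤ j →
      (∀ s ∈ sectorMinus (2 * j + 1),
        Tendsto (fun Λ : ℝ => phase b θs ^ (j - 1) *ᵥ FInfTilde b θ₀ θs (zPoint b Λ j s) Λ) atTop
          (𝓝 (confD b θ₀ θs (2 * j + 1) s))) ∧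
      (∀ s ∈ sectorMinus (2 * j),
        Tendsto (fun Λ : ℝ => phase b θs ^ (j - 1) *ᵥ
            FInfTilde b θ₀ θs (zPoint b (-Λ) j s) (-Λ)) atTop
          (𝓝 (confD b θ₀ θs (2 * j) s))) ∧
      (∀ s ∈ sectorPlus (2 * j),
        Tendsto (fun Λ : ℝ => phase b θs ^ (j - 1) *ᵥ F1Tilde b θ₀ θs (zPoint b Λ j s) Λ) atTop
          (𝓝 (confD b θ₀ θs (2 * j) s))) ∧
      (∀ s ∈ sectorPlus (2 * j - 1),
        Tendsto (fun Λ : ℝ => phase b θs ^ (j - 1) *ᵥ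
            F1Tilde b θ₀ θs (zPoint b (-Λ) j s) (-Λ)) atTop
          (𝓝 (confD b θ₀ θs (2 * j - 1) s)))) ∧
    -- the renormalized connection matrix and the Stokes matrices
    (∀ Λ : ℝ, Λ ≠ 0 →
      (∀ m : ℤ, Complex.I * (b : ℂ) * (Λ + θs) ≠ (m : ℂ)) →
      (∀ m : ℤ, Complex.I * (b : ℂ) * (Λ - θs) ≠ (m : ℂ)) →
      ∀ C : Matrix (Fin 2) (Fin 2) ℂ,
        IsConnInf1Tilde b θ₀ θs Λ C ↔ C = connInf1Tilde b θ₀ θs Λ) ∧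
    (∀ S : Matrix (Fin 2) (Fin 2) ℂ, IsStokesMatrix b θ₀ θs 1 S ↔ S = stokes1 b θ₀ θs) ∧
    (∀ S : Matrix (Fin 2) (Fin 2) ℂ, IsStokesMatrix b θ₀ θs 2 S ↔ S = stokes2 b θ₀ θs) ∧
    -- confluent limits of the connection matrix
    Tendsto (fun Λ : ℝ => connInf1Tilde b θ₀ θs Λ) atTop (𝓝 (stokes2 b θ₀ θs)) ∧
    Tendsto (fun Λ : ℝ => connInf1Tilde b θ₀ θs (-Λ)) atTop (𝓝 (stokes1 b θ₀ θs)) := by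
  have hb' : (b : ℂ) ≠ 0 := Complex.ofReal_ne_zero.2 hb.ne'
  have hX := tendsto_norm_I_mul hb
  have hX' : Tendsto (fun L : ℝ => ‖Complex.I * b * (-L : ℂ)‖) atTop atTop := by
    simpa using hX
  have hre : ∀ L : ℝ, (Complex.I * b * (L : ℂ)).re = 0 := fun L => by simp
  have hre' : ∀ L : ℝ, (Complex.I * b * (-L : ℂ)).re = 0 := fun L => by simp
  refine ⟨fun j hj => ?_, fun Λ hΛ h₁ h₂ C => isConnInf1Tilde_iff hb'
    (Complex.ofReal_ne_zero.2 hΛ) hθ₀ h₁ h₂ C,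
    isStokesMatrix_iff hθ₀ (det_connD_one_ne_zero hθ₀) stokes1_mul_connD,
    isStokesMatrix_iff hθ₀ (det_connD_two_ne_zero hθ₀) stokes2_mul_connD,
    tendsto_connInf1Tilde hb' hX hre (tendsto_scaledConn10_pos hb) (tendsto_scaledConnInf0_pos hb)
      (det_connD_two_ne_zero hθ₀) stokes2_mul_connD,
    tendsto_connInf1Tilde hb' hX' hre' (tendsto_scaledConn10_neg hb)
      (tendsto_scaledConnInf0_neg hb) (det_connD_one_ne_zero hθ₀) stokes1_mul_connD⟩
  obtain ⟨N, rfl⟩ : ∃ N, j = N + 1 := ⟨j - 1, by omega⟩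
  simp only [zPoint_succ, Nat.add_sub_cancel]
  refine ⟨fun s hs => ?_, fun s hs => ?_, fun s hs => ?_, fun s hs => ?_⟩
  · rw [show (2 * ((N + 1 : ℕ) : ℤ) + 1) = 3 + 2 * N by push_cast; ring] at hs ⊢
    obtain ⟨h0, h1⟩ := hs
    push_cast at h0 h1
    refine tendsto_phase_mulVec N ?_
    rw [confD_eq_connD_mulVec hθ₀]
    refine tendsto_FInfTilde hb' hθ₀ hX hre (tendsto_scaledConnInf0_pos hb) ?_
    filter_upwards [eventually_gt_atTop 0] with L hL
    refine log_exp_div_pos hb hL ?_ ?_ <;> rw [sub_two_pi_I_mul_im] <;> linarith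
  · rw [show (2 * ((N + 1 : ℕ) : ℤ)) = 2 + 2 * N by push_cast; ring] at hs ⊢
    obtain ⟨h0, h1⟩ := hs
    push_cast at h0 h1
    refine tendsto_phase_mulVec N ?_
    rw [confD_eq_connD_mulVec hθ₀]
    refine tendsto_FInfTilde hb' hθ₀ hX' hre' (tendsto_scaledConnInf0_neg hb) ?_
    filter_upwards [eventually_gt_atTop 0] with L hL
    refine log_exp_div_neg hb hL ?_ ?_ <;> rw [sub_two_pi_I_mul_im] <;> linarith
  · rw [show (2 * ((N + 1 : ℕ) : ℤ)) = 2 + 2 * N by push_cast; ring] at hs ⊢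
    obtain ⟨h0, h1⟩ := hs
    push_cast at h0 h1
    refine tendsto_phase_mulVec N ?_
    rw [confD_eq_connD_mulVec hθ₀]
    refine tendsto_F1Tilde hb' hθ₀ hX hre (tendsto_scaledConn10_pos hb) ?_
    filter_upwards [eventually_gt_atTop 0] with L hL
    refine log_exp_div_pos hb hL ?_ ?_ <;> rw [sub_two_pi_I_mul_im] <;> linarith
  · rw [show (2 * ((N + 1 : ℕ) : ℤ) - 1) = 1 + 2 * N by push_cast; ring] at hs ⊢
    obtain ⟨h0, h1⟩ := hs
    push_cast at h0 h1
    refine tendsto_phase_mulVec N ?_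
    rw [confD_eq_connD_mulVec hθ₀]
    refine tendsto_F1Tilde hb' hθ₀ hX' hre' (tendsto_scaledConn10_neg hb) ?_
    filter_upwards [eventually_gt_atTop 0] with L hL
    refine log_exp_div_neg hb hL ?_ ?_ <;> rw [sub_two_pi_I_mul_im] <;> linarith
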